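/- Let targets $p_1,p_2,\dots$ form a Poisson point process of intensity $\lambda>0$ on $\mathbb{R}^2$, and let the reward $r(p_i)\ge 0$ of each target be drawn independently (of the other rewards and of the target locations) from a common distribution function $F$ on $[0,\infty)$ with light tail, in the sense that $$\int_0^\infty (1-F(s))^{1/2}\,ds<\infty$$ (this holds in particular whenever $1-F(x)\le a e^{-bx}$ for all $x>0$ and some $a,b>0$). A robot moves with unit agility: $\dot x_1(t)=v$, $\dot x_2(t)=u(t)$, $|u(t)|\le v$, where $v>0$ is fixed and the control $u$ is measurable. Let $T_2^*(L)$ be the maximum, over all such paths that start from the origin and travel the longitudinal distance $L$, of the total reward $\sum_{p_i\in\pi} r(p_i)$ of the targets on the path $\pi$, and let $$\mathbf{R}^*_2:=\sup_{L>0}\frac{\mathbb{E}[T_2^*(L)]}{L}.$$ The receding-horizon algorithm with sensing distance $S>0$ starts at the origin. In each iteration the robot chooses, using only the locations and rewards of the targets sensed so far (at longitudinal coordinate $x_1$ it senses all targets with longitudinal coordinate in $[x_1,x_1+S]$), a feasible path of longitudinal length $S$ from its current state that maximizes the collected reward, ties being broken in an arbitrary measurable way; it executes this path to its end, and repeats as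 long as the distance travelled is less than $L$. Let $T_i$ be the reward collected in the $i$-th iteration and $$R_{\mathrm{iterative}}(L;S):=\frac1L\sum_{i=1}^{\lceil L/S\rceil}T_i .$$ Then $\mathbf{R}^*_2<\infty$, and there is a constant $c>0$ such that, for every choice of the maximizing paths and every $\delta>0$, $$\lim_{L\to\infty}\mathbb{P}\Big(\big|R_{\mathrm{iterative}}(L;c\log L)-\mathbf{R}^*_2\big|\ge\delta\Big)=0 .$$ -/

import Mathlib

open MeasureTheory ProbabilityTheory Set Filter Topology
open scoped NNReal ENNReal

namespace RewardField

/-- The targets `p i` (points of the plane) with rewards `r i` form, under `P`, a marked point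
process: a homogeneous Poisson point process on the plane of intensity `lam`, whose points carry
rewards that are i.i.d. with law `F` and independent of the target locations.
The field `poisson` is the law of the numbers of targets in disjoint regions: they are independent
and the number in `A` is Poisson with mean `lam * |A|`. -/
structure IsPoissonRewardField {Ω : Type*} [MeasurableSpace Ω] (P : Measure Ω) (lam : ℝ≥0)
    (F : Measure ℝ≥0) (p : ℕ → Ω → ℝ × ℝ) (r : ℕ → Ω → ℝ≥0) : Prop where
  measurable_location : ∀ i, Measurable (p i)
  measurable_reward : ∀ i, Measurable (r i)
  locally_finite : ∀ᵐ ω ∂P, ∀ B : Set (ℝ × ℝ), Bornology.IsBounded B → {i | p i ω ∈ B}.Finite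
  simple : ∀ᵐ ω ∂P, Function.Injective (fun i => p i ω)
  poisson : ∀ (k : ℕ) (A : Fin k → Set (ℝ × ℝ)), (∀ j, MeasurableSet (A j)) →
    (∀ j, volume (A j) ≠ ∞) → Pairwise (fun i j => Disjoint (A i) (A j)) →
    ∀ n : Fin k → ℕ,
      P {ω | ∀ j, {i | p i ω ∈ A j}.encard = (n j : ℕ∞)}
        = ∏ j, poissonMeasure (lam * (volume (A j)).toNNReal) {n j}
  law_reward : ∀ i, P.map (r i) = F
  iid_reward : iIndepFun r P
  indep_location : IndepFun (fun ω i => p i ω) (fun ω i => r i ω) P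

/-- `x` solves, on the time interval `[0, τ]` and from the state `z`, the dynamics
`x₁' = v`, `x₂' = u(t)` for some measurable control `u` with `|u(t)| ≤ w`. -/
def IsTrajectory (v w τ : ℝ) (z : ℝ × ℝ) (x : ℝ → ℝ × ℝ) : Prop :=
  ∃ u : ℝ → ℝ, Measurable u ∧ (∀ t, |u t| ≤ w) ∧
    ∀ t ∈ Icc 0 τ, x t = (z.1 + v * t, z.2 + ∫ s in 0..t, u s)

/-- Total reward collected along `x` during `[0, τ]`, for targets at `p i` with rewards `r i`. -/
noncomputable def collected (p : ℕ → ℝ × ℝ) (r : ℕ → ℝ≥0) (τ : ℝ) (x : ℝ → ℝ × ℝ) : ℝ≥0∞ :=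
  ∑' i : {i : ℕ // ∃ t ∈ Icc 0 τ, x t = p i}, (r i : ℝ≥0∞)

/-- `T*(L)`: the optimal total reward along feasible paths that start from the origin and travel
a longitudinal distance `L`. -/
noncomputable def optimalReward (v w : ℝ) (p : ℕ → ℝ × ℝ) (r : ℕ → ℝ≥0) (L : ℝ) : ℝ≥0∞ :=
  ⨆ (x : ℝ → ℝ × ℝ) (_ : IsTrajectory v w (L / v) 0 x), collected p r (L / v) x

/-- `R*`: the optimal mean reward, `sup_{L > 0} E[T*(L)] / L`. -/
noncomputable def optimalMeanReward {Ω : Type*} [MeasurableSpace Ω] (P : Measure Ω) (v w : ℝ)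
    (p : ℕ → Ω → ℝ × ℝ) (r : ℕ → Ω → ℝ≥0) : ℝ≥0∞ :=
  ⨆ (L : ℝ) (_ : 0 < L),
    (∫⁻ ω, optimalReward v w (fun i => p i ω) (fun i => r i ω) L ∂P) / ENNReal.ofReal L

/-- The part of the plane that a robot with sensing distance `S` has sensed while its longitudinal
coordinate increased from `0` to `d`. -/
def sensedRegion (S d : ℝ) : Set (ℝ × ℝ) :=
  ⋃ s ∈ Icc 0 d, {q : ℝ × ℝ | 0 ≤ q.1 - s ∧ q.1 - s ≤ S}

/-- The information (σ-algebra) carried by the locations and rewards of the targets lying in the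
region `B`: it is generated by the numbers of targets in Borel subsets of `B` with reward in Borel
sets. -/
@[reducible] def information {Ω : Type*} (p : ℕ → Ω → ℝ × ℝ) (r : ℕ → Ω → ℝ≥0) (B : Set (ℝ × ℝ)) :
    MeasurableSpace Ω :=
  MeasurableSpace.generateFrom
    {E | ∃ (A : Set (ℝ × ℝ)) (C : Set ℝ≥0) (n : ℕ∞), MeasurableSet A ∧ A ⊆ B ∧ MeasurableSet C ∧
      E = {ω | {i | p i ω ∈ A ∧ r i ω ∈ C}.encard = n}}

/-- The state of the robot at the start of iteration `k` (counted from `0`) when it starts at the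
origin and executes the path `X k` of longitudinal length `S` in iteration `k`. -/
noncomputable def startState {Ω : Type*} (v S : ℝ) (X : ℕ → Ω → ℝ → ℝ × ℝ) : ℕ → Ω → ℝ × ℝ
  | 0, _ => 0
  | k + 1, ω => X k ω (S / v)

/-- `X` is a run of the receding-horizon algorithm with sensing distance `S`. In iteration `k` the
robot, at longitudinal coordinate `k * S`, plans a feasible path of longitudinal length `S` from its
current state that maximizes the collected reward among all such paths, and executes it to its end.
The plan depends only on the targets sensed up to the moment of planning; ties are otherwise broken
arbitrarily. -/
structure IsRecedingHorizonRun {Ω : Type*} [MeasurableSpace Ω] (P : Measure Ω) (v w : ℝ)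
    (p : ℕ → Ω → ℝ × ℝ) (r : ℕ → Ω → ℝ≥0) (S : ℝ) (X : ℕ → Ω → ℝ → ℝ × ℝ) : Prop where
  feasible : ∀ k ω, IsTrajectory v w (S / v) (startState v S X k ω) (X k ω)
  optimal : ∀ᵐ ω ∂P, ∀ (k : ℕ) (x : ℝ → ℝ × ℝ), IsTrajectory v w (S / v) (startState v S X k ω) x →
    collected (fun i => p i ω) (fun i => r i ω) (S / v) x
      ≤ collected (fun i => p i ω) (fun i => r i ω) (S / v) (X k ω)
  adapted : ∀ k : ℕ, ∀ t ∈ Icc 0 (S / v),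
    Measurable[information p r (sensedRegion S (k * S))] (fun ω => X k ω t)

/-- Mean reward of the run `X`: the total reward of its iterations divided by `L`. A new iteration
is started as long as the distance travelled is less than `L`, so that there are `⌈L / S⌉` of
them. -/
noncomputable def meanReward {Ω : Type*} (v : ℝ) (p : ℕ → Ω → ℝ × ℝ) (r : ℕ → Ω → ℝ≥0)
    (L S : ℝ) (X : ℕ → Ω → ℝ → ℝ × ℝ) (ω : Ω) : ℝ≥0∞ :=
  (∑ k ∈ Finset.range ⌈L / S⌉₊,
    collected (fun i => p i ω) (fun i => r i ω) (S / v) (X k ω)) / ENNReal.ofReal L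

end RewardField

/-! A unit-agility path is, with time eliminated, the graph of a 1-Lipschitz function. So the best
reward from a given state is a supremum over chains: finite sets of targets that satisfy the slope
constraint `|Δx₂| ≤ |Δx₁|` with each other and with the state. This optimum only involves the
targets in the strip ahead of the state.

Independence. The state at the start of iteration `k` is a function of the targets with `x₁ ≤ kS`.
The field beyond `kS` is independent of these targets, and its law is invariant under lateral
translation, so the reward of iteration `k` has the law of `T*(S)` and is independent of the past,
however ties are broken (`map_prod_gridValue`). The two properties of the field come from its
characteristic function (`integral_exp_markSum`). To insert a random starting state, the optimum is
written as a jointly measurable function of the state and of the rewards in the cells of countably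
many grids (`chainValue_eq_gridValue`).

Finiteness of `R*`. Among targets of intensity `μ`, a path of length `L` meets `O(√μ L)` in the
mean: about `√μ L` steps of a lattice path with three choices per step describe a tube around it,
and a union bound over tubes with exponential moments gives the estimate. Slicing a reward as `r ≤
∑ₖ 1{r > k}` and adding the bounds for the intensities `λ(1 - F(k))` produces `∫ (1 - F)^{1/2}`.

Limit. Concatenated iterations form one feasible path, so the mean optimum `G` satisfies `n G(S) ≤
G(nS)`, and a Fekete argument gives `G(S)/S → R*`. Since `T*(S)` is at most the total reward in an
`S × 2S` box, its second moment is `O(S⁴)`. With `S = log L` and about `L/S` pairwise independent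
iterations, the total has variance `O(L log³ L)`, negligible against `L²`; Chebyshev's inequality
concludes with `c = 1`. -/

namespace RewardField

/-! ### Feasible paths and chains of targets -/

/-- The finite index sets whose points lie in `D` and, together with `z`, satisfy pairwise the slope
constraint of a robot of unit agility. -/
def chains (D : Set (ℝ × ℝ)) (z : ℝ × ℝ) (p : ℕ → ℝ × ℝ) : Set (Finset ℕ) :=
  {I | (∀ i ∈ I, p i ∈ D ∧ |(p i).2 - z.2| ≤ |(p i).1 - z.1|) ∧
    ∀ i ∈ I, ∀ j ∈ I, |(p i).2 - (p j).2| ≤ |(p i).1 - (p j).1|}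

/-- The largest reward of a chain of points of `D` that starts at `z`. -/
noncomputable def chainValue (D : Set (ℝ × ℝ)) (z : ℝ × ℝ) (p : ℕ → ℝ × ℝ) (r : ℕ → ℝ≥0) : ℝ≥0∞ :=
  ⨆ I ∈ chains D z p, ∑ i ∈ I, (r i : ℝ≥0∞)

theorem IsTrajectory.fst_eq {v w τ : ℝ} {z : ℝ × ℝ} {x : ℝ → ℝ × ℝ} (h : IsTrajectory v w τ z x)
    {t : ℝ} (ht : t ∈ Icc 0 τ) : (x t).1 = z.1 + v * t := by
  obtain ⟨u, -, -, hx⟩ := h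
  rw [hx t ht]

theorem IsTrajectory.apply_zero {v w τ : ℝ} {z : ℝ × ℝ} {x : ℝ → ℝ × ℝ}
    (h : IsTrajectory v w τ z x) (hτ : 0 ≤ τ) : x 0 = z := by
  obtain ⟨u, -, -, hx⟩ := h
  rw [hx 0 ⟨le_rfl, hτ⟩]
  simp

theorem IsTrajectory.abs_snd_sub_le {v w τ : ℝ} {z : ℝ × ℝ} {x : ℝ → ℝ × ℝ}
    (h : IsTrajectory v w τ z x) {s t : ℝ} (hs : s ∈ Icc 0 τ) (ht : t ∈ Icc 0 τ) :
    |(x t).2 - (x s).2| ≤ w * |t - s| := by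
  obtain ⟨u, hu, hub, hx⟩ := h
  have hint : ∀ a b, IntervalIntegrable u volume a b := fun a b =>
    (intervalIntegrable_const (c := w)).mono_fun hu.aestronglyMeasurable
      (ae_of_all _ fun t => by
        simpa using (hub t).trans (le_abs_self w))
  rw [hx t ht, hx s hs]
  have : z.2 + (∫ s in 0..t, u s) - (z.2 + ∫ s in 0..s, u s) = ∫ y in s..t, u y := by
    rw [add_sub_add_left_eq_sub, intervalIntegral.integral_interval_sub_left (hint _ _) (hint _ _)]
  simp only [this]
  simpa only [Real.norm_eq_abs] using
    intervalIntegral.norm_integral_le_of_norm_le_const (a := s) (b := t) (f := u) (C := w)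
      fun y _ => hub y

/-- The longitudinal speed is exactly `v` and the lateral speed at most `v`, so eliminating time
leaves a constraint free of `v`. -/
theorem IsTrajectory.cone {v τ : ℝ} (hv : 0 < v) {z : ℝ × ℝ} {x : ℝ → ℝ × ℝ}
    (h : IsTrajectory v v τ z x) {s t : ℝ} (hs : s ∈ Icc 0 τ) (ht : t ∈ Icc 0 τ) :
    |(x t).2 - (x s).2| ≤ |(x t).1 - (x s).1| := by
  rw [h.fst_eq hs, h.fst_eq ht, add_sub_add_left_eq_sub, ← mul_sub, abs_mul, abs_of_pos hv]
  exact h.abs_snd_sub_le hs ht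

/-- A Lipschitz function is absolutely continuous, hence the integral of its derivative, which
serves as the control. Where the derivative fails to exist `deriv` is zero, so the bound on the
control holds at every time. -/
theorem isTrajectory_of_lipschitz {v : ℝ} (hv : 0 ≤ v) (τ : ℝ) (z : ℝ × ℝ) {g : ℝ → ℝ}
    (hg : LipschitzWith v.toNNReal g) (h0 : g 0 = z.2) :
    IsTrajectory v v τ z (fun t => (z.1 + v * t, g t)) := by
  refine ⟨deriv g, measurable_deriv g, fun t => ?_, fun t _ => ?_⟩
  · simpa [hv] using norm_deriv_le_of_lipschitz (x₀ := t) hg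
  · rw [(hg.lipschitzOnWith (s := uIcc 0 t)).absolutelyContinuousOnInterval.integral_deriv_eq_sub,
      h0]
    simp

/-- Every chain lies on a feasible path. -/
theorem exists_trajectory_of_chain {v τ : ℝ} (hv : 0 < v) {z : ℝ × ℝ} {p : ℕ → ℝ × ℝ}
    {I : Finset ℕ} (hI : I ∈ chains {q | z.1 ≤ q.1 ∧ q.1 ≤ z.1 + v * τ} z p) :
    ∃ x, IsTrajectory v v τ z x ∧ ∀ i ∈ I, ∃ t ∈ Icc 0 τ, x t = p i := by
  classical
  set T : ℕ → ℝ := fun i => ((p i).1 - z.1) / v with hT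
  have hTv : ∀ i, v * T i = (p i).1 - z.1 := fun i => by rw [hT]; field_simp
  -- Lateral position as a function of arrival time. Targets of the chain with the same arrival time
  -- have the same lateral coordinate by the slope constraint, so the choice is harmless; the
  -- default `z.2` is the right value at time `0`.
  let f : ℝ → ℝ := fun t => if h : ∃ i ∈ I, T i = t then (p h.choose).2 else z.2
  have hf : ∀ i ∈ I, f (T i) = (p i).2 := by
    intro i hi
    have h : ∃ j ∈ I, T j = T i := ⟨i, hi, rfl⟩
    have hs := h.choose_spec
    simp only [f, dif_pos h]
    have := hI.2 _ hs.1 i hi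
    have e : (p h.choose).1 = (p i).1 := by
      have h1 := hTv h.choose
      rw [hs.2, hTv i] at h1
      linarith
    rw [e, sub_self, abs_zero, abs_nonpos_iff] at this
    linarith
  have h0 : f 0 = z.2 := by
    by_cases h : ∃ i ∈ I, T i = 0
    · have hs := h.choose_spec
      simp only [f, dif_pos h]
      have := (hI.1 _ hs.1).2
      have h1 := hTv h.choose
      rw [hs.2, mul_zero] at h1
      rw [← h1, abs_zero, abs_nonpos_iff] at this
      linarith
    · simp only [f, dif_neg h]
  have hlip : LipschitzOnWith v.toNNReal f (insert 0 (T '' I)) := by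
    apply LipschitzOnWith.of_dist_le_mul
    have key : ∀ i j, |(p i).1 - (p j).1| = v * |T i - T j| := fun i j => by
      have e : (p i).1 - (p j).1 = v * (T i - T j) := by rw [mul_sub, hTv, hTv]; ring
      rw [e, abs_mul, abs_of_pos hv]
    have key0 : ∀ i, |(p i).1 - z.1| = v * |T i| := fun i => by
      rw [← hTv, abs_mul, abs_of_pos hv]
    rintro _ (rfl | ⟨i, hi, rfl⟩) _ (rfl | ⟨j, hj, rfl⟩)
    · simp
    · rw [h0, hf j hj, Real.dist_eq, Real.dist_eq, Real.coe_toNNReal _ hv.le, abs_sub_comm, zero_sub,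
        abs_neg, ← key0]
      exact (hI.1 j hj).2
    · rw [h0, hf i hi, Real.dist_eq, Real.dist_eq, Real.coe_toNNReal _ hv.le, sub_zero, ← key0]
      exact (hI.1 i hi).2
    · rw [hf j hj, hf i hi, Real.dist_eq, Real.dist_eq, Real.coe_toNNReal _ hv.le, ← key]
      exact hI.2 i hi j hj
  -- A Lipschitz extension from the finite set of arrival times to the line gives the path.
  obtain ⟨g, hg, hgf⟩ := hlip.extend_real
  refine ⟨_, isTrajectory_of_lipschitz hv.le τ z hg (by rw [← hgf (by simp), h0]), fun i hi => ?_⟩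
  refine ⟨T i, ?_, ?_⟩
  · have := (hI.1 i hi).1
    simp only [mem_ofPred_eq] at this
    constructor
    · exact div_nonneg (by linarith) hv.le
    · rw [hT]; simp only
      rw [div_le_iff₀ hv]; linarith
  · ext
    · simp [hTv]
    · simp only
      rw [← hgf (by right; exact ⟨i, hi, rfl⟩), hf i hi]

theorem sum_le_collected {p : ℕ → ℝ × ℝ} (r : ℕ → ℝ≥0) {τ : ℝ} {x : ℝ → ℝ × ℝ} {I : Finset ℕ}
    (h : ∀ i ∈ I, ∃ t ∈ Icc 0 τ, x t = p i) : ∑ i ∈ I, (r i : ℝ≥0∞) ≤ collected p r τ x := by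
  classical
  have : ∑ i ∈ I, (r i : ℝ≥0∞) =
      ∑ i ∈ I.subtype (fun i => ∃ t ∈ Icc 0 τ, x t = p i), (r i : ℝ≥0∞) := by
    rw [← Finset.sum_subtype_of_mem _ h]
  rw [this]
  exact ENNReal.sum_le_tsum _

theorem collected_le {p : ℕ → ℝ × ℝ} {r : ℕ → ℝ≥0} {τ : ℝ} {x : ℝ → ℝ × ℝ} {c : ℝ≥0∞}
    (h : ∀ I : Finset ℕ, (∀ i ∈ I, ∃ t ∈ Icc 0 τ, x t = p i) → ∑ i ∈ I, (r i : ℝ≥0∞) ≤ c) :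
    collected p r τ x ≤ c := by
  classical
  rw [collected, ENNReal.tsum_eq_iSup_sum]
  refine iSup_le fun I => ?_
  have := h (I.map (Function.Embedding.subtype _)) (fun i hi => by
    simp only [Finset.mem_map, Function.Embedding.coe_subtype] at hi
    obtain ⟨j, -, rfl⟩ := hi
    exact j.2)
  simpa using this

theorem mem_chains_of_trajectory {v τ : ℝ} (hv : 0 < v) (hτ : 0 ≤ τ) {z : ℝ × ℝ} {p : ℕ → ℝ × ℝ}
    {x : ℝ → ℝ × ℝ} (hx : IsTrajectory v v τ z x) {I : Finset ℕ}
    (h : ∀ i ∈ I, ∃ t ∈ Icc 0 τ, x t = p i) :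
    I ∈ chains {q | z.1 ≤ q.1 ∧ q.1 ≤ z.1 + v * τ} z p := by
  refine ⟨fun i hi => ?_, fun i hi j hj => ?_⟩
  · obtain ⟨t, ht, e⟩ := h i hi
    rw [← e]
    refine ⟨?_, ?_⟩
    · simp only [mem_ofPred_eq, hx.fst_eq ht]
      exact ⟨by nlinarith [ht.1], by nlinarith [ht.2]⟩
    · have := hx.cone hv ⟨le_rfl, hτ⟩ ht
      rwa [hx.apply_zero hτ] at this
  · obtain ⟨t, ht, e⟩ := h i hi
    obtain ⟨s, hs, e'⟩ := h j hj
    rw [← e, ← e']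
    exact hx.cone hv hs ht

/-- This trades an uncountable supremum over paths for one over the countably many finite sets of
indices. -/
theorem iSup_collected_eq_chainValue {v τ : ℝ} (hv : 0 < v) (hτ : 0 ≤ τ) (z : ℝ × ℝ)
    (p : ℕ → ℝ × ℝ) (r : ℕ → ℝ≥0) :
    ⨆ (x : ℝ → ℝ × ℝ) (_ : IsTrajectory v v τ z x), collected p r τ x =
      chainValue {q | z.1 ≤ q.1 ∧ q.1 ≤ z.1 + v * τ} z p r := by
  apply le_antisymm
  · refine iSup₂_le fun x hx => collected_le fun I hI => ?_
    exact le_iSup₂_of_le I (mem_chains_of_trajectory hv hτ hx hI) le_rfl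
  · refine iSup₂_le fun I hI => ?_
    obtain ⟨x, hx, hxI⟩ := exists_trajectory_of_chain hv hI
    exact le_iSup₂_of_le x hx (sum_le_collected r hxI)

theorem optimalReward_eq_chainValue {v : ℝ} (hv : 0 < v) {L : ℝ} (hL : 0 ≤ L) (p : ℕ → ℝ × ℝ)
    (r : ℕ → ℝ≥0) :
    optimalReward v v p r L = chainValue {q | 0 ≤ q.1 ∧ q.1 ≤ L} 0 p r := by
  rw [optimalReward, iSup_collected_eq_chainValue hv (by positivity)]
  simp [mul_div_cancel₀ _ hv.ne']

theorem chains_congr {D D' : Set (ℝ × ℝ)} {z : ℝ × ℝ} {p : ℕ → ℝ × ℝ}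
    (h : ∀ i, p i ∈ D ↔ p i ∈ D') : chains D z p = chains D' z p := by
  simp only [chains, h]

theorem chainValue_congr {D D' : Set (ℝ × ℝ)} {z : ℝ × ℝ} {p : ℕ → ℝ × ℝ} {r : ℕ → ℝ≥0}
    (h : ∀ i, p i ∈ D ↔ p i ∈ D') : chainValue D z p r = chainValue D' z p r := by
  rw [chainValue, chainValue, chains_congr h]

theorem chainValue_mono {D D' : Set (ℝ × ℝ)} (h : D ⊆ D') (z : ℝ × ℝ) (p : ℕ → ℝ × ℝ)
    (r : ℕ → ℝ≥0) : chainValue D z p r ≤ chainValue D' z p r := by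
  refine iSup₂_le fun I hI => le_iSup₂_of_le I ?_ le_rfl
  exact ⟨fun i hi => ⟨h (hI.1 i hi).1, (hI.1 i hi).2⟩, hI.2⟩

/-! ### Poisson counts and products over the targets -/

theorem measurable_encard {Ω : Type*} [MeasurableSpace Ω] {s : ℕ → Set Ω}
    (hs : ∀ i, MeasurableSet (s i)) : Measurable fun ω => {i | ω ∈ s i}.encard := by
  refine measurable_to_countable' fun n => ?_
  have h : ∀ ω, (({i | ω ∈ s i}.encard : ℕ∞) : ℝ≥0∞) = ∑' i, (s i).indicator 1 ω := by
    intro ω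
    rw [← ENNReal.tsum_set_one, tsum_subtype {i | ω ∈ s i} (fun _ => (1 : ℝ≥0∞))]
    rfl
  have hm : Measurable fun ω => ∑' i, (s i).indicator (1 : Ω → ℝ≥0∞) ω :=
    Measurable.tsum fun i => measurable_one.indicator (hs i)
  have : (fun ω => {i | ω ∈ s i}.encard) ⁻¹' {n} =
      (fun ω => ∑' i, (s i).indicator (1 : Ω → ℝ≥0∞) ω) ⁻¹' {(n : ℝ≥0∞)} := by
    ext ω
    simp only [mem_preimage, mem_singleton_iff, ← h, ENat.toENNReal_inj]
  rw [this]
  exact hm (measurableSet_singleton _)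

theorem lintegral_pow_poissonMeasure (m : ℝ≥0) {c : ℝ} (hc : 0 ≤ c) :
    ∫⁻ n, ENNReal.ofReal c ^ n ∂poissonMeasure m = ENNReal.ofReal (Real.exp (m * (c - 1))) := by
  have hs : HasSum (fun n : ℕ => Real.exp (-m) * (m : ℝ) ^ n / n.factorial * c ^ n)
      (Real.exp (m * (c - 1))) := by
    have := (NormedSpace.expSeries_div_hasSum_exp ((m : ℝ) * c)).mul_left (Real.exp (-m))
    rw [← Real.exp_eq_exp_ℝ, ← Real.exp_add] at this
    convert! this using 2
    · rw [mul_pow]; ring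
    · ring
  rw [poissonMeasure, lintegral_sum_measure]
  simp only [lintegral_smul_measure, lintegral_dirac, smul_eq_mul]
  rw [← hs.tsum_eq, ENNReal.ofReal_tsum_of_nonneg (fun n => by positivity) hs.summable]
  refine tsum_congr fun n => ?_
  rw [ENNReal.ofReal_mul (by positivity), ENNReal.ofReal_pow hc]

theorem integral_pow_poissonMeasure (m : ℝ≥0) (c : ℂ) :
    ∫ n, c ^ n ∂poissonMeasure m = Complex.exp (m * (c - 1)) := by
  rw [integral_poissonMeasure]
  have := (NormedSpace.expSeries_div_hasSum_exp ((m : ℂ) * c)).mul_left (Complex.exp (-m))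
  rw [← Complex.exp_eq_exp_ℂ, ← Complex.exp_add] at this
  have h2 := this.tsum_eq
  rw [show -(m : ℂ) + m * c = m * (c - 1) by ring] at h2
  rw [← h2]
  refine tsum_congr fun n => ?_
  rw [Complex.real_smul, mul_pow]
  push_cast
  ring

set_option linter.unusedSectionVars false

variable {Ω : Type*} [MeasurableSpace Ω] {P : Measure Ω} {lam : ℝ≥0} {F : Measure ℝ≥0}
  {p : ℕ → Ω → ℝ × ℝ} {r : ℕ → Ω → ℝ≥0}

/-- The number of targets in `A`. -/
noncomputable def count (p : ℕ → Ω → ℝ × ℝ) (A : Set (ℝ × ℝ)) (ω : Ω) : ℕ :=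
  {i | p i ω ∈ A}.encard.toNat

theorem IsPoissonRewardField.measurable_count (h : IsPoissonRewardField P lam F p r)
    {A : Set (ℝ × ℝ)} (hA : MeasurableSet A) : Measurable (count p A) :=
  (measurable_of_countable ENat.toNat).comp
    (measurable_encard fun i => h.measurable_location i hA)

theorem IsPoissonRewardField.map_count [IsProbabilityMeasure P]
    (h : IsPoissonRewardField P lam F p r)
    {κ : Type*} [Fintype κ] {B : κ → Set (ℝ × ℝ)} (hB : ∀ t, MeasurableSet (B t))
    (hb : ∀ t, Bornology.IsBounded (B t)) (hd : Pairwise fun s t => Disjoint (B s) (B t)) :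
    P.map (fun ω t => count p (B t) ω) =
      Measure.pi fun t => poissonMeasure (lam * (volume (B t)).toNNReal) := by
  have hm : Measurable fun ω t => count p (B t) ω :=
    measurable_pi_lambda _ fun t => h.measurable_count (hB t)
  refine Measure.ext_of_singleton fun n => ?_
  rw [Measure.map_apply hm (measurableSet_singleton n), Measure.pi_singleton]
  let e := Fintype.equivFin κ
  have hp := h.poisson (Fintype.card κ) (fun j => B (e.symm j)) (fun j => hB _)
    (fun j => (hb _).measure_lt_top.ne) (fun i j hij => hd (e.symm.injective.ne hij))
    (fun j => n (e.symm j))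
  rw [← Equiv.prod_comp e.symm, ← hp]
  · refine measure_congr ?_
    filter_upwards [h.locally_finite] with ω hω
    refine propext ?_
    change (fun t => count p (B t) ω) = n ↔
      ∀ j, {i | p i ω ∈ B (e.symm j)}.encard = (n (e.symm j) : ℕ∞)
    -- `count` sends an infinite number to `0`; local finiteness rules this case out.
    have key : ∀ t, count p (B t) ω = n t ↔ {i | p i ω ∈ B t}.encard = (n t : ℕ∞) := fun t => by
      obtain ⟨m, hm⟩ := ENat.ne_top_iff_exists.1 (hω _ (hb t)).encard_lt_top.ne
      rw [count, ← hm]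
      simp
    rw [funext_iff]
    simp_rw [key]
    exact e.symm.forall_congr_right.symm
  
theorem IsPoissonRewardField.map_count_single [IsProbabilityMeasure P]
    (h : IsPoissonRewardField P lam F p r) {A : Set (ℝ × ℝ)} (hA : MeasurableSet A)
    (hb : Bornology.IsBounded A) :
    P.map (count p A) = poissonMeasure (lam * (volume A).toNNReal) := by
  have := h.map_count (κ := Unit) (B := fun _ => A) (fun _ => hA) (fun _ => hb)
    (fun s t hst => (hst rfl).elim)
  have h2 := congrArg (Measure.map fun f : Unit → ℕ => f ()) this
  rw [Measure.map_map (measurable_pi_apply _)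
    (measurable_pi_lambda _ fun t => h.measurable_count hA)] at h2
  rw [(measurePreserving_eval (fun _ : Unit => poissonMeasure (lam * (volume A).toNNReal)) ()).map_eq]
    at h2
  exact h2

theorem IsPoissonRewardField.integral_prod_pow_count [IsProbabilityMeasure P]
    (h : IsPoissonRewardField P lam F p r)
    {κ : Type*} [Fintype κ] {B : κ → Set (ℝ × ℝ)} (hB : ∀ t, MeasurableSet (B t))
    (hb : ∀ t, Bornology.IsBounded (B t)) (hd : Pairwise fun s t => Disjoint (B s) (B t))
    (K : κ → ℂ) :
    ∫ ω, ∏ t, K t ^ count p (B t) ω ∂P =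
      ∏ t, Complex.exp (lam * (volume (B t)).toReal * (K t - 1)) := by
  have hm : Measurable fun ω t => count p (B t) ω :=
    measurable_pi_lambda _ fun t => h.measurable_count (hB t)
  have := integral_map hm.aemeasurable (μ := P)
    (f := fun n : κ → ℕ => ∏ t, K t ^ n t) (measurable_of_countable _).aestronglyMeasurable
  rw [← this, h.map_count hB hb hd, integral_fintype_prod_eq_prod (f := fun t n => K t ^ n)]
  refine Finset.prod_congr rfl fun t _ => ?_
  rw [integral_pow_poissonMeasure]
  simp [ENNReal.toReal]

theorem IsPoissonRewardField.map_location_reward [IsProbabilityMeasure P] [IsProbabilityMeasure F]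
    (h : IsPoissonRewardField P lam F p r) (n : ℕ) :
    P.map (fun ω => ((fun i : Fin n => p i ω), (fun i : Fin n => r i ω))) =
      (P.map fun ω (i : Fin n) => p i ω).prod (Measure.pi fun _ => F) := by
  have h1 : IndepFun (fun ω (i : Fin n) => p i ω) (fun ω (i : Fin n) => r i ω) P :=
    h.indep_location.comp (φ := fun (f : ℕ → ℝ × ℝ) (i : Fin n) => f i)
      (ψ := fun (f : ℕ → ℝ≥0) (i : Fin n) => f i) (by fun_prop) (by fun_prop)
  have mp : Measurable fun ω (i : Fin n) => p i ω :=
    measurable_pi_lambda _ fun i => h.measurable_location i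
  have mr : Measurable fun ω (i : Fin n) => r i ω :=
    measurable_pi_lambda _ fun i => h.measurable_reward i
  rw [(indepFun_iff_map_prod_eq_prod_map_map mp.aemeasurable mr.aemeasurable).1 h1]
  have h2 : iIndepFun (fun i : Fin n => r i) P := h.iid_reward.precomp Fin.val_injective
  rw [(h2.map_fun_eq_pi_map (f := fun i : Fin n => r i)) fun i => (h.measurable_reward i).aemeasurable]
  simp_rw [h.law_reward]

/-- Given the locations the rewards are i.i.d., so they integrate out factor by factor. What remains
is a product over the locations alone, which the Poisson law can evaluate as `n` grows. -/
theorem IsPoissonRewardField.integral_prod_mark [IsProbabilityMeasure P] [IsProbabilityMeasure F]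
    (h : IsPoissonRewardField P lam F p r) {f : ℝ × ℝ → ℝ≥0 → ℂ}
    (hf : Measurable fun x : (ℝ × ℝ) × ℝ≥0 => f x.1 x.2) (hf1 : ∀ x s, ‖f x s‖ ≤ 1) (n : ℕ) :
    ∫ ω, ∏ i ∈ Finset.range n, f (p i ω) (r i ω) ∂P =
      ∫ ω, ∏ i ∈ Finset.range n, ∫ s, f (p i ω) s ∂F ∂P := by
  simp_rw [Finset.prod_range]
  have mp : Measurable fun ω (i : Fin n) => p i ω :=
    measurable_pi_lambda _ fun i => h.measurable_location i
  have mr : Measurable fun ω (i : Fin n) => r i ω :=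
    measurable_pi_lambda _ fun i => h.measurable_reward i
  have mf : Measurable fun x : (Fin n → ℝ × ℝ) × (Fin n → ℝ≥0) => ∏ i, f (x.1 i) (x.2 i) :=
    Finset.measurable_fun_prod _ fun i _ => by
      have e : Measurable fun x : (Fin n → ℝ × ℝ) × (Fin n → ℝ≥0) => (x.1 i, x.2 i) := by fun_prop
      exact hf.comp e
  rw [← integral_map (mp.prodMk mr).aemeasurable
    (f := fun x : (Fin n → ℝ × ℝ) × (Fin n → ℝ≥0) => ∏ i, f (x.1 i) (x.2 i))
    mf.aestronglyMeasurable, h.map_location_reward n]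
  have := Measure.isProbabilityMeasure_map (μ := P) mp.aemeasurable
  rw [integral_prod]
  · rw [integral_map mp.aemeasurable]
    · refine integral_congr_ae (ae_of_all _ fun ω => ?_)
      simp only
      rw [integral_fintype_prod_eq_prod (f := fun (i : Fin n) s => f (p i ω) s)]
    · exact (mf.stronglyMeasurable.integral_prod_right).aestronglyMeasurable
  · refine Integrable.of_bound mf.aestronglyMeasurable 1 (ae_of_all _ fun x => ?_)
    rw [norm_prod]
    exact Finset.prod_le_one (fun _ _ => norm_nonneg _) fun i _ => hf1 _ _

theorem IsPoissonRewardField.lintegral_prod_mark [IsProbabilityMeasure P] [IsProbabilityMeasure F]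
    (h : IsPoissonRewardField P lam F p r) {f : ℝ × ℝ → ℝ≥0 → ℝ≥0∞}
    (hf : Measurable fun x : (ℝ × ℝ) × ℝ≥0 => f x.1 x.2) (n : ℕ) :
    ∫⁻ ω, ∏ i ∈ Finset.range n, f (p i ω) (r i ω) ∂P =
      ∫⁻ ω, ∏ i ∈ Finset.range n, ∫⁻ s, f (p i ω) s ∂F ∂P := by
  simp_rw [Finset.prod_range]
  have mp : Measurable fun ω (i : Fin n) => p i ω :=
    measurable_pi_lambda _ fun i => h.measurable_location i
  have mr : Measurable fun ω (i : Fin n) => r i ω :=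
    measurable_pi_lambda _ fun i => h.measurable_reward i
  have mf : Measurable fun x : (Fin n → ℝ × ℝ) × (Fin n → ℝ≥0) => ∏ i, f (x.1 i) (x.2 i) :=
    Finset.measurable_fun_prod _ fun i _ => by
      have e : Measurable fun x : (Fin n → ℝ × ℝ) × (Fin n → ℝ≥0) => (x.1 i, x.2 i) := by fun_prop
      exact hf.comp e
  rw [← lintegral_map (f := fun x : (Fin n → ℝ × ℝ) × (Fin n → ℝ≥0) => ∏ i, f (x.1 i) (x.2 i))
    mf (mp.prodMk mr), h.map_location_reward n, lintegral_prod _ mf.aemeasurable,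
    lintegral_map mf.lintegral_prod_right' mp]
  refine lintegral_congr fun ω => ?_
  have hm : ∀ i : Fin n, Measurable (f (p i ω)) := fun i =>
    hf.comp (measurable_const.prodMk measurable_id)
  rw [lintegral_prod_eq_prod_lintegral_of_indepFun Finset.univ
    (fun (i : Fin n) (s : Fin n → ℝ≥0) => f (p i ω) (s i))
    (iIndepFun_pi (μ := fun _ : Fin n => F) fun i => (hm i).aemeasurable)
    fun i => (hm i).comp (measurable_pi_apply i)]
  refine Finset.prod_congr rfl fun i _ => ?_
  exact (measurePreserving_eval (fun _ : Fin n => F) i).lintegral_comp (hm i)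

/-- A form of Campbell's formula: the mean of the product of a function that takes finitely many
values and equals `1` outside of a bounded set. -/
theorem IsPoissonRewardField.tendsto_integral_prod_location [IsProbabilityMeasure P]
    (h : IsPoissonRewardField P lam F p r)
    {κ : Type*} [Fintype κ] {B : κ → Set (ℝ × ℝ)} (hB : ∀ t, MeasurableSet (B t))
    (hb : ∀ t, Bornology.IsBounded (B t)) (hd : Pairwise fun s t => Disjoint (B s) (B t))
    {K : κ → ℂ} (hK : ∀ t, ‖K t‖ ≤ 1) {H : ℝ × ℝ → ℂ} (hin : ∀ t, ∀ x ∈ B t, H x = K t)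
    (hout : ∀ x, (∀ t, x ∉ B t) → H x = 1) :
    Tendsto (fun n => ∫ ω, ∏ i ∈ Finset.range n, H (p i ω) ∂P) atTop
      (𝓝 (Complex.exp (lam * ∫ x, (H x - 1)))) := by
  classical
  have hH : ∀ x, H x = ∏ t, if x ∈ B t then K t else 1 := by
    intro x
    by_cases hx : ∃ t, x ∈ B t
    · obtain ⟨t, ht⟩ := hx
      rw [hin t x ht, Finset.prod_eq_single t, if_pos ht]
      · intro s _ hst
        exact if_neg fun hs => (hd hst).le_bot ⟨hs, ht⟩
      · simp
    · push Not at hx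
      rw [hout x hx]
      simp [hx]
  have hHs : ∀ x, H x - 1 = ∑ t, (B t).indicator (fun _ => K t - 1) x := by
    intro x
    by_cases hx : ∃ t, x ∈ B t
    · obtain ⟨t, ht⟩ := hx
      rw [hin t x ht, Finset.sum_eq_single t, indicator_of_mem ht]
      · intro s _ hst
        exact indicator_of_notMem (fun hs => (hd hst).le_bot ⟨hs, ht⟩) _
      · simp
    · push Not at hx
      rw [hout x hx]
      simp [hx]
  have hHm : Measurable H := by
    have : H = fun x => ∏ t, if x ∈ B t then K t else 1 := funext hH
    rw [this]
    exact Finset.measurable_fun_prod _ fun t _ => Measurable.ite (hB t) measurable_const measurable_const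
  have hHn : ∀ x, ‖H x‖ ≤ 1 := by
    intro x
    rw [hH, norm_prod]
    refine Finset.prod_le_one (fun _ _ => norm_nonneg _) fun t _ => ?_
    split_ifs
    · exact hK t
    · simp
  -- The cells carry independent Poisson counts, so the mean of the product is a product of
  -- generating functions, whose exponents add up to the integral.
  have hint : Complex.exp (lam * ∫ x, (H x - 1)) = ∫ ω, ∏ t, K t ^ count p (B t) ω ∂P := by
    rw [h.integral_prod_pow_count hB hb hd, ← Complex.exp_sum]
    congr 1
    simp_rw [hHs]
    rw [integral_finsetSum]
    · rw [Finset.mul_sum]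
      refine Finset.sum_congr rfl fun t _ => ?_
      rw [integral_indicator_const _ (hB t), Measure.real, Complex.real_smul]
      ring
    · exact fun t _ => (integrable_indicator_iff (hB t)).2
        (integrableOn_const (hb t).measure_lt_top.ne)
  rw [hint]
  refine tendsto_integral_of_dominated_convergence (fun _ => 1) (fun n => ?_)
    (integrable_const _) (fun n => ae_of_all _ fun ω => ?_) ?_
  · exact (Finset.measurable_fun_prod _ fun i _ =>
      hHm.comp (h.measurable_location i)).aestronglyMeasurable
  · rw [norm_prod]
    exact Finset.prod_le_one (fun _ _ => norm_nonneg _) fun i _ => hHn _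
  -- Only finitely many targets lie in the cells, so the partial products are eventually constant.
  · filter_upwards [h.locally_finite] with ω hω
    have hfin : ∀ t, {i | p i ω ∈ B t}.Finite := fun t => hω _ (hb t)
    have hev : ∀ᶠ n in atTop, ∀ t, (hfin t).toFinset ⊆ Finset.range n :=
      eventually_all.2 fun t => tendsto_finset_range.eventually (eventually_ge_atTop (hfin t).toFinset)
    refine tendsto_const_nhds.congr' ?_
    filter_upwards [hev] with n hn
    simp_rw [hH]
    rw [Finset.prod_comm]
    refine Finset.prod_congr rfl fun t _ => ?_
    rw [← Finset.prod_filter, Finset.prod_const]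
    congr 1
    rw [count, (hfin t).encard_eq_coe_toFinset_card, ENat.toNat_natCast]
    congr 1
    ext i
    have := @hn t i
    simp only [Finite.mem_toFinset, mem_ofPred_eq, Finset.mem_filter] at this ⊢
    exact ⟨fun hi => ⟨this hi, hi⟩, fun hi => hi.2⟩

/-! ### Reward sums: characteristic function, independence, translation invariance -/

/-- The sum of `g` over the rewards of the targets in `A`. -/
noncomputable def markSum (p : ℕ → Ω → ℝ × ℝ) (r : ℕ → Ω → ℝ≥0) (A : Set (ℝ × ℝ)) (g : ℝ≥0 → ℝ≥0)
    (ω : Ω) : ℝ≥0∞ :=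
  ∑' i, A.indicator (fun _ => (g (r i ω) : ℝ≥0∞)) (p i ω)

theorem IsPoissonRewardField.measurable_markSum (h : IsPoissonRewardField P lam F p r)
    {A : Set (ℝ × ℝ)} (hA : MeasurableSet A) {g : ℝ≥0 → ℝ≥0} (hg : Measurable g) :
    Measurable (markSum p r A g) := by
  classical
  refine Measurable.tsum fun i => ?_
  simp only [indicator_apply]
  exact Measurable.ite (h.measurable_location i hA)
    (measurable_coe_nnreal_ennreal.comp (hg.comp (h.measurable_reward i))) measurable_const

theorem hasSum_markSum {ω : Ω} {A : Set (ℝ × ℝ)} (hA : {i | p i ω ∈ A}.Finite) (g : ℝ≥0 → ℝ≥0) :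
    HasSum (fun i => A.indicator (fun _ => (g (r i ω) : ℝ)) (p i ω)) (markSum p r A g ω).toReal := by
  have e : (fun i => A.indicator (fun _ => (g (r i ω) : ℝ)) (p i ω)) =
      fun i => (A.indicator (fun _ => (g (r i ω) : ℝ≥0∞)) (p i ω)).toReal := by
    ext i
    by_cases hi : p i ω ∈ A <;> simp [hi]
  have hs : Summable fun i => A.indicator (fun _ => (g (r i ω) : ℝ)) (p i ω) := by
    refine summable_of_hasFiniteSupport (hA.subset fun i hi => ?_)
    by_contra hi'
    exact hi (indicator_of_notMem (s := A) hi' _)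
  rw [markSum, ENNReal.tsum_toReal_eq, ← e]
  · exact hs.hasSum
  · intro i
    by_cases hi : p i ω ∈ A <;> simp [hi]

theorem markSum_lt_top {ω : Ω} {A : Set (ℝ × ℝ)} (hA : {i | p i ω ∈ A}.Finite) (g : ℝ≥0 → ℝ≥0) :
    markSum p r A g ω < ∞ := by
  rw [markSum, tsum_eq_sum (s := hA.toFinset)]
  · refine ENNReal.sum_lt_top.2 fun i _ => ?_
    by_cases hi : p i ω ∈ A <;> simp [hi]
  · intro i hi
    exact indicator_of_notMem (by simpa using hi) _

/-- The phase of a single target at `x` with reward `s`. -/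
noncomputable def markPhase {ι : Type*} [Fintype ι] (A : ι → Set (ℝ × ℝ)) (g : ι → ℝ≥0 → ℝ≥0)
    (θ : ι → ℝ) (x : ℝ × ℝ) (s : ℝ≥0) : ℝ :=
  ∑ j, θ j * (A j).indicator (fun _ => (g j s : ℝ)) x

theorem measurable_markPhase {ι : Type*} [Fintype ι] {A : ι → Set (ℝ × ℝ)} {g : ι → ℝ≥0 → ℝ≥0}
    (hA : ∀ j, MeasurableSet (A j)) (hg : ∀ j, Measurable (g j)) (θ : ι → ℝ) :
    Measurable fun x : (ℝ × ℝ) × ℝ≥0 => markPhase A g θ x.1 x.2 := by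
  classical
  refine Finset.measurable_fun_sum _ fun j _ => measurable_const.mul ?_
  simp only [indicator_apply]
  exact Measurable.ite (measurable_fst (hA j))
    (measurable_coe_nnreal_real.comp ((hg j).comp measurable_snd)) measurable_const

/-- The characteristic function of the reward field. -/
theorem IsPoissonRewardField.integral_exp_markSum [IsProbabilityMeasure P] [IsProbabilityMeasure F]
    (h : IsPoissonRewardField P lam F p r) {ι : Type*} [Fintype ι] {A : ι → Set (ℝ × ℝ)}
    {g : ι → ℝ≥0 → ℝ≥0} (hA : ∀ j, MeasurableSet (A j)) (hb : ∀ j, Bornology.IsBounded (A j))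
    (hg : ∀ j, Measurable (g j)) (θ : ι → ℝ) :
    ∫ ω, Complex.exp ((∑ j, θ j * (markSum p r (A j) (g j) ω).toReal : ℝ) * Complex.I) ∂P =
      Complex.exp (lam * ∫ x, (∫ s, Complex.exp (markPhase A g θ x s * Complex.I) ∂F - 1)) := by
  classical
  set f : ℝ × ℝ → ℝ≥0 → ℂ := fun x s => Complex.exp (markPhase A g θ x s * Complex.I) with hf
  have hfm : Measurable fun x : (ℝ × ℝ) × ℝ≥0 => f x.1 x.2 :=
    Complex.measurable_exp.comp
      ((Complex.measurable_ofReal.comp (measurable_markPhase hA hg θ)).mul_const _)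
  have hf1 : ∀ x s, ‖f x s‖ = 1 := fun x s => Complex.norm_exp_ofReal_mul_I _
  -- The atoms of the algebra generated by the sets `A j`, indexed by the sets that contain the
  -- point. Leaving out the empty index keeps the atoms bounded. On each atom the mean phase factor
  -- is a constant, and outside of all of them it is `1`.
  let κ := {T : Finset ι // T.Nonempty}
  let B : κ → Set (ℝ × ℝ) := fun T => {x | ∀ j, x ∈ A j ↔ j ∈ T.1}
  let K : κ → ℂ := fun T => ∫ s, Complex.exp ((∑ j ∈ T.1, θ j * (g j s : ℝ) : ℝ) * Complex.I) ∂F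
  have hBm : ∀ t, MeasurableSet (B t) := fun T => by
    have : B T = ⋂ j, {x | x ∈ A j ↔ j ∈ T.1} := by ext; simp [B]
    rw [this]
    refine MeasurableSet.iInter fun j => ?_
    by_cases hj : j ∈ T.1
    · simpa [hj] using hA j
    · have : {x | x ∈ A j ↔ j ∈ T.1} = (A j)ᶜ := by ext; simp [hj]
      rw [this]
      exact (hA j).compl
  have hBb : ∀ t, Bornology.IsBounded (B t) := fun T => by
    obtain ⟨j, hj⟩ := T.2
    exact (hb j).subset fun x hx => (hx j).2 hj
  have hBd : Pairwise fun s t => Disjoint (B s) (B t) := fun S T hST => by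
    refine Set.disjoint_left.2 fun x hS hT => hST (Subtype.ext (Finset.ext fun j => ?_))
    rw [← hS j, hT j]
  have hK : ∀ t, ‖K t‖ ≤ 1 := fun T => by
    refine (norm_integral_le_of_norm_le_const (C := 1) (ae_of_all _ fun s => ?_)).trans (by simp)
    rw [Complex.norm_exp_ofReal_mul_I]
  have hlim1 := h.tendsto_integral_prod_location hBm hBb hBd hK (H := fun x => ∫ s, f x s ∂F)
    (fun T x hx => by
      refine integral_congr_ae (ae_of_all _ fun s => ?_)
      have : markPhase A g θ x s = ∑ j ∈ T.1, θ j * (g j s : ℝ) := by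
        have hx' : ∀ j, x ∈ A j ↔ j ∈ T.1 := hx
        rw [markPhase, ← Finset.sum_subset T.1.subset_univ]
        · exact Finset.sum_congr rfl fun j hj => by rw [indicator_of_mem ((hx' j).2 hj)]
        · intro j _ hj
          rw [indicator_of_notMem (fun hxj => hj ((hx' j).1 hxj)), mul_zero]
      simp only [hf, this])
    (fun x hx => by
      have hx0 : ∀ j, x ∉ A j := by
        by_contra! hx'
        obtain ⟨j, hj⟩ := hx'
        exact hx ⟨Finset.univ.filter fun j => x ∈ A j, ⟨j, by simpa using hj⟩⟩ (fun j => by simp)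
      have : ∀ s, markPhase A g θ x s = 0 := fun s => Finset.sum_eq_zero fun j _ => by
        rw [indicator_of_notMem (hx0 j), mul_zero]
      simp [hf, this])
  have hlim2 : Tendsto (fun n => ∫ ω, ∏ i ∈ Finset.range n, f (p i ω) (r i ω) ∂P) atTop
      (𝓝 (∫ ω, Complex.exp
        ((∑ j, θ j * (markSum p r (A j) (g j) ω).toReal : ℝ) * Complex.I) ∂P)) := by
    refine tendsto_integral_of_dominated_convergence (fun _ => 1) (fun n => ?_)
      (integrable_const _) (fun n => ae_of_all _ fun ω => ?_) ?_
    · exact (Finset.measurable_fun_prod _ fun i _ =>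
        hfm.comp ((h.measurable_location i).prodMk (h.measurable_reward i))).aestronglyMeasurable
    · rw [norm_prod]
      exact Finset.prod_le_one (fun _ _ => norm_nonneg _) fun i _ => (hf1 _ _).le
    · filter_upwards [h.locally_finite] with ω hω
      have hs : HasSum (fun i => markPhase A g θ (p i ω) (r i ω))
          (∑ j, θ j * (markSum p r (A j) (g j) ω).toReal) :=
        hasSum_sum fun j _ => (hasSum_markSum (hω _ (hb j)) (g j)).mul_left (θ j)
      have := (Complex.continuous_exp.tendsto _).comp
        (((Complex.continuous_ofReal.tendsto _).comp hs.tendsto_sum_nat).mul_const Complex.I)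
      refine this.congr fun n => ?_
      simp only [Function.comp, hf, ← Complex.exp_sum]
      rw [Complex.ofReal_sum, Finset.sum_mul]
  -- The same means have two limits: one from the convergence of the phases, the other from
  -- integrating out the rewards first.
  have e : ∀ n, ∫ ω, ∏ i ∈ Finset.range n, f (p i ω) (r i ω) ∂P =
      ∫ ω, ∏ i ∈ Finset.range n, ∫ s, f (p i ω) s ∂F ∂P :=
    h.integral_prod_mark hfm fun x s => (hf1 x s).le
  simp_rw [e] at hlim2
  exact tendsto_nhds_unique hlim2 hlim1

theorem clm_pi_apply {ι : Type*} [Fintype ι] [DecidableEq ι] (L : (ι → ℝ) →L[ℝ] ℝ) (y : ι → ℝ) :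
    L y = ∑ j, L (Pi.single j 1) * y j := by
  conv_lhs => rw [pi_eq_sum_univ' y, map_sum]
  refine Finset.sum_congr rfl fun j _ => ?_
  rw [map_smul, smul_eq_mul, mul_comm]

theorem IsPoissonRewardField.measurable_markSum_toReal (h : IsPoissonRewardField P lam F p r)
    {ι : Type*} {A : ι → Set (ℝ × ℝ)}
    {g : ι → ℝ≥0 → ℝ≥0} (hA : ∀ j, MeasurableSet (A j)) (hg : ∀ j, Measurable (g j)) :
    Measurable fun ω j => (markSum p r (A j) (g j) ω).toReal :=
  measurable_pi_lambda _ fun j => (h.measurable_markSum (hA j) (hg j)).ennreal_toReal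

theorem IsPoissonRewardField.charFunDual_markSum [IsProbabilityMeasure P] [IsProbabilityMeasure F]
    (h : IsPoissonRewardField P lam F p r) {ι : Type*} [Fintype ι] [DecidableEq ι]
    {A : ι → Set (ℝ × ℝ)}
    {g : ι → ℝ≥0 → ℝ≥0} (hA : ∀ j, MeasurableSet (A j)) (hb : ∀ j, Bornology.IsBounded (A j))
    (hg : ∀ j, Measurable (g j)) (L : (ι → ℝ) →L[ℝ] ℝ) :
    charFunDual (P.map fun ω j => (markSum p r (A j) (g j) ω).toReal) L =
      Complex.exp (lam * ∫ x, (∫ s, Complex.exp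
        (markPhase A g (fun j => L (Pi.single j 1)) x s * Complex.I) ∂F - 1)) := by
  rw [charFunDual_apply, integral_map (h.measurable_markSum_toReal hA hg).aemeasurable
    (by fun_prop), ← h.integral_exp_markSum hA hb hg]
  refine integral_congr_ae (ae_of_all _ fun ω => ?_)
  simp only
  rw [clm_pi_apply L fun j => (markSum p r (A j) (g j) ω).toReal]

theorem integrable_integral_exp_markPhase [IsProbabilityMeasure F]
    {ι : Type*} [Fintype ι]
    {A : ι → Set (ℝ × ℝ)}
    {g : ι → ℝ≥0 → ℝ≥0} (hA : ∀ j, MeasurableSet (A j)) (hb : ∀ j, Bornology.IsBounded (A j))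
    (hg : ∀ j, Measurable (g j)) (θ : ι → ℝ) :
    Integrable fun x => ∫ s, Complex.exp (markPhase A g θ x s * Complex.I) ∂F - 1 := by
  have hm : Measurable fun x : (ℝ × ℝ) × ℝ≥0 => Complex.exp (markPhase A g θ x.1 x.2 * Complex.I) :=
    Complex.measurable_exp.comp
      ((Complex.measurable_ofReal.comp (measurable_markPhase hA hg θ)).mul_const _)
  have hU : Bornology.IsBounded (⋃ j, A j) := Bornology.isBounded_iUnion.2 hb
  rw [← integrableOn_iff_integrable_of_support_subset (s := ⋃ j, A j)]
  · refine IntegrableOn.of_bound hU.measure_lt_top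
      (hm.stronglyMeasurable.integral_prod_right.aestronglyMeasurable.sub
        aestronglyMeasurable_const) 2 (ae_of_all _ fun x => ?_)
    have : ‖∫ s, Complex.exp (markPhase A g θ x s * Complex.I) ∂F‖ ≤ 1 :=
      (norm_integral_le_of_norm_le_const (C := 1)
        (ae_of_all _ fun s => (Complex.norm_exp_ofReal_mul_I _).le)).trans (by simp)
    refine (norm_sub_le _ _).trans ?_
    rw [norm_one]
    linarith
  · intro x hx
    by_contra hx'
    simp only [mem_iUnion, not_exists] at hx'
    have : ∀ s, markPhase A g θ x s = 0 := fun s => Finset.sum_eq_zero fun j _ => by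
      rw [indicator_of_notMem (hx' j), mul_zero]
    exact hx (by simp [this])

/-- The exponent of the characteristic function is an integral over the plane. A point lies in sets
of at most one of the two families, so there one of the phases vanishes; the exponent is then
additive and the joint characteristic function factorizes. -/
theorem IsPoissonRewardField.indepFun_markSum [IsProbabilityMeasure P] [IsProbabilityMeasure F]
    (h : IsPoissonRewardField P lam F p r) {ι κ : Type*} [Fintype ι] [Fintype κ]
    {A : ι → Set (ℝ × ℝ)} {g : ι → ℝ≥0 → ℝ≥0}
    (hA : ∀ j, MeasurableSet (A j)) (hAb : ∀ j, Bornology.IsBounded (A j))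
    (hg : ∀ j, Measurable (g j)) {B : κ → Set (ℝ × ℝ)} {g' : κ → ℝ≥0 → ℝ≥0}
    (hB : ∀ j, MeasurableSet (B j)) (hBb : ∀ j, Bornology.IsBounded (B j))
    (hg' : ∀ j, Measurable (g' j)) (hd : ∀ i j, Disjoint (A i) (B j)) :
    IndepFun (fun ω i => (markSum p r (A i) (g i) ω).toReal)
      (fun ω j => (markSum p r (B j) (g' j) ω).toReal) P := by
  classical
  have m1 := h.measurable_markSum_toReal hA hg
  have m2 := h.measurable_markSum_toReal hB hg'
  rw [indepFun_iff_charFunDual_prod m1.aemeasurable m2.aemeasurable]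
  intro L
  rw [h.charFunDual_markSum hA hAb hg, h.charFunDual_markSum hB hBb hg', ← Complex.exp_add,
    ← mul_add, ← integral_add (integrable_integral_exp_markPhase hA hAb hg _)
      (integrable_integral_exp_markPhase hB hBb hg' _), charFunDual_apply,
    integral_map (m1.prodMk m2).aemeasurable (by fun_prop)]
  have key := h.integral_exp_markSum (ι := ι ⊕ κ) (A := Sum.elim A B) (g := Sum.elim g g')
    (by rintro (i | i); exacts [hA i, hB i]) (by rintro (i | i); exacts [hAb i, hBb i])
    (by rintro (i | i); exacts [hg i, hg' i])
    (Sum.elim (fun i => L (Pi.single i 1, 0)) (fun j => L (0, Pi.single j 1)))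
  simp only [Fintype.sum_sum_type, Sum.elim_inl, Sum.elim_inr] at key
  have eL : ∀ y : (ι → ℝ) × (κ → ℝ), L y = ∑ i, L (Pi.single i 1, 0) * y.1 i +
      ∑ j, L (0, Pi.single j 1) * y.2 j := by
    intro y
    rw [← L.comp_inl_add_comp_inr y, clm_pi_apply, clm_pi_apply]
    rfl
  rw [integral_congr_ae (ae_of_all P fun ω => congrArg (fun y : ℝ => Complex.exp (y * Complex.I))
    (eL (fun i => (markSum p r (A i) (g i) ω).toReal, fun j => (markSum p r (B j) (g' j) ω).toReal))),
    key]
  congr 2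
  refine integral_congr_ae (ae_of_all _ fun x => ?_)
  have e : ∀ s, markPhase (Sum.elim A B) (Sum.elim g g')
      (Sum.elim (fun i => L (Pi.single i 1, 0)) (fun j => L (0, Pi.single j 1))) x s =
      markPhase A g (fun i => L (Pi.single i 1, 0)) x s +
      markPhase B g' (fun j => L (0, Pi.single j 1)) x s := fun s => by
    simp [markPhase]
  simp only [e]
  change _ = ∫ s, Complex.exp (markPhase A g (fun i => L (Pi.single i 1, 0)) x s * Complex.I) ∂F - 1
    + (∫ s, Complex.exp (markPhase B g' (fun j => L (0, Pi.single j 1)) x s * Complex.I) ∂F - 1)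
  by_cases hx : ∃ i, x ∈ A i
  · obtain ⟨i, hi⟩ := hx
    have : ∀ s, markPhase B g' (fun j => L (0, Pi.single j 1)) x s = 0 := fun s =>
      Finset.sum_eq_zero fun j _ => by
        rw [indicator_of_notMem (disjoint_left.1 (hd i j) hi), mul_zero]
    simp [this]
  · push Not at hx
    have : ∀ s, markPhase A g (fun i => L (Pi.single i 1, 0)) x s = 0 := fun s =>
      Finset.sum_eq_zero fun j _ => by
        rw [indicator_of_notMem (hx j), mul_zero]
    simp [this]

theorem IsPoissonRewardField.markSum_ae_lt_top (h : IsPoissonRewardField P lam F p r)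
    {A : Set (ℝ × ℝ)} (hA : Bornology.IsBounded A) (g : ℝ≥0 → ℝ≥0) :
    ∀ᵐ ω ∂P, markSum p r A g ω < ∞ := by
  filter_upwards [h.locally_finite] with ω hω
  exact markSum_lt_top (hω A hA) g

/-- The bounded regions contained in `B`, with functions of the rewards. -/
def MarkIndex (B : Set (ℝ × ℝ)) : Type :=
  {a : Set (ℝ × ℝ) × (ℝ≥0 → ℝ≥0) //
    MeasurableSet a.1 ∧ Bornology.IsBounded a.1 ∧ a.1 ⊆ B ∧ Measurable a.2}

/-- All the reward sums over bounded parts of `B`. -/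
noncomputable def markField (p : ℕ → Ω → ℝ × ℝ) (r : ℕ → Ω → ℝ≥0) (B : Set (ℝ × ℝ)) (ω : Ω) :
    MarkIndex B → ℝ≥0∞ :=
  fun a => markSum p r a.1.1 a.1.2 ω

/-- The reward fields in disjoint regions are independent. -/
theorem IsPoissonRewardField.indepFun_markField [IsProbabilityMeasure P] [IsProbabilityMeasure F]
    (h : IsPoissonRewardField P lam F p r) {B B' : Set (ℝ × ℝ)} (hd : Disjoint B B') :
    IndepFun (markField p r B) (markField p r B') P := by
  have hreal : IndepFun (fun ω (a : MarkIndex B) => (markSum p r a.1.1 a.1.2 ω).toReal)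
      (fun ω (a : MarkIndex B') => (markSum p r a.1.1 a.1.2 ω).toReal) P := by
    refine IndepFun.process_indepFun_process
      (fun a => (h.measurable_markSum a.2.1 a.2.2.2.2).ennreal_toReal)
      (fun a => (h.measurable_markSum a.2.1 a.2.2.2.2).ennreal_toReal) fun I J => ?_
    exact h.indepFun_markSum (A := fun a : I => a.1.1.1) (g := fun a : I => a.1.1.2)
      (B := fun a : J => a.1.1.1) (g' := fun a : J => a.1.1.2)
      (fun a => a.1.2.1) (fun a => a.1.2.2.1) (fun a => a.1.2.2.2.2)
      (fun a => a.1.2.1) (fun a => a.1.2.2.1) (fun a => a.1.2.2.2.2)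
      (fun a b => hd.mono a.1.2.2.2.1 b.1.2.2.2.1)
  have hofReal : IndepFun
      (fun ω (a : MarkIndex B) => ENNReal.ofReal (markSum p r a.1.1 a.1.2 ω).toReal)
      (fun ω (a : MarkIndex B') => ENNReal.ofReal (markSum p r a.1.1 a.1.2 ω).toReal) P :=
    hreal.comp (φ := fun (f : MarkIndex B → ℝ) a => ENNReal.ofReal (f a))
    (ψ := fun (f : MarkIndex B' → ℝ) a => ENNReal.ofReal (f a)) (by fun_prop) (by fun_prop)
  -- The index set is uncountable, so almost sure finiteness is only available index by index. This
  -- is enough, since the law of a process is determined by its finite-dimensional marginals.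
  have hae : ∀ (D : Set (ℝ × ℝ)) (a : MarkIndex D),
      (fun ω => ENNReal.ofReal (markSum p r a.1.1 a.1.2 ω).toReal) =ᵐ[P] markSum p r a.1.1 a.1.2 :=
    fun D a => by
      filter_upwards [h.markSum_ae_lt_top a.2.2.1 a.1.2] with ω hω
      exact ENNReal.ofReal_toReal hω.ne
  exact IndepFun.process_congr
    (X := fun (a : MarkIndex B) ω => ENNReal.ofReal (markSum p r a.1.1 a.1.2 ω).toReal)
    (Y := fun (a : MarkIndex B') ω => ENNReal.ofReal (markSum p r a.1.1 a.1.2 ω).toReal)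
    (X' := fun (a : MarkIndex B) ω => markSum p r a.1.1 a.1.2 ω)
    (Y' := fun (a : MarkIndex B') ω => markSum p r a.1.1 a.1.2 ω) hofReal (hae B) (hae B')

/-- The law of the reward field is invariant under translations. -/
theorem IsPoissonRewardField.map_markSum_translate [IsProbabilityMeasure P] [IsProbabilityMeasure F]
    (h : IsPoissonRewardField P lam F p r) {ι : Type*} {A : ι → Set (ℝ × ℝ)} {g : ι → ℝ≥0 → ℝ≥0}
    (hA : ∀ j, MeasurableSet (A j)) (hb : ∀ j, Bornology.IsBounded (A j))
    (hg : ∀ j, Measurable (g j)) (z : ℝ × ℝ) :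
    P.map (fun ω j => markSum p r ((fun q => q - z) ⁻¹' A j) (g j) ω) =
      P.map (fun ω j => markSum p r (A j) (g j) ω) := by
  classical
  have hA' : ∀ j, MeasurableSet ((fun q => q - z) ⁻¹' A j) := fun j =>
    (measurable_id.sub_const z) (hA j)
  have hb' : ∀ j, Bornology.IsBounded ((fun q => q - z) ⁻¹' A j) := fun j => by
    have : (fun q => q - z) ⁻¹' A j = (fun q => q + z) '' A j := by
      ext q
      simp only [mem_preimage, mem_image]
      exact ⟨fun hq => ⟨q - z, hq, by simp⟩, by rintro ⟨y, hy, rfl⟩; simpa using hy⟩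
    rw [this]
    exact (LipschitzWith.of_dist_le_mul (K := 1) (by simp)).isBounded_image (hb j)
  have hreal : P.map (fun ω j => (markSum p r ((fun q => q - z) ⁻¹' A j) (g j) ω).toReal) =
      P.map (fun ω j => (markSum p r (A j) (g j) ω).toReal) := by
    rw [map_eq_iff_forall_finset_map_restrict_eq
      (X := fun j ω => (markSum p r ((fun q => q - z) ⁻¹' A j) (g j) ω).toReal)
      (Y := fun j ω => (markSum p r (A j) (g j) ω).toReal)
      (h.measurable_markSum_toReal hA' hg).aemeasurable
      (h.measurable_markSum_toReal hA hg).aemeasurable]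
    intro I
    have m1 := h.measurable_markSum_toReal (A := fun j : I => (fun q => q - z) ⁻¹' A j)
      (g := fun j : I => g j) (fun j => hA' j) fun j => hg j
    have m2 := h.measurable_markSum_toReal (A := fun j : I => A j)
      (g := fun j : I => g j) (fun j => hA j) fun j => hg j
    have := Measure.isProbabilityMeasure_map (μ := P) m1.aemeasurable
    have := Measure.isProbabilityMeasure_map (μ := P) m2.aemeasurable
    refine Measure.ext_of_charFunDual
      (μ := P.map (fun ω (j : I) => (markSum p r ((fun q => q - z) ⁻¹' A j) (g j) ω).toReal))
      (ν := P.map (fun ω (j : I) => (markSum p r (A j) (g j) ω).toReal)) ?_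
    ext L
    rw [h.charFunDual_markSum (fun j : I => hA j) (fun j : I => hb j) (fun j : I => hg j),
      h.charFunDual_markSum (fun j : I => hA' j) (fun j : I => hb' j) (fun j : I => hg j)]
    congr 2
    -- Translating the regions translates the integrand of the exponent, and Lebesgue measure is
    -- invariant.
    refine Eq.trans ?_ (integral_sub_right_eq_self (fun x => ∫ s, Complex.exp
      (markPhase (fun j : I => A j) (fun j : I => g j) (fun j => L (Pi.single j 1)) x s *
        Complex.I) ∂F - 1) z)
    rfl
  have m1 := h.measurable_markSum_toReal hA' hg
  have m2 := h.measurable_markSum_toReal hA hg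
  have hc : Measurable fun (f : ι → ℝ) j => ENNReal.ofReal (f j) := by fun_prop
  have h3 := congrArg (Measure.map fun (f : ι → ℝ) j => ENNReal.ofReal (f j)) hreal
  rw [Measure.map_map hc m1, Measure.map_map hc m2] at h3
  rw [← map_eq_of_forall_ae_eq
      (X := fun j ω => ENNReal.ofReal (markSum p r ((fun q => q - z) ⁻¹' A j) (g j) ω).toReal)
      (Y := fun j ω => markSum p r ((fun q => q - z) ⁻¹' A j) (g j) ω) (hc.comp m1).aemeasurable
      (measurable_pi_lambda _ fun j => h.measurable_markSum (hA' j) (hg j)).aemeasurable,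
    ← map_eq_of_forall_ae_eq
      (X := fun j ω => ENNReal.ofReal (markSum p r (A j) (g j) ω).toReal)
      (Y := fun j ω => markSum p r (A j) (g j) ω) (hc.comp m2).aemeasurable
      (measurable_pi_lambda _ fun j => h.measurable_markSum (hA j) (hg j)).aemeasurable]
  · exact h3
  · intro j
    filter_upwards [h.markSum_ae_lt_top (hb j) (g j)] with ω hω
    exact ENNReal.ofReal_toReal hω.ne
  · intro j
    filter_upwards [h.markSum_ae_lt_top (hb' j) (g j)] with ω hω
    exact ENNReal.ofReal_toReal hω.ne

theorem measurable_markSum_comap (p : ℕ → Ω → ℝ × ℝ) (r : ℕ → Ω → ℝ≥0) {A B : Set (ℝ × ℝ)}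
    (hA : MeasurableSet A) (hb : Bornology.IsBounded A) (hAB : A ⊆ B) {g : ℝ≥0 → ℝ≥0}
    (hg : Measurable g) :
    Measurable[MeasurableSpace.comap (markField p r B) inferInstance] (markSum p r A g) :=
  (measurable_pi_apply (⟨(A, g), hA, hb, hAB, hg⟩ : MarkIndex B)).comp
    (comap_measurable (markField p r B))

/-- The reward sums over bounded regions determine the information. -/
theorem information_le_comap (p : ℕ → Ω → ℝ × ℝ) (r : ℕ → Ω → ℝ≥0) (B : Set (ℝ × ℝ)) :
    information p r B ≤ MeasurableSpace.comap (markField p r B) inferInstance := by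
  classical
  refine MeasurableSpace.generateFrom_le ?_
  rintro E ⟨A, C, n, hA, hAB, hC, rfl⟩
  -- The region may be unbounded, so it is cut into bounded pieces by the integer part of the norm.
  -- The count, possibly infinite, is the sum over the pieces of the reward sums for the indicator
  -- of `C`.
  let D : ℕ → Set (ℝ × ℝ) := fun m => A ∩ {x | ⌊‖x‖⌋₊ = m}
  have hD : ∀ m, MeasurableSet (D m) := fun m =>
    hA.inter ((Nat.measurable_floor.comp measurable_norm) (measurableSet_singleton m))
  have hDb : ∀ m, Bornology.IsBounded (D m) := fun m => by
    refine (Metric.isBounded_ball (x := (0 : ℝ × ℝ)) (r := m + 1)).subset fun x hx => ?_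
    rw [mem_ball_zero_iff]
    have := Nat.lt_floor_add_one ‖x‖
    rwa [show ⌊‖x‖⌋₊ = m from hx.2] at this
  let g : ℝ≥0 → ℝ≥0 := C.indicator 1
  have hg : Measurable g := measurable_one.indicator hC
  have key : ∀ ω, (({i | p i ω ∈ A ∧ r i ω ∈ C}.encard : ℕ∞) : ℝ≥0∞) =
      ∑' m, markSum p r (D m) g ω := by
    intro ω
    simp only [markSum]
    rw [ENNReal.tsum_comm, ← ENNReal.tsum_set_one,
      tsum_subtype {i | p i ω ∈ A ∧ r i ω ∈ C} (fun _ => (1 : ℝ≥0∞))]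
    refine tsum_congr fun i => ?_
    rw [tsum_eq_single ⌊‖p i ω‖⌋₊]
    · by_cases h1 : p i ω ∈ A <;> by_cases h2 : r i ω ∈ C <;> simp [D, g, h1, h2]
    · intro m hm
      exact indicator_of_notMem (fun h => hm h.2.symm) _
  have : {ω | {i | p i ω ∈ A ∧ r i ω ∈ C}.encard = n} =
      (fun ω => ∑' m, markSum p r (D m) g ω) ⁻¹' {(n : ℝ≥0∞)} := by
    ext ω
    simp only [mem_preimage, mem_singleton_iff, ← key, ENat.toENNReal_inj]
    rfl
  rw [this]
  have hm : Measurable[MeasurableSpace.comap (markField p r B) inferInstance]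
      fun ω => ∑' m, markSum p r (D m) g ω := by
    let : MeasurableSpace Ω := MeasurableSpace.comap (markField p r B) inferInstance
    exact Measurable.tsum fun m =>
      measurable_markSum_comap p r (hD m) (hDb m) (inter_subset_left.trans hAB) hg
  exact hm (measurableSet_singleton _)

/-! ### Grid approximation of the optimal reward -/

/-- The squares of a grid of mesh `S / (n + 1)` in the strip `(0, S] × ℝ`, for all `n`. -/
abbrev GridIndex : Type := Σ n : ℕ, Fin (n + 1) × ℤ

/-- The mesh of the grid. -/
noncomputable def mesh (S : ℝ) (n : ℕ) : ℝ := S / (n + 1)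

/-- A square of the grid. -/
def gridCell (S : ℝ) (a : GridIndex) : Set (ℝ × ℝ) :=
  {q | (mesh S a.1 * (a.2.1 : ℕ) < q.1 ∧ q.1 ≤ mesh S a.1 * (a.2.1 : ℕ) + mesh S a.1) ∧
    mesh S a.1 * a.2.2 ≤ q.2 ∧ q.2 < mesh S a.1 * a.2.2 + mesh S a.1}

/-- Sets of squares that satisfy the slope constraint up to the mesh of the grid. -/
def gridChains (S : ℝ) (n : ℕ) (y : ℝ) : Set (Finset (Fin (n + 1) × ℤ)) :=
  {J | (∀ j ∈ J, |mesh S n * j.2 - y| ≤ mesh S n * (j.1 : ℕ) + 2 * mesh S n) ∧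
    ∀ j ∈ J, ∀ k ∈ J, |mesh S n * j.2 - mesh S n * k.2| ≤
      |mesh S n * (j.1 : ℕ) - mesh S n * (k.1 : ℕ)| + 2 * mesh S n}

/-- The largest total reward of a chain of squares of the grid. -/
noncomputable def gridLevelValue (S : ℝ) (n : ℕ) (y : ℝ) (arr : GridIndex → ℝ≥0∞) : ℝ≥0∞ :=
  ⨆ J : Finset (Fin (n + 1) × ℤ), ⨆ _ : J ∈ gridChains S n y, ∑ j ∈ J, arr ⟨n, j⟩

/-- The limit of the largest total reward of a chain of squares, as the mesh vanishes. -/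
noncomputable def gridValue (S : ℝ) (y : ℝ) (arr : GridIndex → ℝ≥0∞) : ℝ≥0∞ :=
  limsup (fun n => gridLevelValue S n y arr) atTop

theorem mesh_pos {S : ℝ} (hS : 0 < S) (n : ℕ) : 0 < mesh S n := by
  unfold mesh; positivity

theorem mesh_mul (S : ℝ) (n : ℕ) : mesh S n * (n + 1) = S := by
  unfold mesh; field_simp

theorem tendsto_mesh (S : ℝ) : Tendsto (mesh S) atTop (𝓝 0) := by
  have := (tendsto_one_div_add_atTop_nhds_zero_nat (𝕜 := ℝ)).const_mul S
  rw [mul_zero] at this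
  exact this.congr fun n => by rw [mesh]; ring

theorem measurableSet_gridCell (S : ℝ) (a : GridIndex) : MeasurableSet (gridCell S a) :=
  ((measurableSet_lt measurable_const measurable_fst).inter
    (measurableSet_le measurable_fst measurable_const)).inter
    ((measurableSet_le measurable_const measurable_snd).inter
      (measurableSet_lt measurable_snd measurable_const))

theorem isBounded_gridCell (S : ℝ) (a : GridIndex) : Bornology.IsBounded (gridCell S a) := by
  refine ((Metric.isBounded_Icc (mesh S a.1 * (a.2.1 : ℕ))
    (mesh S a.1 * (a.2.1 : ℕ) + mesh S a.1)).prod (Metric.isBounded_Icc (mesh S a.1 * a.2.2)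
      (mesh S a.1 * a.2.2 + mesh S a.1))).subset fun q hq => ?_
  exact ⟨⟨hq.1.1.le, hq.1.2⟩, hq.2.1, hq.2.2.le⟩

theorem gridCell_subset {S : ℝ} (hS : 0 < S) (a : GridIndex) :
    gridCell S a ⊆ {q | 0 < q.1 ∧ q.1 ≤ S} := by
  intro q hq
  have hm := mesh_pos hS a.1
  refine ⟨lt_of_le_of_lt (by positivity) hq.1.1, hq.1.2.trans ?_⟩
  have h1 : ((a.2.1 : ℕ) : ℝ) + 1 ≤ a.1 + 1 := by exact_mod_cast a.2.1.2
  have := mul_le_mul_of_nonneg_left h1 hm.le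
  rw [mesh_mul] at this
  linarith

theorem exists_mem_gridCell {S : ℝ} (hS : 0 < S) (n : ℕ) {q : ℝ × ℝ} (h0 : 0 < q.1) (h1 : q.1 ≤ S) :
    ∃ j, q ∈ gridCell S ⟨n, j⟩ := by
  have hm := mesh_pos hS n
  have hx : 0 < q.1 / mesh S n := div_pos h0 hm
  have hc : 0 < ⌈q.1 / mesh S n⌉₊ := Nat.ceil_pos.2 hx
  have hle : ⌈q.1 / mesh S n⌉₊ ≤ n + 1 := by
    rw [Nat.ceil_le, div_le_iff₀ hm]
    push_cast
    rw [mul_comm, mesh_mul]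
    exact h1
  have hcast : ((⌈q.1 / mesh S n⌉₊ - 1 : ℕ) : ℝ) = ⌈q.1 / mesh S n⌉₊ - 1 := by
    rw [Nat.cast_sub hc, Nat.cast_one]
  have e1 := Nat.ceil_lt_add_one hx.le
  have e2 := Nat.le_ceil (q.1 / mesh S n)
  have e3 := Int.floor_le (q.2 / mesh S n)
  have e4 := Int.lt_floor_add_one (q.2 / mesh S n)
  have d1 : mesh S n * (q.1 / mesh S n) = q.1 := mul_div_cancel₀ _ hm.ne'
  have d2 : mesh S n * (q.2 / mesh S n) = q.2 := mul_div_cancel₀ _ hm.ne'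
  refine ⟨(⟨⌈q.1 / mesh S n⌉₊ - 1, by omega⟩, ⌊q.2 / mesh S n⌋), ⟨?_, ?_⟩, ?_, ?_⟩
  · simp only [hcast]
    nlinarith
  · simp only [hcast]
    nlinarith
  · simp only
    nlinarith
  · simp only
    nlinarith

theorem gridCell_disjoint {S : ℝ} (hS : 0 < S) (n : ℕ) {j k : Fin (n + 1) × ℤ} (hjk : j ≠ k) :
    Disjoint (gridCell S ⟨n, j⟩) (gridCell S ⟨n, k⟩) := by
  have hm := mesh_pos hS n
  refine Set.disjoint_left.2 fun q hj hk => hjk ?_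
  obtain ⟨⟨a1, a2⟩, a3, a4⟩ := hj
  obtain ⟨⟨b1, b2⟩, b3, b4⟩ := hk
  simp only at a1 a2 a3 a4 b1 b2 b3 b4
  have e1 : ((j.1 : ℕ) : ℝ) < (k.1 : ℕ) + 1 := by
    refine lt_of_mul_lt_mul_left ?_ hm.le; linarith
  have e2 : ((k.1 : ℕ) : ℝ) < (j.1 : ℕ) + 1 := by
    refine lt_of_mul_lt_mul_left ?_ hm.le; linarith
  have e3 : (j.2 : ℝ) < k.2 + 1 := by
    refine lt_of_mul_lt_mul_left ?_ hm.le; linarith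
  have e4 : (k.2 : ℝ) < j.2 + 1 := by
    refine lt_of_mul_lt_mul_left ?_ hm.le; linarith
  norm_cast at e1 e2 e3 e4
  refine Prod.ext (Fin.ext (by omega)) (by omega)

/-- Joint measurability in the lateral position and the cell rewards is what permits a random
starting state. It holds because there are countably many sets of squares, and each of them is a
chain for a closed set of positions. -/
theorem measurable_gridValue (S : ℝ) :
    Measurable fun x : ℝ × (GridIndex → ℝ≥0∞) => gridValue S x.1 x.2 := by
  classical
  refine Measurable.limsup fun n => Measurable.iSup fun J => ?_
  have : (fun x : ℝ × (GridIndex → ℝ≥0∞) => ⨆ _ : J ∈ gridChains S n x.1, ∑ j ∈ J, x.2 ⟨n, j⟩) =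
      fun x => if J ∈ gridChains S n x.1 then ∑ j ∈ J, x.2 ⟨n, j⟩ else 0 := by
    funext x
    split_ifs with h <;> simp [h]
  rw [this]
  refine Measurable.ite ?_ (by fun_prop) measurable_const
  refine MeasurableSet.inter ?_ (MeasurableSet.const _)
  have : {x : ℝ × (GridIndex → ℝ≥0∞) | ∀ j ∈ J, |mesh S n * j.2 - x.1| ≤
      mesh S n * (j.1 : ℕ) + 2 * mesh S n} = ⋂ j ∈ J, {x : ℝ × (GridIndex → ℝ≥0∞) |
        |mesh S n * j.2 - x.1| ≤ mesh S n * (j.1 : ℕ) + 2 * mesh S n} := by ext; simp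
  change MeasurableSet {x : ℝ × (GridIndex → ℝ≥0∞) | ∀ j ∈ J, |mesh S n * j.2 - x.1| ≤
      mesh S n * (j.1 : ℕ) + 2 * mesh S n}
  rw [this]
  exact Finset.measurableSet_biInter J fun j _ =>
    measurableSet_le (by fun_prop) measurable_const

/-- The rewards in the squares of the grids anchored at `q₀`. -/
noncomputable def gridRewards (p : ℕ → Ω → ℝ × ℝ) (r : ℕ → Ω → ℝ≥0) (S : ℝ) (q₀ : ℝ × ℝ) (ω : Ω) :
    GridIndex → ℝ≥0∞ :=
  fun a => markSum p r ((fun q => q - q₀) ⁻¹' gridCell S a) id ω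

/-- The squares met by a chain form a grid chain. Replacing targets by the lower left corners of
their squares costs one mesh in each coordinate difference, whence the tolerance of two meshes in
`gridChains`. -/
theorem chainValue_le_gridLevelValue {S : ℝ} (hS : 0 < S) (q₀ : ℝ × ℝ) (y : ℝ) (ω : Ω) (n : ℕ) :
    chainValue {q | q₀.1 < q.1 ∧ q.1 ≤ q₀.1 + S} (q₀.1, q₀.2 + y) (fun i => p i ω) (fun i => r i ω)
      ≤ gridLevelValue S n y (gridRewards p r S q₀ ω) := by
  classical
  refine iSup₂_le fun I hI => ?_
  have hm := mesh_pos hS n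
  have hex : ∀ i, i ∈ I → ∃ j, p i ω - q₀ ∈ gridCell S ⟨n, j⟩ := fun i hi => by
    have := (hI.1 i hi).1
    refine exists_mem_gridCell hS n ?_ ?_
    · simp only [Prod.fst_sub]; linarith [this.1]
    · simp only [Prod.fst_sub]; linarith [this.2]
  choose! c hc using hex
  have hJ : I.image c ∈ gridChains S n y := by
    constructor
    · intro j hj
      obtain ⟨i, hi, rfl⟩ := Finset.mem_image.1 hj
      obtain ⟨⟨a1, a2⟩, a3, a4⟩ := hc i hi
      obtain ⟨⟨b1, b2⟩, b3⟩ := hI.1 i hi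
      simp only [Prod.fst_sub, Prod.snd_sub] at a1 a2 a3 a4 b1 b2 b3
      rw [abs_of_pos (a := (p i ω).1 - q₀.1) (by linarith), abs_le] at b3
      rw [abs_le]
      constructor <;> linarith [b3.1, b3.2]
    · intro j hj k hk
      obtain ⟨i, hi, rfl⟩ := Finset.mem_image.1 hj
      obtain ⟨l, hl, rfl⟩ := Finset.mem_image.1 hk
      obtain ⟨⟨a1, a2⟩, a3, a4⟩ := hc i hi
      obtain ⟨⟨b1, b2⟩, b3, b4⟩ := hc l hl
      have := hI.2 i hi l hl
      simp only [Prod.fst_sub, Prod.snd_sub] at a1 a2 a3 a4 b1 b2 b3 b4 this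
      have h1 : |(p i ω).1 - (p l ω).1| ≤
          |mesh S n * ((c i).1 : ℕ) - mesh S n * ((c l).1 : ℕ)| + mesh S n := by
        rw [abs_le]
        constructor
        · linarith [neg_abs_le (mesh S n * ((c i).1 : ℕ) - mesh S n * ((c l).1 : ℕ))]
        · linarith [le_abs_self (mesh S n * ((c i).1 : ℕ) - mesh S n * ((c l).1 : ℕ))]
      have h2 := abs_le.1 (this.trans h1)
      rw [abs_le]
      constructor <;> linarith [h2.1, h2.2]
  refine le_iSup₂_of_le (I.image c) hJ ?_
  rw [← Finset.sum_fiberwise_of_maps_to (g := c) fun i hi => Finset.mem_image_of_mem c hi]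
  refine Finset.sum_le_sum fun j _ => ?_
  refine le_trans ?_ (ENNReal.sum_le_tsum (I.filter fun i => c i = j))
  refine Finset.sum_le_sum fun i hi => ?_
  rw [Finset.mem_filter] at hi
  have : p i ω ∈ (fun q => q - q₀) ⁻¹' gridCell S ⟨n, j⟩ := hi.2 ▸ hc i hi.1
  rw [indicator_of_mem this]
  rfl

/-- The converse, with a defect: going back from corners to targets costs two more meshes, hence `4
* mesh S n`. The targets involved have lateral distance at most `S + 2 * mesh S n ≤ 3 * S` from the
start, so the finite set `K` can be chosen independently of `n`. -/
theorem exists_of_lt_gridLevelValue {S : ℝ} (hS : 0 < S) {q₀ : ℝ × ℝ} {y : ℝ} {ω : Ω} {n : ℕ}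
    {t : ℝ≥0∞} (ht : t < gridLevelValue S n y (gridRewards p r S q₀ ω)) {K : Finset ℕ}
    (hK : ∀ i, q₀.1 < (p i ω).1 → (p i ω).1 ≤ q₀.1 + S → |(p i ω).2 - (q₀.2 + y)| ≤ 3 * S → i ∈ K) :
    ∃ I ⊆ K, t < ∑ i ∈ I, (r i ω : ℝ≥0∞) ∧
      (∀ i ∈ I, (q₀.1 < (p i ω).1 ∧ (p i ω).1 ≤ q₀.1 + S) ∧
        |(p i ω).2 - (q₀.2 + y)| ≤ |(p i ω).1 - q₀.1| + 4 * mesh S n) ∧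
      ∀ i ∈ I, ∀ j ∈ I, |(p i ω).2 - (p j ω).2| ≤ |(p i ω).1 - (p j ω).1| + 4 * mesh S n := by
  classical
  obtain ⟨J, hJ⟩ := lt_iSup_iff.1 ht
  obtain ⟨hJc, hJt⟩ := lt_iSup_iff.1 hJ
  have hm := mesh_pos hS n
  have hmS : mesh S n ≤ S := div_le_self hS.le (by linarith [n.cast_nonneg (α := ℝ)])
  let U : Set (ℝ × ℝ) := ⋃ j ∈ J, (fun q => q - q₀) ⁻¹' gridCell S ⟨n, j⟩
  have hU : ∀ i, p i ω ∈ U → (q₀.1 < (p i ω).1 ∧ (p i ω).1 ≤ q₀.1 + S) ∧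
        |(p i ω).2 - (q₀.2 + y)| ≤ |(p i ω).1 - q₀.1| + 3 * mesh S n ∧ i ∈ K := by
    intro i hi
    simp only [U, mem_iUnion] at hi
    obtain ⟨j, hj, hij⟩ := hi
    have h1 := gridCell_subset hS _ hij
    obtain ⟨⟨a1, a2⟩, a3, a4⟩ := hij
    have h2 := abs_le.1 (hJc.1 j hj)
    simp only [Prod.fst_sub, Prod.snd_sub, mem_ofPred_eq] at a1 a2 a3 a4 h1
    have h3 : |(p i ω).2 - (q₀.2 + y)| ≤ (p i ω).1 - q₀.1 + 3 * mesh S n := by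
      rw [abs_le]
      constructor <;> linarith [h2.1, h2.2]
    refine ⟨⟨by linarith, by linarith⟩, ?_, hK i (by linarith) (by linarith) ?_⟩
    · rwa [abs_of_pos (a := (p i ω).1 - q₀.1) (by linarith)]
    · have h4 : mesh S n * (j.1 : ℕ) + mesh S n ≤ S := by
        have h1 : ((j.1 : ℕ) : ℝ) + 1 ≤ n + 1 := by exact_mod_cast j.1.2
        have := mul_le_mul_of_nonneg_left h1 hm.le
        rw [mesh_mul] at this
        linarith
      rw [abs_le]
      constructor <;> linarith [h2.1, h2.2]
  refine ⟨K.filter fun i => p i ω ∈ U, Finset.filter_subset _ _, ?_, ?_, ?_⟩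
  · refine hJt.trans_le (le_of_eq ?_)
    simp only [gridRewards, markSum]
    rw [← Summable.tsum_finsetSum fun _ _ => ENNReal.summable, tsum_eq_sum (s := K.filter fun i => p i ω ∈ U)]
    · refine Finset.sum_congr rfl fun i hi => ?_
      have := Finset.indicator_biUnion_apply J (fun j => (fun q => q - q₀) ⁻¹' gridCell S ⟨n, j⟩)
        (f := fun _ => (r i ω : ℝ≥0∞)) (fun j _ k _ hjk => (gridCell_disjoint hS n hjk).preimage _)
        (p i ω)
      rw [Finset.mem_filter] at hi
      simp only [id]
      rw [← this, indicator_of_mem hi.2]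
    · intro i hi
      refine Finset.sum_eq_zero fun j hj => indicator_of_notMem (fun hij => hi ?_) _
      have hiU : p i ω ∈ U := mem_biUnion (Finset.mem_coe.2 hj) hij
      exact Finset.mem_filter.2 ⟨(hU i hiU).2.2, hiU⟩
  · intro i hi
    have := hU i (Finset.mem_filter.1 hi).2
    exact ⟨this.1, this.2.1.trans (by linarith)⟩
  · intro i hi l hl
    have hi' := (Finset.mem_filter.1 hi).2
    have hl' := (Finset.mem_filter.1 hl).2
    simp only [U, mem_iUnion] at hi' hl'
    obtain ⟨j, hj, ⟨a1, a2⟩, a3, a4⟩ := hi'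
    obtain ⟨k, hk, ⟨b1, b2⟩, b3, b4⟩ := hl'
    have h := hJc.2 j hj k hk
    simp only [Prod.fst_sub, Prod.snd_sub] at a1 a2 a3 a4 b1 b2 b3 b4
    have h1 : |mesh S n * (j.1 : ℕ) - mesh S n * (k.1 : ℕ)| ≤
        |(p i ω).1 - (p l ω).1| + mesh S n := by
      rw [abs_le]
      constructor
      · linarith [neg_abs_le ((p i ω).1 - (p l ω).1)]
      · linarith [le_abs_self ((p i ω).1 - (p l ω).1)]
    have h2 := abs_le.1 (h.trans (add_le_add_left h1 _))
    rw [abs_le]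
    constructor <;> linarith [h2.1, h2.2]

theorem chainValue_eq_gridValue {S : ℝ} (hS : 0 < S) (q₀ : ℝ × ℝ) (y : ℝ) {ω : Ω}
    (hfin : ∀ B : Set (ℝ × ℝ), Bornology.IsBounded B → {i | p i ω ∈ B}.Finite) :
    chainValue {q | q₀.1 < q.1 ∧ q.1 ≤ q₀.1 + S} (q₀.1, q₀.2 + y) (fun i => p i ω) (fun i => r i ω)
      = gridValue S y (gridRewards p r S q₀ ω) := by
  classical
  apply le_antisymm
  · exact le_limsup_of_frequently_le
      (Frequently.of_forall fun n => chainValue_le_gridLevelValue hS q₀ y ω n) (by isBoundedDefault)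
  · refine le_of_forall_lt fun t ht => ?_
    have hfreq := frequently_lt_of_lt_limsup (by isBoundedDefault) ht
    let D : Set (ℝ × ℝ) := Icc q₀.1 (q₀.1 + S) ×ˢ Metric.closedBall (q₀.2 + y) (3 * S)
    have hD : Bornology.IsBounded D := (Metric.isBounded_Icc _ _).prod Metric.isBounded_closedBall
    let K := (hfin D hD).toFinset
    have hK : ∀ i, q₀.1 < (p i ω).1 → (p i ω).1 ≤ q₀.1 + S →
        |(p i ω).2 - (q₀.2 + y)| ≤ 3 * S → i ∈ K := fun i h1 h2 h3 => by
      simp only [K, Finite.mem_toFinset, mem_ofPred_eq]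
      exact ⟨⟨h1.le, h2⟩, by rwa [Metric.mem_closedBall, Real.dist_eq]⟩
    -- Pigeonhole: `K` has finitely many subsets, so a single set of targets works for arbitrarily
    -- fine grids. As the mesh vanishes so does the defect, and this set is a true chain.
    have hex : ∃ I ∈ K.powerset, ∃ᶠ n in atTop, t < ∑ i ∈ I, (r i ω : ℝ≥0∞) ∧
        (∀ i ∈ I, (q₀.1 < (p i ω).1 ∧ (p i ω).1 ≤ q₀.1 + S) ∧
          |(p i ω).2 - (q₀.2 + y)| ≤ |(p i ω).1 - q₀.1| + 4 * mesh S n) ∧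
        ∀ i ∈ I, ∀ j ∈ I, |(p i ω).2 - (p j ω).2| ≤
          |(p i ω).1 - (p j ω).1| + 4 * mesh S n := by
      by_contra! hcon
      have := (Finset.eventually_all (K.powerset)).2 hcon
      refine hfreq (this.mono fun n hn hlt => ?_)
      obtain ⟨I, hIK, hI⟩ := exists_of_lt_gridLevelValue hS hlt hK
      obtain ⟨i, hi, j, hj, hij⟩ := hn I (Finset.mem_powerset.2 hIK) hI.1 hI.2.1
      exact hij.not_ge (hI.2.2 i hi j hj)
    obtain ⟨I, -, hI⟩ := hex
    obtain ⟨n₀, hn₀⟩ := hI.exists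
    have hlim : ∀ a b : ℝ, (∃ᶠ n in atTop, a ≤ b + 4 * mesh S n) → a ≤ b := fun a b h => by
      have h2 : Tendsto (fun n => b + 4 * mesh S n) atTop (𝓝 (b + 4 * 0)) :=
        ((tendsto_mesh S).const_mul 4).const_add b
      rw [mul_zero, add_zero] at h2
      exact ge_of_tendsto_of_frequently h2 h
    refine hn₀.1.trans_le (le_iSup₂_of_le I ⟨fun i hi => ⟨(hn₀.2.1 i hi).1, ?_⟩, fun i hi j hj => ?_⟩
      le_rfl)
    · exact hlim _ _ (hI.mono fun n hn => (hn.2.1 i hi).2)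
    · exact hlim _ _ (hI.mono fun n hn => hn.2.2 i hi j hj)

/-! ### Iterations are independent copies of the first segment -/

/-- Fubini: if the law of `Φ (y, ·)` is the same for every `y`, then substituting an independent
random `y` changes neither that law nor the independence from anything observed along with `y`. -/
theorem map_prod_eq_prod_of_map_eq {β γ δ ε : Type*} [MeasurableSpace β] [MeasurableSpace γ]
    [MeasurableSpace δ] [MeasurableSpace ε] (μ : Measure (β × γ)) [SFinite μ] (ρ : Measure δ)
    [SFinite ρ] (ν : Measure ε) [SFinite ν] {Φ : γ × δ → ε} (hΦ : Measurable Φ)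
    (h : ∀ y, ρ.map (fun a => Φ (y, a)) = ν) :
    (μ.prod ρ).map (fun x => (x.1.1, Φ (x.1.2, x.2))) = (μ.map Prod.fst).prod ν := by
  have hm : Measurable fun x : (β × γ) × δ => (x.1.1, Φ (x.1.2, x.2)) :=
    measurable_fst.fst.prodMk (hΦ.comp (measurable_fst.snd.prodMk measurable_snd))
  ext s hs
  rw [Measure.map_apply hm hs, Measure.prod_apply (hm hs), Measure.prod_apply hs,
    lintegral_map (measurable_measure_prodMk_left hs) measurable_fst]
  refine lintegral_congr fun x => ?_
  rw [← h x.2, Measure.map_apply (f := fun a => Φ (x.2, a)) (hΦ.comp measurable_prodMk_left) (measurable_prodMk_left hs)]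
  rfl

theorem measurable_gridValue_comp {α : Type*} [MeasurableSpace α] (S : ℝ) {f : α → ℝ}
    {g : α → GridIndex → ℝ≥0∞} (hf : Measurable f) (hg : Measurable g) :
    Measurable fun a => gridValue S (f a) (g a) := by
  have h : Measurable fun a => (f a, g a) := hf.prodMk hg
  have := Measurable.comp (g := fun x : ℝ × (GridIndex → ℝ≥0∞) => gridValue S x.1 x.2)
    (measurable_gridValue S) h
  exact this

/-- A line has area zero. This removes the difference between the closed strips of the paths and the
half-open strips of the grid, and keeps targets off the borders between iterations. -/
theorem IsPoissonRewardField.ae_notMem_line (h : IsPoissonRewardField P lam F p r) (c : ℝ)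
    [IsProbabilityMeasure P] : ∀ᵐ ω ∂P, ∀ i, (p i ω).1 ≠ c := by
  have hA : MeasurableSet {q : ℝ × ℝ | q.1 = c} := measurable_fst (measurableSet_singleton c)
  have hv : volume {q : ℝ × ℝ | q.1 = c} = 0 := by
    have : {q : ℝ × ℝ | q.1 = c} = {c} ×ˢ univ := by ext; simp
    rw [this, Measure.volume_eq_prod, Measure.prod_prod]
    simp
  have := h.poisson 1 (fun _ => {q | q.1 = c}) (fun _ => hA) (fun _ => by simp [hv])
    (fun i j hij => (hij (Subsingleton.elim _ _)).elim) (fun _ => 0)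
  simp only [hv, ENNReal.toNNReal_zero, mul_zero, poissonMeasure_singleton] at this
  have hm : MeasurableSet {ω | ∀ _ : Fin 1, {i | p i ω ∈ {q : ℝ × ℝ | q.1 = c}}.encard = ((0 : ℕ) : ℕ∞)} := by
    simp only [forall_const]
    exact measurable_encard (fun i => h.measurable_location i hA) (measurableSet_singleton _)
  have h1 : P {ω | ∀ _ : Fin 1, {i | p i ω ∈ {q : ℝ × ℝ | q.1 = c}}.encard = ((0 : ℕ) : ℕ∞)} = 1 := by
    rw [this]; simp
  filter_upwards [(prob_compl_eq_zero_iff hm).2 h1 |> measure_eq_zero_iff_ae_notMem.1] with ω hω i hi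
  rw [notMem_compl_iff] at hω
  have h0 := hω 0
  rw [Nat.cast_zero, encard_eq_zero] at h0
  exact (h0 ▸ (show i ∈ {i | p i ω ∈ {q : ℝ × ℝ | q.1 = c}} from hi) : i ∈ (∅ : Set ℕ))

theorem markField_comap_mono (p : ℕ → Ω → ℝ × ℝ) (r : ℕ → Ω → ℝ≥0) {B B' : Set (ℝ × ℝ)}
    (hB : B ⊆ B') : MeasurableSpace.comap (markField p r B) inferInstance ≤
      MeasurableSpace.comap (markField p r B') inferInstance := by
  rw [← measurable_iff_comap_le]
  let : MeasurableSpace Ω := MeasurableSpace.comap (markField p r B') inferInstance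
  exact measurable_pi_lambda _ fun a =>
    measurable_markSum_comap p r a.2.1 a.2.2.1 (a.2.2.2.1.trans hB) a.2.2.2.2

theorem measurableSet_translate {A : Set (ℝ × ℝ)} (hA : MeasurableSet A) (z : ℝ × ℝ) :
    MeasurableSet ((fun q => q - z) ⁻¹' A) := (measurable_id.sub_const z) hA

theorem isBounded_translate {A : Set (ℝ × ℝ)} (hA : Bornology.IsBounded A) (z : ℝ × ℝ) :
    Bornology.IsBounded ((fun q => q - z) ⁻¹' A) := by
  have : (fun q => q - z) ⁻¹' A = (fun q => q + z) '' A := by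
    ext q
    simp only [mem_preimage, mem_image]
    exact ⟨fun hq => ⟨q - z, hq, by simp⟩, by rintro ⟨y, hy, rfl⟩; simpa using hy⟩
  rw [this]
  exact (LipschitzWith.of_dist_le_mul (K := 1) (by simp)).isBounded_image hA

theorem measurable_gridRewards_comap (p : ℕ → Ω → ℝ × ℝ) (r : ℕ → Ω → ℝ≥0) {S : ℝ} (hS : 0 < S)
    (q₀ : ℝ × ℝ) {B : Set (ℝ × ℝ)} (hB : {q | q₀.1 < q.1 ∧ q.1 ≤ q₀.1 + S} ⊆ B) :
    Measurable[MeasurableSpace.comap (markField p r B) inferInstance]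
      (gridRewards p r S q₀) := by
  let : MeasurableSpace Ω := MeasurableSpace.comap (markField p r B) inferInstance
  refine measurable_pi_lambda _ fun a => measurable_markSum_comap p r
    (measurableSet_translate (measurableSet_gridCell S a) q₀)
    (isBounded_translate (isBounded_gridCell S a) q₀) (fun q hq => hB ?_) measurable_id
  have := gridCell_subset hS a hq
  simp only [Prod.fst_sub, mem_ofPred_eq] at this ⊢
  constructor <;> linarith [this.1, this.2]

theorem IsPoissonRewardField.measurable_gridRewards (h : IsPoissonRewardField P lam F p r) (S : ℝ)
    (q₀ : ℝ × ℝ) : Measurable (gridRewards p r S q₀) :=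
  measurable_pi_lambda _ fun a => h.measurable_markSum
    (measurableSet_translate (measurableSet_gridCell S a) q₀) measurable_id

/-- The law of the optimal reward over the longitudinal distance `S`. -/
noncomputable def segmentLaw (P : Measure Ω) (p : ℕ → Ω → ℝ × ℝ) (r : ℕ → Ω → ℝ≥0) (S : ℝ) :
    Measure ℝ≥0∞ :=
  P.map fun ω => gridValue S 0 (gridRewards p r S 0 ω)

theorem IsPoissonRewardField.map_gridRewards [IsProbabilityMeasure P] [IsProbabilityMeasure F]
    (h : IsPoissonRewardField P lam F p r) (S : ℝ) (q₀ : ℝ × ℝ) :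
    P.map (gridRewards p r S q₀) = P.map (gridRewards p r S 0) := by
  have := h.map_markSum_translate (A := gridCell S) (g := fun _ => id) (measurableSet_gridCell S)
    (isBounded_gridCell S) (fun _ => measurable_id)
  have h0 := this 0
  rw [← this q₀] at h0
  exact h0.symm

theorem IsPoissonRewardField.isProbabilityMeasure_segmentLaw [IsProbabilityMeasure P]
    (h : IsPoissonRewardField P lam F p r) (S : ℝ) : IsProbabilityMeasure (segmentLaw P p r S) :=
  Measure.isProbabilityMeasure_map (measurable_gridValue_comp S measurable_const (h.measurable_gridRewards S 0)).aemeasurable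

/-- Starting at height `y` amounts to anchoring the grid at height `y`. The two grids need not be
aligned, so the comparison passes through `chainValue`, which knows nothing of the grid; translation
invariance does the rest. -/
theorem IsPoissonRewardField.map_gridValue [IsProbabilityMeasure P] [IsProbabilityMeasure F]
    (h : IsPoissonRewardField P lam F p r) {S : ℝ} (hS : 0 < S) (q₀ : ℝ × ℝ) (y : ℝ) :
    (P.map (gridRewards p r S q₀)).map (gridValue S y) = segmentLaw P p r S := by
  have hm : Measurable (gridValue S 0) := measurable_gridValue_comp S measurable_const measurable_id
  have hmy : Measurable (gridValue S y) := measurable_gridValue_comp S measurable_const measurable_id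
  have hR := fun q => h.measurable_gridRewards S q
  have e : P.map (fun ω => gridValue S y (gridRewards p r S q₀ ω)) =
      P.map (fun ω => gridValue S 0 (gridRewards p r S (q₀.1, q₀.2 + y) ω)) := by
    refine Measure.map_congr ?_
    filter_upwards [h.locally_finite] with ω hω
    rw [← chainValue_eq_gridValue hS q₀ y hω, ← chainValue_eq_gridValue hS _ 0 hω]
    simp
  rw [Measure.map_map hmy (hR _)]
  change P.map (fun ω => gridValue S y (gridRewards p r S q₀ ω)) = _
  rw [e, segmentLaw]
  change P.map (gridValue S 0 ∘ gridRewards p r S (q₀.1, q₀.2 + y)) =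
    P.map (gridValue S 0 ∘ gridRewards p r S 0)
  rw [← Measure.map_map hm (hR _), ← Measure.map_map hm (hR _), h.map_gridRewards]

/-- The optimal reward ahead of a state that depends on the past has the law of the optimal reward
from the origin, and is independent of the past. -/
theorem IsPoissonRewardField.map_prod_gridValue [IsProbabilityMeasure P] [IsProbabilityMeasure F]
    (h : IsPoissonRewardField P lam F p r) {S : ℝ} (hS : 0 < S) (x₀ : ℝ) {β : Type*}
    [MeasurableSpace β] {Z : Ω → β} {Y : Ω → ℝ}
    (hZ : Measurable[MeasurableSpace.comap (markField p r {q | q.1 ≤ x₀}) inferInstance] Z)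
    (hY : Measurable[MeasurableSpace.comap (markField p r {q | q.1 ≤ x₀}) inferInstance] Y) :
    P.map (fun ω => (Z ω, gridValue S (Y ω) (gridRewards p r S (x₀, 0) ω))) =
      (P.map Z).prod (segmentLaw P p r S) := by
  have hproc : ∀ B, Measurable (markField p r B) := fun B =>
    measurable_pi_lambda _ fun a => h.measurable_markSum a.2.1 a.2.2.2.2
  have hle := (hproc {q | q.1 ≤ x₀}).comap_le
  have hZ' : Measurable Z := hZ.mono hle le_rfl
  have hY' : Measurable Y := hY.mono hle le_rfl
  have hR := h.measurable_gridRewards S (x₀, 0)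
  -- The grid cells are open on the left, so the reward ahead only uses targets strictly beyond
  -- `x₀`.
  have hd : Disjoint {q : ℝ × ℝ | q.1 ≤ x₀} {q | x₀ < q.1} :=
    Set.disjoint_left.2 fun q (h1 : q.1 ≤ x₀) (h2 : x₀ < q.1) => not_lt.2 h1 h2
  have hind : IndepFun (fun ω => (Z ω, Y ω)) (gridRewards p r S (x₀, 0)) P := by
    have hi := h.indepFun_markField hd
    rw [IndepFun_iff_Indep] at hi ⊢
    refine indep_of_indep_of_le_left (indep_of_indep_of_le_right hi ?_) ?_
    · exact (measurable_gridRewards_comap p r hS _ fun q hq => hq.1).comap_le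
    · let m : MeasurableSpace Ω :=
        MeasurableSpace.comap (markField p r {q | q.1 ≤ x₀}) inferInstance
      exact (hZ.prodMk hY).comap_le
  have hlaw := (indepFun_iff_map_prod_eq_prod_map_map (hZ'.prodMk hY').aemeasurable
    hR.aemeasurable).1 hind
  have := Measure.isProbabilityMeasure_map (μ := P) (hZ'.prodMk hY').aemeasurable
  have := Measure.isProbabilityMeasure_map (μ := P) hR.aemeasurable
  have := h.isProbabilityMeasure_segmentLaw S
  have key := map_prod_eq_prod_of_map_eq (P.map fun ω => (Z ω, Y ω))
    (P.map (gridRewards p r S (x₀, 0))) (segmentLaw P p r S) (measurable_gridValue S)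
    (fun y => h.map_gridValue hS (x₀, 0) y)
  rw [← hlaw, Measure.map_map (measurable_fst.fst.prodMk (measurable_gridValue_comp S measurable_fst.snd
      measurable_snd)) ((hZ'.prodMk hY').prodMk hR),
    Measure.map_map measurable_fst (hZ'.prodMk hY')] at key
  exact key

theorem IsPoissonRewardField.optimalReward_ae_eq [IsProbabilityMeasure P]
    (h : IsPoissonRewardField P lam F p r) {v S : ℝ} (hv : 0 < v) (hS : 0 < S) :
    (fun ω => optimalReward v v (fun i => p i ω) (fun i => r i ω) S) =ᵐ[P]
      fun ω => gridValue S 0 (gridRewards p r S 0 ω) := by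
  filter_upwards [h.locally_finite, h.ae_notMem_line 0] with ω hω h0
  rw [optimalReward_eq_chainValue hv hS.le, ← chainValue_eq_gridValue hS 0 0 hω]
  simp only [Prod.fst_zero, Prod.snd_zero, add_zero, zero_add]
  refine chainValue_congr fun i => ?_
  have := h0 i
  simp only [mem_ofPred_eq]
  exact and_congr_left' ⟨fun h => lt_of_le_of_ne h (Ne.symm this), le_of_lt⟩

theorem startState_fst {v S : ℝ} (hv : 0 < v) (hS : 0 < S) {X : ℕ → Ω → ℝ → ℝ × ℝ}
    (hX : ∀ k ω, IsTrajectory v v (S / v) (startState v S X k ω) (X k ω)) (k : ℕ) (ω : Ω) :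
    (startState v S X k ω).1 = k * S := by
  induction k with
  | zero => simp [startState]
  | succ k ih =>
    rw [startState, (hX k ω).fst_eq ⟨by positivity, le_rfl⟩, ih, mul_div_cancel₀ _ hv.ne']
    push_cast
    ring

/-- A plan made at `kS` looks at most `S` ahead, so the state at its end is known from the targets
with `x₁ ≤ (k + 1)S`. Nothing else is needed of the information available to the robot. -/
theorem IsRecedingHorizonRun.measurable_startState {v S : ℝ} (hv : 0 < v) (hS : 0 < S)
    {X : ℕ → Ω → ℝ → ℝ × ℝ} (hX : IsRecedingHorizonRun P v v p r S X) (k : ℕ) :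
    Measurable[MeasurableSpace.comap (markField p r {q | q.1 ≤ k * S}) inferInstance]
      (startState v S X k) := by
  cases k with
  | zero => exact @measurable_const _ _ _ (_) _
  | succ k =>
    have hsub : sensedRegion S (k * S) ⊆ {q | q.1 ≤ ((k + 1 : ℕ) : ℝ) * S} := by
      intro q hq
      simp only [sensedRegion, mem_iUnion] at hq
      obtain ⟨s, hs, hq⟩ := hq
      simp only [mem_ofPred_eq] at hq ⊢
      push_cast
      linarith [hs.2, hq.2]
    exact (hX.adapted k (S / v) ⟨by positivity, le_rfl⟩).mono
      ((information_le_comap p r _).trans (markField_comap_mono p r hsub)) le_rfl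

/-- The reward that the run collects in iteration `k`, as a function of the reward field. -/
noncomputable def iterationReward (p : ℕ → Ω → ℝ × ℝ) (r : ℕ → Ω → ℝ≥0) (v S : ℝ)
    (X : ℕ → Ω → ℝ → ℝ × ℝ) (k : ℕ) (ω : Ω) : ℝ≥0∞ :=
  gridValue S (startState v S X k ω).2 (gridRewards p r S (k * S, 0) ω)

theorem IsRecedingHorizonRun.measurable_iterationReward {v S : ℝ} (hv : 0 < v) (hS : 0 < S)
    {X : ℕ → Ω → ℝ → ℝ × ℝ} (hX : IsRecedingHorizonRun P v v p r S X) {j k : ℕ} (hjk : j < k) :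
    Measurable[MeasurableSpace.comap (markField p r {q | q.1 ≤ k * S}) inferInstance]
      (iterationReward p r v S X j) := by
  have hjk' : ((j : ℝ) + 1) * S ≤ k * S := by
    refine mul_le_mul_of_nonneg_right ?_ hS.le
    exact_mod_cast hjk
  have h1 := (hX.measurable_startState hv hS j).mono
    (markField_comap_mono p r (B' := {q | q.1 ≤ k * S}) fun q hq => by
      simp only [mem_ofPred_eq] at hq ⊢; linarith) le_rfl
  have h2 := measurable_gridRewards_comap p r hS ((j * S, 0) : ℝ × ℝ) (B := {q | q.1 ≤ k * S})
    fun q hq => by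
      simp only [mem_ofPred_eq] at hq ⊢; linarith [hq.2]
  let : MeasurableSpace Ω := MeasurableSpace.comap (markField p r {q | q.1 ≤ k * S}) inferInstance
  exact measurable_gridValue_comp S h1.snd h2

/-- By optimality of the plan, ties influence the reward of an iteration only through its starting
state. -/
theorem IsRecedingHorizonRun.collected_ae_eq [IsProbabilityMeasure P]
    (h : IsPoissonRewardField P lam F p r) {v S : ℝ} (hv : 0 < v) (hS : 0 < S)
    {X : ℕ → Ω → ℝ → ℝ × ℝ} (hX : IsRecedingHorizonRun P v v p r S X) :
    ∀ᵐ ω ∂P, ∀ k, collected (fun i => p i ω) (fun i => r i ω) (S / v) (X k ω) =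
      iterationReward p r v S X k ω := by
  filter_upwards [h.locally_finite, ae_all_iff.2 fun k : ℕ => h.ae_notMem_line (k * S),
    hX.optimal] with ω hω h0 hopt k
  set z := startState v S X k ω with hz
  have hz1 : z.1 = k * S := startState_fst hv hS hX.feasible k ω
  have h1 : collected (fun i => p i ω) (fun i => r i ω) (S / v) (X k ω) =
      chainValue {q | z.1 ≤ q.1 ∧ q.1 ≤ z.1 + v * (S / v)} z (fun i => p i ω) (fun i => r i ω) := by
    rw [← iSup_collected_eq_chainValue hv (by positivity)]
    exact le_antisymm (le_iSup₂_of_le (X k ω) (hX.feasible k ω) le_rfl)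
      (iSup₂_le fun x hx => hopt k x hx)
  have h2 := chainValue_eq_gridValue (r := r) hS ((k * S, 0) : ℝ × ℝ) z.2 hω
  rw [h1, iterationReward, ← hz, ← h2, zero_add, ← hz1]
  refine chainValue_congr fun i => ?_
  have := h0 k i
  rw [← hz1] at this
  simp only [mem_ofPred_eq, mul_div_cancel₀ _ hv.ne']
  exact and_congr_left' ⟨fun h => lt_of_le_of_ne h (Ne.symm this), le_of_lt⟩

theorem IsRecedingHorizonRun.map_iterationReward [IsProbabilityMeasure P] [IsProbabilityMeasure F]
    (h : IsPoissonRewardField P lam F p r) {v S : ℝ} (hv : 0 < v) (hS : 0 < S)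
    {X : ℕ → Ω → ℝ → ℝ × ℝ} (hX : IsRecedingHorizonRun P v v p r S X) (k : ℕ) :
    P.map (iterationReward p r v S X k) = segmentLaw P p r S := by
  have hz := hX.measurable_startState hv hS k
  have hz2 := (@Measurable.snd _ _ _ (_) _ _ _ hz)
  -- A trivial past leaves the marginal law.
  have : P.map (fun ω => ((), iterationReward p r v S X k ω)) = (P.map fun _ => ()).prod
      (segmentLaw P p r S) :=
    h.map_prod_gridValue hS (k * S) (Z := fun _ => ()) (@measurable_const _ _ _ (_) _) hz2
  have h2 := congrArg (Measure.map Prod.snd) this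
  have hm : Measurable (iterationReward p r v S X k) :=
    (hX.measurable_iterationReward hv hS k.lt_succ_self).mono
      (Measurable.comap_le (measurable_pi_lambda _ fun a => h.measurable_markSum a.2.1 a.2.2.2.2))
      le_rfl
  have := h.isProbabilityMeasure_segmentLaw S
  rw [Measure.map_snd_prod, Measure.map_map measurable_snd
    ((measurable_const).prodMk hm)] at h2
  rw [Measure.map_apply measurable_const MeasurableSet.univ] at h2
  simpa [Function.comp_def] using h2

/-- The earlier reward is a function of the field up to `kS`, so it may play the part of the past.
Independence in pairs is all that the variance requires. -/
theorem IsRecedingHorizonRun.indepFun_iterationReward [IsProbabilityMeasure P]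
    [IsProbabilityMeasure F]
    (h : IsPoissonRewardField P lam F p r) {v S : ℝ} (hv : 0 < v) (hS : 0 < S)
    {X : ℕ → Ω → ℝ → ℝ × ℝ} (hX : IsRecedingHorizonRun P v v p r S X) {j k : ℕ} (hjk : j < k) :
    IndepFun (iterationReward p r v S X j) (iterationReward p r v S X k) P := by
  have hm : ∀ k, Measurable (iterationReward p r v S X k) := fun k =>
    (hX.measurable_iterationReward hv hS k.lt_succ_self).mono
      (Measurable.comap_le (measurable_pi_lambda _ fun a => h.measurable_markSum a.2.1 a.2.2.2.2))
      le_rfl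
  rw [indepFun_iff_map_prod_eq_prod_map_map (hm j).aemeasurable (hm k).aemeasurable,
    hX.map_iterationReward h hv hS k]
  exact h.map_prod_gridValue hS (k * S) (hX.measurable_iterationReward hv hS hjk)
    (@Measurable.snd _ _ _ (_) _ _ _ (hX.measurable_startState hv hS k))

/-! ### First and second moments of reward sums -/

/-- The Chen–Stein identity of the Poisson law; `f = 1` and `f = id` give the first two moments. -/
theorem lintegral_mul_poissonMeasure (m : ℝ≥0) (f : ℕ → ℝ≥0∞) :
    ∫⁻ n, n * f n ∂poissonMeasure m = m * ∫⁻ n, f (n + 1) ∂poissonMeasure m := by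
  rw [poissonMeasure, lintegral_sum_measure, lintegral_sum_measure]
  simp only [lintegral_smul_measure, lintegral_dirac, smul_eq_mul]
  rw [tsum_eq_zero_add' ENNReal.summable, Nat.cast_zero, zero_mul, mul_zero, zero_add,
    ← ENNReal.tsum_mul_left]
  refine tsum_congr fun n => ?_
  rw [← mul_assoc, ← mul_assoc]
  congr 1
  rw [← ENNReal.ofReal_natCast (n + 1), ← ENNReal.ofReal_mul (by positivity),
    ← ENNReal.ofReal_coe_nnreal, ← ENNReal.ofReal_mul (by positivity)]
  congr 1
  rw [Nat.factorial_succ, pow_succ]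
  push_cast
  field_simp

theorem lintegral_id_poissonMeasure (m : ℝ≥0) : ∫⁻ n, (n : ℝ≥0∞) ∂poissonMeasure m = m := by
  simpa using lintegral_mul_poissonMeasure m 1

theorem lintegral_sq_poissonMeasure (m : ℝ≥0) :
    ∫⁻ n, (n : ℝ≥0∞) ^ 2 ∂poissonMeasure m = m * (m + 1) := by
  have := lintegral_mul_poissonMeasure m (fun n => n)
  simp only [Nat.cast_add, Nat.cast_one] at this
  rw [lintegral_add_right _ measurable_const, lintegral_id_poissonMeasure] at this
  simpa [sq] using this

theorem tsum_indicator_eq_count {ω : Ω} {A : Set (ℝ × ℝ)} (hA : {i | p i ω ∈ A}.Finite) :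
    ∑' i, A.indicator (1 : ℝ × ℝ → ℝ≥0∞) (p i ω) = count p A ω := by
  have : ∑' i, A.indicator (1 : ℝ × ℝ → ℝ≥0∞) (p i ω) = {i | p i ω ∈ A}.encard := by
    rw [← ENNReal.tsum_set_one, tsum_subtype {i | p i ω ∈ A} (fun _ => (1 : ℝ≥0∞))]
    rfl
  obtain ⟨m, hm⟩ := ENat.ne_top_iff_exists.1 hA.encard_lt_top.ne
  rw [this, count, ← hm]
  simp

theorem IsPoissonRewardField.lintegral_count [IsProbabilityMeasure P]
    (h : IsPoissonRewardField P lam F p r) {A : Set (ℝ × ℝ)} (hA : MeasurableSet A)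
    (hb : Bornology.IsBounded A) (f : ℕ → ℝ≥0∞) :
    ∫⁻ ω, f (count p A ω) ∂P = ∫⁻ n, f n ∂poissonMeasure (lam * (volume A).toNNReal) := by
  rw [← h.map_count_single hA hb, lintegral_map (measurable_of_countable f) (h.measurable_count hA)]

theorem IsPoissonRewardField.lintegral_reward (h : IsPoissonRewardField P lam F p r) (i : ℕ)
    {f : ℝ≥0 → ℝ≥0∞} (hf : Measurable f) : ∫⁻ ω, f (r i ω) ∂P = ∫⁻ s, f s ∂F := by
  rw [← h.law_reward i, lintegral_map hf (h.measurable_reward i)]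

theorem IsPoissonRewardField.lintegral_markSum [IsProbabilityMeasure P]
    (h : IsPoissonRewardField P lam F p r) {A : Set (ℝ × ℝ)} (hA : MeasurableSet A)
    (hb : Bornology.IsBounded A) {g : ℝ≥0 → ℝ≥0} (hg : Measurable g) :
    ∫⁻ ω, markSum p r A g ω ∂P = lam * volume A * ∫⁻ s, g s ∂F := by
  have hgE : Measurable fun s => (g s : ℝ≥0∞) := measurable_coe_nnreal_ennreal.comp hg
  have hind : Measurable (A.indicator (1 : ℝ × ℝ → ℝ≥0∞)) := measurable_one.indicator hA
  have e : ∀ ω, markSum p r A g ω = ∑' i, A.indicator 1 (p i ω) * (g (r i ω) : ℝ≥0∞) := fun ω => by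
    refine tsum_congr fun i => ?_
    by_cases hi : p i ω ∈ A <;> simp [hi]
  simp_rw [e]
  have hm : ∀ i, Measurable fun ω => A.indicator 1 (p i ω) * (g (r i ω) : ℝ≥0∞) := fun i =>
    (hind.comp (h.measurable_location i)).mul (hgE.comp (h.measurable_reward i))
  rw [lintegral_tsum fun i => (hm i).aemeasurable]
  have e2 : ∀ i, ∫⁻ ω, A.indicator 1 (p i ω) * (g (r i ω) : ℝ≥0∞) ∂P =
      (∫⁻ ω, A.indicator 1 (p i ω) ∂P) * ∫⁻ s, g s ∂F := fun i => by
    rw [← h.lintegral_reward i hgE]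
    refine lintegral_mul_eq_lintegral_mul_lintegral_of_indepFun
      (hind.comp (h.measurable_location i)) (hgE.comp (h.measurable_reward i)) ?_
    exact h.indep_location.comp (φ := fun f : ℕ → ℝ × ℝ => A.indicator (1 : ℝ × ℝ → ℝ≥0∞) (f i))
      (ψ := fun f : ℕ → ℝ≥0 => (g (f i) : ℝ≥0∞)) (hind.comp (measurable_pi_apply i))
      (hgE.comp (measurable_pi_apply i))
  simp_rw [e2]
  have hp : ∀ i, Measurable fun ω => A.indicator (1 : ℝ × ℝ → ℝ≥0∞) (p i ω) := fun i =>
    hind.comp (h.measurable_location i)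
  rw [ENNReal.tsum_mul_right, ← lintegral_tsum fun i => (hp i).aemeasurable]
  congr 1
  calc ∫⁻ ω, ∑' i, A.indicator (1 : ℝ × ℝ → ℝ≥0∞) (p i ω) ∂P = ∫⁻ ω, count p A ω ∂P := by
        refine lintegral_congr_ae ?_
        filter_upwards [h.locally_finite] with ω hω
        exact tsum_indicator_eq_count (hω A hb)
    _ = _ := by
        rw [h.lintegral_count hA hb fun n => n, lintegral_id_poissonMeasure]
        push_cast
        rw [ENNReal.coe_toNNReal hb.measure_lt_top.ne]

/-- The square expands into a double sum over pairs of targets. Locations and rewards separate by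
independence, and `2ab ≤ a² + b²` bounds the reward factor on and off the diagonal alike, leaving
the second moment of the count. -/
theorem IsPoissonRewardField.lintegral_markSum_sq_le [IsProbabilityMeasure P]
    (h : IsPoissonRewardField P lam F p r) {A : Set (ℝ × ℝ)} (hA : MeasurableSet A)
    (hb : Bornology.IsBounded A) :
    ∫⁻ ω, markSum p r A id ω ^ 2 ∂P ≤
      lam * volume A * (lam * volume A + 1) * ∫⁻ s, (s : ℝ≥0∞) ^ 2 ∂F := by
  have hgE : Measurable fun s : ℝ≥0 => (s : ℝ≥0∞) := measurable_coe_nnreal_ennreal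
  have hr : ∀ i, Measurable fun ω => (r i ω : ℝ≥0∞) := fun i => hgE.comp (h.measurable_reward i)
  have hind : Measurable (A.indicator (1 : ℝ × ℝ → ℝ≥0∞)) := measurable_one.indicator hA
  have hp : ∀ i, Measurable fun ω => A.indicator (1 : ℝ × ℝ → ℝ≥0∞) (p i ω) := fun i =>
    hind.comp (h.measurable_location i)
  have e : ∀ ω, markSum p r A id ω ^ 2 = ∑' i, ∑' j,
      (A.indicator 1 (p i ω) * A.indicator 1 (p j ω)) * ((r i ω : ℝ≥0∞) * r j ω) := fun ω => by
    rw [sq, markSum, ← ENNReal.tsum_mul_right]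
    refine tsum_congr fun i => ?_
    rw [← ENNReal.tsum_mul_left]
    refine tsum_congr fun j => ?_
    by_cases hi : p i ω ∈ A <;> by_cases hj : p j ω ∈ A <;> simp [hi, hj]
  simp_rw [e]
  have hpp : ∀ i j, Measurable fun ω =>
      A.indicator 1 (p i ω) * A.indicator (1 : ℝ × ℝ → ℝ≥0∞) (p j ω) := fun i j => (hp i).mul (hp j)
  have hppr : ∀ i j, Measurable fun ω => (A.indicator 1 (p i ω) * A.indicator 1 (p j ω)) *
      ((r i ω : ℝ≥0∞) * r j ω) := fun i j => (hpp i j).mul ((hr i).mul (hr j))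
  rw [lintegral_tsum fun i => (Measurable.tsum fun j => hppr i j).aemeasurable]
  have e1 : ∀ i, ∫⁻ ω, ∑' j, (A.indicator 1 (p i ω) * A.indicator 1 (p j ω)) *
      ((r i ω : ℝ≥0∞) * r j ω) ∂P = ∑' j, ∫⁻ ω, (A.indicator 1 (p i ω) * A.indicator 1 (p j ω)) *
      ((r i ω : ℝ≥0∞) * r j ω) ∂P := fun i =>
    lintegral_tsum fun j => (hppr i j).aemeasurable
  simp_rw [e1]
  have e2 : ∀ i j, ∫⁻ ω, (A.indicator 1 (p i ω) * A.indicator 1 (p j ω)) *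
      ((r i ω : ℝ≥0∞) * r j ω) ∂P ≤
      (∫⁻ ω, A.indicator 1 (p i ω) * A.indicator 1 (p j ω) ∂P) * ∫⁻ s, (s : ℝ≥0∞) ^ 2 ∂F := by
    intro i j
    have : ∫⁻ ω, (A.indicator 1 (p i ω) * A.indicator 1 (p j ω)) *
      ((r i ω : ℝ≥0∞) * r j ω) ∂P = (∫⁻ ω, A.indicator 1 (p i ω) * A.indicator 1 (p j ω) ∂P) *
        ∫⁻ ω, ((r i ω : ℝ≥0∞) * r j ω) ∂P := by
      refine lintegral_mul_eq_lintegral_mul_lintegral_of_indepFun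
        ((hp i).mul (hp j)) ((hr i).mul (hr j)) ?_
      exact h.indep_location.comp
        (φ := fun f : ℕ → ℝ × ℝ => A.indicator (1 : ℝ × ℝ → ℝ≥0∞) (f i) * A.indicator 1 (f j))
        (ψ := fun f : ℕ → ℝ≥0 => (f i : ℝ≥0∞) * f j)
        ((hind.comp (measurable_pi_apply i)).mul (hind.comp (measurable_pi_apply j)))
        ((hgE.comp (measurable_pi_apply i)).mul (hgE.comp (measurable_pi_apply j)))
    rw [this]
    gcongr
    have hle : ∀ ω, 2 * ((r i ω : ℝ≥0∞) * r j ω) ≤ (r i ω : ℝ≥0∞) ^ 2 + (r j ω : ℝ≥0∞) ^ 2 := by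
      intro ω
      have : 2 * (r i ω * r j ω) ≤ r i ω ^ 2 + r j ω ^ 2 := by
        rw [← mul_assoc]; exact two_mul_le_add_sq _ _
      exact_mod_cast this
    have h2 := lintegral_mono (μ := P) hle
    have m1 : Measurable fun ω => (r i ω : ℝ≥0∞) * r j ω := (hr i).mul (hr j)
    have m2 : Measurable fun ω => (r i ω : ℝ≥0∞) ^ 2 := (hr i).pow_const 2
    have m3 : Measurable fun s : ℝ≥0 => (s : ℝ≥0∞) ^ 2 := hgE.pow_const 2
    rw [lintegral_const_mul _ m1, lintegral_add_left m2, h.lintegral_reward i m3,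
      h.lintegral_reward j m3, ← two_mul] at h2
    exact (ENNReal.mul_le_mul_iff_right (by simp) (by simp)).1 h2
  refine (ENNReal.tsum_le_tsum fun i => ENNReal.tsum_le_tsum fun j => e2 i j).trans (le_of_eq ?_)
  simp_rw [ENNReal.tsum_mul_right]
  congr 1
  have e3 : ∀ i, ∑' j, ∫⁻ ω, A.indicator 1 (p i ω) * A.indicator (1 : ℝ × ℝ → ℝ≥0∞) (p j ω) ∂P =
      ∫⁻ ω, ∑' j, A.indicator 1 (p i ω) * A.indicator 1 (p j ω) ∂P := fun i =>
    (lintegral_tsum fun j => (hpp i j).aemeasurable).symm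
  simp_rw [e3]
  rw [← lintegral_tsum fun i => (Measurable.tsum fun j => hpp i j).aemeasurable]
  calc ∫⁻ ω, ∑' i, ∑' j, A.indicator 1 (p i ω) * A.indicator (1 : ℝ × ℝ → ℝ≥0∞) (p j ω) ∂P
      = ∫⁻ ω, (count p A ω : ℝ≥0∞) ^ 2 ∂P := by
        refine lintegral_congr_ae ?_
        filter_upwards [h.locally_finite] with ω hω
        simp_rw [ENNReal.tsum_mul_left, ENNReal.tsum_mul_right, tsum_indicator_eq_count (hω A hb), sq]
    _ = _ := by
        rw [h.lintegral_count hA hb fun n => (n : ℝ≥0∞) ^ 2, lintegral_sq_poissonMeasure]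
        push_cast
        rw [ENNReal.coe_toNNReal hb.measure_lt_top.ne]

/-! ### Finiteness of the optimal mean reward -/

/-- The rectangle that contains all targets within reach over the longitudinal distance `L`. -/
def reachBox (L : ℝ) : Set (ℝ × ℝ) := Icc 0 L ×ˢ Icc (-L) L

theorem measurableSet_reachBox (L : ℝ) : MeasurableSet (reachBox L) :=
  measurableSet_Icc.prod measurableSet_Icc

theorem isBounded_reachBox (L : ℝ) : Bornology.IsBounded (reachBox L) :=
  (Metric.isBounded_Icc _ _).prod (Metric.isBounded_Icc _ _)

theorem volume_reachBox {L : ℝ} (hL : 0 ≤ L) : volume (reachBox L) = ENNReal.ofReal (2 * L ^ 2) := by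
  rw [reachBox, Measure.volume_eq_prod, Measure.prod_prod, Real.volume_Icc, Real.volume_Icc,
    ← ENNReal.ofReal_mul (by linarith)]
  congr 1; ring

theorem optimalReward_le_markSum {v L : ℝ} (hv : 0 < v) (hL : 0 ≤ L) (g : ℝ≥0 → ℝ≥0) (ω : Ω) :
    optimalReward v v (fun i => p i ω) (fun i => g (r i ω)) L ≤ markSum p r (reachBox L) g ω := by
  rw [optimalReward_eq_chainValue hv hL]
  refine iSup₂_le fun I hI => le_trans (Finset.sum_le_sum fun i hi => ?_) (ENNReal.sum_le_tsum I)
  have h1 := hI.1 i hi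
  have h0 : 0 ≤ (p i ω).1 := h1.1.1
  have h2 := h1.2
  simp only [Prod.fst_zero, Prod.snd_zero, sub_zero] at h2
  rw [abs_of_nonneg h0] at h2
  have h3 := abs_le.1 (h2.trans h1.1.2)
  rw [indicator_of_mem]
  exact ⟨h1.1, h3⟩

/-- The tail integral bounds the second moment and the sum of the square roots of the tail. -/
theorem natCast_mul_tail_le (F : Measure ℝ≥0) (k : ℕ) :
    (k : ℝ≥0∞) * F {x : ℝ≥0 | (k : ℝ≥0) < x} ^ (1 / 2 : ℝ) ≤
      ∫⁻ s in Ioi (0 : ℝ), (F {x : ℝ≥0 | s < (x : ℝ)}) ^ (1 / 2 : ℝ) := by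
  calc (k : ℝ≥0∞) * F {x : ℝ≥0 | (k : ℝ≥0) < x} ^ (1 / 2 : ℝ)
      = ∫⁻ s in Ioc (0 : ℝ) k, F {x : ℝ≥0 | (k : ℝ≥0) < x} ^ (1 / 2 : ℝ) := by
        rw [setLIntegral_const, Real.volume_Ioc, mul_comm]; simp
    _ ≤ ∫⁻ s in Ioc (0 : ℝ) k, (F {x : ℝ≥0 | s < (x : ℝ)}) ^ (1 / 2 : ℝ) := by
        refine setLIntegral_mono' measurableSet_Ioc fun s hs => ?_
        refine ENNReal.rpow_le_rpow (measure_mono fun x hx => ?_) (by norm_num)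
        have : (k : ℝ) < x := by exact_mod_cast hx
        exact hs.2.trans_lt this
    _ ≤ _ := lintegral_mono_set Ioc_subset_Ioi_self

theorem tsum_tail_le (F : Measure ℝ≥0) [IsProbabilityMeasure F] :
    ∑' k : ℕ, F {x : ℝ≥0 | (k : ℝ≥0) < x} ^ (1 / 2 : ℝ) ≤
      1 + ∫⁻ s in Ioi (0 : ℝ), (F {x : ℝ≥0 | s < (x : ℝ)}) ^ (1 / 2 : ℝ) := by
  rw [tsum_eq_zero_add' ENNReal.summable]
  refine add_le_add ?_ ?_
  · calc _ ≤ (1 : ℝ≥0∞) ^ (1 / 2 : ℝ) := ENNReal.rpow_le_rpow prob_le_one (by norm_num)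
      _ = 1 := ENNReal.one_rpow _
  · have hd : Pairwise (Function.onFun Disjoint fun k : ℕ => Ioc (k : ℝ) (k + 1)) := by
      intro i j hij
      refine Set.disjoint_left.2 fun x hx hx' => hij ?_
      have h1 : (i : ℝ) < j + 1 := hx.1.trans_le hx'.2
      have h2 : (j : ℝ) < i + 1 := hx'.1.trans_le hx.2
      norm_cast at h1 h2
      omega
    calc ∑' k : ℕ, F {x : ℝ≥0 | ((k + 1 : ℕ) : ℝ≥0) < x} ^ (1 / 2 : ℝ)
        ≤ ∑' k : ℕ, ∫⁻ s in Ioc (k : ℝ) (k + 1), (F {x : ℝ≥0 | s < (x : ℝ)}) ^ (1 / 2 : ℝ) := by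
          refine ENNReal.tsum_le_tsum fun k => ?_
          calc F {x : ℝ≥0 | ((k + 1 : ℕ) : ℝ≥0) < x} ^ (1 / 2 : ℝ)
              = ∫⁻ s in Ioc (k : ℝ) (k + 1), F {x : ℝ≥0 | ((k + 1 : ℕ) : ℝ≥0) < x} ^ (1 / 2 : ℝ) := by
                rw [setLIntegral_const, Real.volume_Ioc]; simp
            _ ≤ _ := by
                refine setLIntegral_mono' measurableSet_Ioc fun s hs => ?_
                refine ENNReal.rpow_le_rpow (measure_mono fun x hx => ?_) (by norm_num)
                have : ((k + 1 : ℕ) : ℝ) < x := by exact_mod_cast hx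
                push_cast at this
                exact hs.2.trans_lt this
      _ = ∫⁻ s in ⋃ k : ℕ, Ioc (k : ℝ) (k + 1), (F {x : ℝ≥0 | s < (x : ℝ)}) ^ (1 / 2 : ℝ) :=
          (lintegral_iUnion (fun k => measurableSet_Ioc) hd _).symm
      _ ≤ _ := lintegral_mono_set (iUnion_subset fun k x hx =>
          lt_of_le_of_lt (Nat.cast_nonneg k) hx.1)

/-- The indicator function of the rewards that exceed `k`. -/
noncomputable def exceeds (k : ℕ) : ℝ≥0 → ℝ≥0 := {x : ℝ≥0 | (k : ℝ≥0) < x}.indicator 1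

theorem measurable_exceeds (k : ℕ) : Measurable (exceeds k) :=
  measurable_one.indicator (measurableSet_lt measurable_const measurable_id)

theorem le_tsum_exceeds (x : ℝ≥0) : (x : ℝ≥0∞) ≤ ∑' k, (exceeds k x : ℝ≥0∞) := by
  have h1 : ∑ k ∈ Finset.range ⌈x⌉₊, (exceeds k x : ℝ≥0∞) = ⌈x⌉₊ := by
    rw [Finset.sum_congr rfl fun k hk => ?_, Finset.sum_const, Finset.card_range, nsmul_one]
    have : (k : ℝ≥0) < x := Nat.lt_ceil.1 (Finset.mem_range.1 hk)
    rw [exceeds, indicator_of_mem (show x ∈ {x : ℝ≥0 | (k : ℝ≥0) < x} from this)]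
    simp
  calc (x : ℝ≥0∞) ≤ ⌈x⌉₊ := by exact_mod_cast Nat.le_ceil x
    _ ≤ _ := h1 ▸ ENNReal.sum_le_tsum _

theorem sq_le_tsum_exceeds (x : ℝ≥0) :
    (x : ℝ≥0∞) ^ 2 ≤ ∑' k : ℕ, (2 * k + 1 : ℝ≥0∞) * (exceeds k x : ℝ≥0∞) := by
  have h1 : ∑ k ∈ Finset.range ⌈x⌉₊, (2 * k + 1 : ℝ≥0∞) * (exceeds k x : ℝ≥0∞) = (⌈x⌉₊ : ℝ≥0∞) ^ 2 := by
    have : ∀ n : ℕ, ∑ k ∈ Finset.range n, (2 * k + 1 : ℝ≥0∞) = (n : ℝ≥0∞) ^ 2 := fun n => by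
      induction n with
      | zero => simp
      | succ n ih => rw [Finset.sum_range_succ, ih]; push_cast; ring
    rw [← this]
    refine Finset.sum_congr rfl fun k hk => ?_
    have : (k : ℝ≥0) < x := Nat.lt_ceil.1 (Finset.mem_range.1 hk)
    rw [exceeds, indicator_of_mem (show x ∈ {x : ℝ≥0 | (k : ℝ≥0) < x} from this)]
    simp
  calc (x : ℝ≥0∞) ^ 2 ≤ (⌈x⌉₊ : ℝ≥0∞) ^ 2 := by
        gcongr; exact_mod_cast Nat.le_ceil x
    _ ≤ _ := h1 ▸ ENNReal.sum_le_tsum _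

theorem lintegral_exceeds (F : Measure ℝ≥0) (k : ℕ) :
    ∫⁻ s, (exceeds k s : ℝ≥0∞) ∂F = F {x : ℝ≥0 | (k : ℝ≥0) < x} := by
  have : ∀ s, (exceeds k s : ℝ≥0∞) = {x : ℝ≥0 | (k : ℝ≥0) < x}.indicator 1 s := fun s => by
    by_cases hs : (k : ℝ≥0) < s <;> simp [exceeds, hs]
  simp_rw [this]
  exact lintegral_indicator_one (measurableSet_lt measurable_const measurable_id)

/-- Write `t k` for the tail at `k` and `M` for the integral. Monotonicity of the tail gives `k *
√(t k) ≤ M`, so one factor `√(t k)` absorbs the weight `2k + 1` and the other is summable. -/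
theorem lintegral_sq_lt_top {F : Measure ℝ≥0} [IsProbabilityMeasure F]
    (hF : ∫⁻ s in Ioi (0 : ℝ), (F {x : ℝ≥0 | s < (x : ℝ)}) ^ (1 / 2 : ℝ) < ∞) :
    ∫⁻ s, (s : ℝ≥0∞) ^ 2 ∂F < ∞ := by
  set M := ∫⁻ s in Ioi (0 : ℝ), (F {x : ℝ≥0 | s < (x : ℝ)}) ^ (1 / 2 : ℝ)
  calc ∫⁻ s, (s : ℝ≥0∞) ^ 2 ∂F
      ≤ ∫⁻ s, ∑' k : ℕ, (2 * k + 1 : ℝ≥0∞) * (exceeds k s : ℝ≥0∞) ∂F :=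
        lintegral_mono fun s => sq_le_tsum_exceeds s
    _ = ∑' k : ℕ, (2 * k + 1 : ℝ≥0∞) * F {x : ℝ≥0 | (k : ℝ≥0) < x} := by
        have hm : ∀ k, Measurable fun s => (exceeds k s : ℝ≥0∞) := fun k =>
          measurable_coe_nnreal_ennreal.comp (measurable_exceeds k)
        rw [lintegral_tsum fun k => ((hm k).const_mul _).aemeasurable]
        refine tsum_congr fun k => ?_
        rw [lintegral_const_mul _ (hm k), lintegral_exceeds]
    _ ≤ ∑' k : ℕ, (2 * M + 1) * F {x : ℝ≥0 | (k : ℝ≥0) < x} ^ (1 / 2 : ℝ) := by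
        refine ENNReal.tsum_le_tsum fun k => ?_
        set t := F {x : ℝ≥0 | (k : ℝ≥0) < x} with ht
        have h1 : t = t ^ (1 / 2 : ℝ) * t ^ (1 / 2 : ℝ) := by
          rw [← ENNReal.rpow_add_of_nonneg _ _ (by norm_num) (by norm_num)]; norm_num
        have h2 : t ^ (1 / 2 : ℝ) ≤ 1 :=
          (ENNReal.rpow_le_rpow prob_le_one (by norm_num)).trans_eq (ENNReal.one_rpow _)
        conv_lhs => rw [h1, ← mul_assoc]
        gcongr
        rw [add_mul, mul_assoc, one_mul]
        gcongr
        exact natCast_mul_tail_le F k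
    _ = (2 * M + 1) * ∑' k : ℕ, F {x : ℝ≥0 | (k : ℝ≥0) < x} ^ (1 / 2 : ℝ) := ENNReal.tsum_mul_left
    _ ≤ (2 * M + 1) * (1 + M) := by gcongr; exact tsum_tail_le F
    _ < ∞ := by
        have := hF.ne
        exact ENNReal.mul_lt_top (by finiteness) (by finiteness)

/-- The position at time `a` of the lattice path with steps `σ l - 1`. -/
def pathHeight {n : ℕ} (σ : Fin n → Fin 3) (a : ℕ) : ℤ :=
  ∑ l ∈ Finset.range a, if h : l < n then ((σ ⟨l, h⟩ : ℕ) : ℤ) - 1 else 0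

/-- A neighbourhood of the graph of a lattice path of mesh `ε`. -/
def pathTube {n : ℕ} (ε : ℝ) (σ : Fin n → Fin 3) : Set (ℝ × ℝ) :=
  ⋃ a : Fin n, Icc (ε * (a : ℕ)) (ε * (a : ℕ) + ε) ×ˢ
    Icc (ε * pathHeight σ a - ε) (ε * pathHeight σ a + 2 * ε)

theorem measurableSet_pathTube {n : ℕ} (ε : ℝ) (σ : Fin n → Fin 3) :
    MeasurableSet (pathTube ε σ) :=
  MeasurableSet.iUnion fun _ => measurableSet_Icc.prod measurableSet_Icc

theorem isBounded_pathTube {n : ℕ} (ε : ℝ) (σ : Fin n → Fin 3) :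
    Bornology.IsBounded (pathTube ε σ) :=
  Bornology.isBounded_iUnion.2 fun _ => (Metric.isBounded_Icc _ _).prod (Metric.isBounded_Icc _ _)

theorem volume_pathTube_le {n : ℕ} {ε : ℝ} (hε : 0 ≤ ε) (σ : Fin n → Fin 3) :
    (volume (pathTube ε σ)).toReal ≤ n * (3 * ε ^ 2) := by
  have : volume (pathTube ε σ) ≤ ENNReal.ofReal (n * (3 * ε ^ 2)) := by
    refine (measure_iUnion_fintype_le _ _).trans ?_
    have e : ∀ a : Fin n, volume (Icc (ε * (a : ℕ)) (ε * (a : ℕ) + ε) ×ˢ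
        Icc (ε * pathHeight σ a - ε) (ε * pathHeight σ a + 2 * ε)) = ENNReal.ofReal (3 * ε ^ 2) := by
      intro a
      rw [Measure.volume_eq_prod, Measure.prod_prod, Real.volume_Icc, Real.volume_Icc,
        ← ENNReal.ofReal_mul (by linarith)]
      congr 1; ring
    simp_rw [e]
    rw [Finset.sum_const, Finset.card_univ, Fintype.card_fin, nsmul_eq_mul,
      ENNReal.ofReal_mul (p := n) (by positivity), ENNReal.ofReal_natCast]
  exact ENNReal.toReal_le_of_le_ofReal (by positivity) this

/-- Sample the path at multiples of the mesh `ε` and round the heights down. The height moves by at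
most `ε` per step, so the rounded one, in units of `ε`, changes by less than `2`: three choices per
step. Between samples the path stays within `ε` of a height in `[εb, εb + ε)`, which explains the
window from `-ε` to `2ε`. -/
theorem exists_pathTube {v L : ℝ} (hv : 0 < v) (hL : 0 < L) {n : ℕ} (hn : 0 < n)
    {x : ℝ → ℝ × ℝ} (hx : IsTrajectory v v (L / v) 0 x) :
    ∃ σ : Fin n → Fin 3, ∀ t ∈ Icc 0 (L / v), x t ∈ pathTube (L / n) σ := by
  have hn' : (0 : ℝ) < n := by exact_mod_cast hn
  set ε := L / n with hεd
  have hε : 0 < ε := by positivity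
  have hεn : ε * n = L := by rw [hεd]; field_simp
  have hfst : ∀ t ∈ Icc 0 (L / v), (x t).1 = v * t := fun t ht => by
    rw [hx.fst_eq ht]; simp
  have htime : ∀ a : ℕ, a ≤ n → ε * a / v ∈ Icc 0 (L / v) := fun a ha => by
    refine ⟨by positivity, ?_⟩
    gcongr
    rw [← hεn]
    gcongr
  have hfsta : ∀ a : ℕ, a ≤ n → (x (ε * a / v)).1 = ε * a := fun a ha => by
    rw [hfst _ (htime a ha), mul_div_cancel₀ _ hv.ne']
  let b : ℕ → ℤ := fun a => ⌊(x (ε * a / v)).2 / ε⌋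
  have hb1 : ∀ a : ℕ, ε * b a ≤ (x (ε * a / v)).2 := fun a => by
    have := Int.floor_le ((x (ε * a / v)).2 / ε)
    rw [le_div_iff₀ hε] at this
    linarith
  have hb2 : ∀ a : ℕ, (x (ε * a / v)).2 < ε * b a + ε := fun a => by
    have := Int.lt_floor_add_one ((x (ε * a / v)).2 / ε)
    rw [div_lt_iff₀ hε] at this
    linarith
  have hb0 : b 0 = 0 := by
    simp [b, hx.apply_zero (by positivity)]
  have hstep : ∀ a, a < n → -1 ≤ b (a + 1) - b a ∧ b (a + 1) - b a ≤ 1 := by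
    intro a ha
    have hc := hx.cone hv (htime a ha.le) (htime (a + 1) ha)
    rw [hfsta a ha.le, hfsta (a + 1) ha] at hc
    have e : ε * ((a + 1 : ℕ) : ℝ) - ε * a = ε := by push_cast; ring
    rw [e, abs_of_pos hε] at hc
    have h1 := abs_le.1 hc
    have c1 := hb1 a
    have c2 := hb2 a
    have c3 := hb1 (a + 1)
    have c4 := hb2 (a + 1)
    have d1 : ((b (a + 1) : ℤ) : ℝ) < b a + 2 := by
      refine lt_of_mul_lt_mul_left ?_ hε.le
      linarith
    have d2 : ((b a : ℤ) : ℝ) < b (a + 1) + 2 := by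
      refine lt_of_mul_lt_mul_left ?_ hε.le
      linarith
    norm_cast at d1 d2
    omega
  let σ : Fin n → Fin 3 := fun l => ⟨(b (l + 1) - b l + 1).toNat, by have := hstep l l.2; omega⟩
  have hσ : ∀ a, a ≤ n → pathHeight σ a = b a := by
    intro a ha
    have : pathHeight σ a = ∑ l ∈ Finset.range a, (b (l + 1) - b l) := by
      refine Finset.sum_congr rfl fun l hl => ?_
      have hl' : l < n := (Finset.mem_range.1 hl).trans_le ha
      have := hstep l hl'
      rw [dif_pos hl']
      simp only [σ]
      omega
    rw [this, Finset.sum_range_sub, hb0, sub_zero]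
  refine ⟨σ, fun t ht => ?_⟩
  have hvt : 0 ≤ v * t := mul_nonneg hv.le ht.1
  have hvL : v * t ≤ L := by
    have := mul_le_mul_of_nonneg_left ht.2 hv.le
    rwa [mul_div_cancel₀ _ hv.ne'] at this
  obtain ⟨a, ha, ha1, ha2⟩ : ∃ a : ℕ, a < n ∧ ε * a ≤ v * t ∧ v * t ≤ ε * a + ε := by
    rcases hvL.lt_or_eq with hlt | heq
    · refine ⟨⌊v * t / ε⌋₊, ?_, ?_, ?_⟩
      · rw [Nat.floor_lt (by positivity), div_lt_iff₀ hε]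
        linarith
      · have := Nat.floor_le (a := v * t / ε) (by positivity)
        rw [le_div_iff₀ hε] at this
        linarith
      · have := Nat.lt_floor_add_one (v * t / ε)
        rw [div_lt_iff₀ hε] at this
        linarith
    -- At the right end the floor would give `n`; the last column is closed and contains this point.
    · refine ⟨n - 1, by omega, ?_, ?_⟩
      · rw [Nat.cast_sub hn, heq, ← hεn]
        push_cast
        nlinarith
      · rw [Nat.cast_sub hn, heq, ← hεn]
        push_cast
        nlinarith
  refine mem_iUnion.2 ⟨⟨a, ha⟩, ?_⟩
  have hc := hx.cone hv (htime a ha.le) ht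
  rw [hfsta a ha.le, hfst t ht, abs_of_nonneg (a := v * t - ε * a) (by linarith)] at hc
  have h1 := abs_le.1 hc
  have c1 := hb1 a
  have c2 := hb2 a
  simp only [hσ a ha.le]
  refine ⟨⟨by rw [hfst t ht]; exact ha1, by rw [hfst t ht]; exact ha2⟩, ?_, ?_⟩
  · linarith [h1.1]
  · linarith [h1.2]

theorem optimalReward_le_iSup_pathTube {v L : ℝ} (hv : 0 < v) (hL : 0 < L) {n : ℕ} (hn : 0 < n)
    (g : ℝ≥0 → ℝ≥0) (ω : Ω) :
    optimalReward v v (fun i => p i ω) (fun i => g (r i ω)) L ≤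
      ⨆ σ : Fin n → Fin 3, markSum p r (pathTube (L / n) σ) g ω := by
  refine iSup₂_le fun x hx => ?_
  obtain ⟨σ, hσ⟩ := exists_pathTube hv hL hn hx
  refine le_iSup_of_le σ (collected_le fun I hI => ?_)
  refine le_trans (Finset.sum_le_sum fun i hi => ?_) (ENNReal.sum_le_tsum I)
  obtain ⟨t, ht, e⟩ := hI i hi
  rw [indicator_of_mem (e ▸ hσ t ht)]

/-- The count of targets with mark in `C` is a thinned Poisson variable. Integrating out the marks
gives each target in `A` the mean factor `c = 1 + (e - 1) F(C)`, and the generating function of the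
full count at `c` gives the bound. Fatou's lemma covers the infinite product, since only an
inequality is needed. -/
theorem IsPoissonRewardField.lintegral_exp_markSum_le [IsProbabilityMeasure P]
    [IsProbabilityMeasure F] (h : IsPoissonRewardField P lam F p r) {A : Set (ℝ × ℝ)}
    (hA : MeasurableSet A) (hb : Bornology.IsBounded A) {C : Set ℝ≥0} (hC : MeasurableSet C) :
    ∫⁻ ω, ENNReal.ofReal (Real.exp (markSum p r A (C.indicator 1) ω).toReal) ∂P ≤
      ENNReal.ofReal (Real.exp (lam * (volume A).toReal * ((Real.exp 1 - 1) * (F C).toReal))) := by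
  classical
  set g : ℝ≥0 → ℝ≥0 := C.indicator 1 with hg
  have hgm : Measurable g := measurable_one.indicator hC
  set θ := (F C).toReal with hθ
  have hθ0 : 0 ≤ θ := ENNReal.toReal_nonneg
  have hθ1 : θ ≤ 1 := measureReal_le_one
  have he1 : 1 ≤ Real.exp 1 := Real.one_le_exp zero_le_one
  set c := 1 + (Real.exp 1 - 1) * θ with hc
  have hc1 : 1 ≤ c := by nlinarith
  let f : ℝ × ℝ → ℝ≥0 → ℝ≥0∞ := fun x s => ENNReal.ofReal (Real.exp (A.indicator (fun _ => (g s : ℝ)) x))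
  have hf : Measurable fun x : (ℝ × ℝ) × ℝ≥0 => f x.1 x.2 := by
    refine ENNReal.measurable_ofReal.comp (Real.measurable_exp.comp ?_)
    simp only [indicator_apply]
    exact Measurable.ite (measurable_fst hA)
      (measurable_coe_nnreal_real.comp (hgm.comp measurable_snd)) measurable_const
  have hfint : ∀ x, ∫⁻ s, f x s ∂F = if x ∈ A then ENNReal.ofReal c else 1 := by
    intro x
    split_ifs with hx
    · have e : ∀ s, f x s = C.indicator (fun _ => ENNReal.ofReal (Real.exp 1)) s +
          Cᶜ.indicator 1 s := fun s => by
        by_cases hs : s ∈ C <;> simp [f, hx, hg, hs]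
      simp_rw [e]
      rw [lintegral_add_left (measurable_const.indicator hC), lintegral_indicator_const hC,
        lintegral_indicator_one hC.compl, prob_compl_eq_one_sub hC,
        ← ENNReal.ofReal_toReal (measure_ne_top F C), ← hθ, ← ENNReal.ofReal_mul (by positivity),
        ← ENNReal.ofReal_one, ← ENNReal.ofReal_sub _ hθ0, ← ENNReal.ofReal_add (by positivity)
          (by linarith)]
      congr 1
      rw [hc]; ring
    · simp [f, hx]
  have hprod : ∀ m, ∫⁻ ω, ∏ i ∈ Finset.range m, f (p i ω) (r i ω) ∂P ≤
      ENNReal.ofReal (Real.exp (lam * (volume A).toReal * ((Real.exp 1 - 1) * θ))) := by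
    intro m
    rw [h.lintegral_prod_mark hf]
    calc ∫⁻ ω, ∏ i ∈ Finset.range m, ∫⁻ s, f (p i ω) s ∂F ∂P
        ≤ ∫⁻ ω, ENNReal.ofReal c ^ count p A ω ∂P := by
          refine lintegral_mono_ae ?_
          filter_upwards [h.locally_finite] with ω hω
          simp_rw [hfint]
          rw [← Finset.prod_filter, Finset.prod_const]
          refine pow_le_pow_right₀ (by rw [← ENNReal.ofReal_one]; exact ENNReal.ofReal_le_ofReal hc1) ?_
          rw [count, (hω A hb).encard_eq_coe_toFinset_card, ENat.toNat_natCast]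
          refine Finset.card_le_card fun i hi => ?_
          simpa using (Finset.mem_filter.1 hi).2
      _ = _ := by
          rw [h.lintegral_count hA hb fun n => ENNReal.ofReal c ^ n,
            lintegral_pow_poissonMeasure _ (by linarith)]
          congr 2
          push_cast
          rw [hc, add_sub_cancel_left]
  calc ∫⁻ ω, ENNReal.ofReal (Real.exp (markSum p r A g ω).toReal) ∂P
      = ∫⁻ ω, liminf (fun m => ∏ i ∈ Finset.range m, f (p i ω) (r i ω)) atTop ∂P := by
        refine lintegral_congr_ae ?_
        filter_upwards [h.locally_finite] with ω hω
        have hs := (hasSum_markSum (r := r) (hω A hb) g).tendsto_sum_nat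
        have h2 := (ENNReal.continuous_ofReal.tendsto _).comp ((Real.continuous_exp.tendsto _).comp hs)
        refine (Tendsto.liminf_eq (h2.congr fun m => ?_)).symm
        simp only [Function.comp, f]
        rw [Real.exp_sum, ENNReal.ofReal_prod_of_nonneg fun _ _ => (Real.exp_pos _).le]
    _ ≤ liminf (fun m => ∫⁻ ω, ∏ i ∈ Finset.range m, f (p i ω) (r i ω) ∂P) atTop := by
        refine lintegral_liminf_le fun m => Finset.measurable_fun_prod _ fun i _ => ?_
        exact hf.comp ((h.measurable_location i).prodMk (h.measurable_reward i))
    _ ≤ _ := liminf_le_of_le (by isBoundedDefault) fun b hb => by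
        obtain ⟨m, hm⟩ := hb.exists
        exact hm.trans (hprod m)

/-- The mean number of targets on a path, among those with a reward in `C`, is at most proportional
to the length of the path and to the square root of the intensity of these targets. -/
theorem IsPoissonRewardField.lintegral_optimalReward_indicator_le [IsProbabilityMeasure P]
    [IsProbabilityMeasure F] (h : IsPoissonRewardField P lam F p r) {C : Set ℝ≥0}
    (hC : MeasurableSet C) {v L : ℝ} (hv : 0 < v) (hL : 0 < L) :
    ∫⁻ ω, optimalReward v v (fun i => p i ω) (fun i => C.indicator 1 (r i ω)) L ∂P ≤
      ENNReal.ofReal (18 * (Real.sqrt (lam * (F C).toReal) * L)) := by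
  set θ := (F C).toReal with hθ
  have hθ0 : 0 ≤ θ := ENNReal.toReal_nonneg
  set g : ℝ≥0 → ℝ≥0 := C.indicator 1 with hg
  have hgm : Measurable g := measurable_one.indicator hC
  -- The length of the path in units of the typical spacing of the targets with reward in `C`.
  set s := Real.sqrt (lam * θ) * L with hs
  have hs0 : 0 ≤ s := by positivity
  have hs2 : s ^ 2 = lam * θ * L ^ 2 := by rw [hs, mul_pow, Real.sq_sqrt (by positivity)]
  -- For a short path the mean number `2s²` of all targets within reach is already of order `s`; for
  -- a long one, tubes of about `s` steps are used.
  rcases le_or_gt s 1 with hs1 | hs1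
  · calc ∫⁻ ω, optimalReward v v (fun i => p i ω) (fun i => g (r i ω)) L ∂P
        ≤ ∫⁻ ω, markSum p r (reachBox L) g ω ∂P :=
          lintegral_mono fun ω => optimalReward_le_markSum hv hL.le g ω
      _ = ENNReal.ofReal (2 * s ^ 2) := by
          rw [h.lintegral_markSum (measurableSet_reachBox L) (isBounded_reachBox L) hgm,
            volume_reachBox hL.le]
          have : ∫⁻ s, (g s : ℝ≥0∞) ∂F = F C := by
            rw [← lintegral_indicator_one hC]
            refine lintegral_congr fun s => ?_
            by_cases hs : s ∈ C <;> simp [hg, hs]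
          rw [this, ← ENNReal.ofReal_toReal (measure_ne_top F C), ← hθ, ← ENNReal.ofReal_coe_nnreal,
            ← ENNReal.ofReal_mul (by positivity), ← ENNReal.ofReal_mul (by positivity), hs2]
          congr 1; ring
      _ ≤ _ := ENNReal.ofReal_le_ofReal (by nlinarith)
  · have hn0 : 0 < ⌈s⌉₊ := Nat.ceil_pos.2 (by linarith)
    set n := ⌈s⌉₊ with hn
    have hns : s ≤ n := Nat.le_ceil s
    have hns2 : (n : ℝ) < s + 1 := Nat.ceil_lt_add_one hs0
    have hn' : (0 : ℝ) < n := by exact_mod_cast hn0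
    have hn1 : (1 : ℝ) ≤ n := by exact_mod_cast hn0
    set ε := L / n with hε
    have hε0 : 0 < ε := by positivity
    have hlε : lam * θ * ε ^ 2 ≤ 1 := by
      rw [hε, div_pow, ← mul_div_assoc, ← hs2, div_le_one (by positivity)]
      gcongr
    let N : (Fin n → Fin 3) → Ω → ℝ≥0∞ := fun σ => markSum p r (pathTube ε σ) g
    have hNm : ∀ σ, Measurable (N σ) := fun σ =>
      h.measurable_markSum (measurableSet_pathTube ε σ) hgm
    -- A tube contains at most `3n` relevant targets in the mean, and `3(e - 1) ≤ 6`.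
    have hNexp : ∀ σ, ∫⁻ ω, ENNReal.ofReal (Real.exp (N σ ω).toReal) ∂P ≤
        ENNReal.ofReal (Real.exp (6 * n)) := by
      intro σ
      refine (h.lintegral_exp_markSum_le (measurableSet_pathTube ε σ) (isBounded_pathTube ε σ)
        hC).trans (ENNReal.ofReal_le_ofReal (Real.exp_le_exp.2 ?_))
      have hv := volume_pathTube_le hε0.le σ
      have he := Real.exp_one_lt_d9
      have he1 : 1 ≤ Real.exp 1 := Real.one_le_exp zero_le_one
      calc lam * (volume (pathTube ε σ)).toReal * ((Real.exp 1 - 1) * θ)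
          ≤ lam * (n * (3 * ε ^ 2)) * ((Real.exp 1 - 1) * θ) := by
            gcongr
        _ = (lam * θ * ε ^ 2) * (3 * (Real.exp 1 - 1) * n) := by ring
        _ ≤ 1 * (3 * (Real.exp 1 - 1) * n) := by
            gcongr
        _ ≤ 6 * n := by nlinarith
    -- The maximum over tubes is bounded through `x ≤ 8n + exp (x - 8n)`. The level `8n` is `6n` for
    -- the exponential moment plus `2n` for the `3ⁿ ≤ e²ⁿ` tubes, so the exponential terms add up to
    -- at most `1` in the mean. Then `8n + 1 ≤ 8s + 9 ≤ 18s` for `s > 1`.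
    have hpoint : ∀ᵐ ω ∂P, optimalReward v v (fun i => p i ω) (fun i => g (r i ω)) L ≤
        ENNReal.ofReal (8 * n) + ∑ σ, ENNReal.ofReal (Real.exp (N σ ω).toReal) *
          ENNReal.ofReal (Real.exp (-(8 * n))) := by
      have hfin : ∀ᵐ ω ∂P, ∀ σ, N σ ω < ∞ := ae_all_iff.2 fun σ =>
        h.markSum_ae_lt_top (isBounded_pathTube ε σ) g
      filter_upwards [hfin] with ω hω
      refine (optimalReward_le_iSup_pathTube hv hL hn0 g ω).trans (iSup_le fun σ => ?_)
      refine le_trans ?_ (add_le_add le_rfl (Finset.single_le_sum (fun _ _ => zero_le) (Finset.mem_univ σ)))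
      change N σ ω ≤ _
      conv_lhs => rw [← ENNReal.ofReal_toReal (hω σ).ne]
      rw [← ENNReal.ofReal_mul (by positivity), ← Real.exp_add, ← ENNReal.ofReal_add (by positivity)
        (by positivity)]
      refine ENNReal.ofReal_le_ofReal ?_
      linarith [Real.add_one_le_exp ((N σ ω).toReal + -(8 * n))]
    calc ∫⁻ ω, optimalReward v v (fun i => p i ω) (fun i => g (r i ω)) L ∂P
        ≤ ∫⁻ ω, ENNReal.ofReal (8 * n) + ∑ σ, ENNReal.ofReal (Real.exp (N σ ω).toReal) *
          ENNReal.ofReal (Real.exp (-(8 * n))) ∂P := lintegral_mono_ae hpoint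
      _ = ENNReal.ofReal (8 * n) + ∑ σ, (∫⁻ ω, ENNReal.ofReal (Real.exp (N σ ω).toReal) ∂P) *
          ENNReal.ofReal (Real.exp (-(8 * n))) := by
          have hm : ∀ σ, Measurable fun ω => ENNReal.ofReal (Real.exp (N σ ω).toReal) := fun σ =>
            (Real.measurable_exp.comp (hNm σ).ennreal_toReal).ennreal_ofReal
          rw [lintegral_add_left measurable_const, lintegral_const, measure_univ, mul_one,
            lintegral_finsetSum _ fun σ _ => (hm σ).mul_const _]
          congr 1
          exact Finset.sum_congr rfl fun σ _ => lintegral_mul_const _ (hm σ)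
      _ ≤ ENNReal.ofReal (8 * n) + ∑ σ : Fin n → Fin 3, ENNReal.ofReal (Real.exp (6 * n)) *
          ENNReal.ofReal (Real.exp (-(8 * n))) := by
          gcongr with σ
          exact hNexp σ
      _ ≤ ENNReal.ofReal (8 * n) + ENNReal.ofReal 1 := by
          gcongr
          rw [Finset.sum_const, Finset.card_univ, Fintype.card_fun, Fintype.card_fin,
            Fintype.card_fin, nsmul_eq_mul, ← ENNReal.ofReal_natCast,
            ← ENNReal.ofReal_mul (by positivity), ← ENNReal.ofReal_mul (by positivity)]
          refine ENNReal.ofReal_le_ofReal ?_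
          have h3 : (3 : ℝ) ≤ Real.exp 2 := by
            have : Real.exp 2 = Real.exp 1 * Real.exp 1 := by rw [← Real.exp_add]; norm_num
            rw [this]; nlinarith [Real.exp_one_gt_d9]
          calc ((3 ^ n : ℕ) : ℝ) * (Real.exp (6 * n) * Real.exp (-(8 * n)))
              ≤ Real.exp 2 ^ n * (Real.exp (6 * n) * Real.exp (-(8 * n))) := by
                push_cast; gcongr
            _ = 1 := by
                rw [← Real.exp_nat_mul, ← Real.exp_add, ← Real.exp_add]
                convert! Real.exp_zero using 2
                ring
      _ ≤ ENNReal.ofReal (18 * s) := by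
          rw [← ENNReal.ofReal_add (by positivity) zero_le_one]
          exact ENNReal.ofReal_le_ofReal (by linarith)

theorem IsPoissonRewardField.comp_reward (h : IsPoissonRewardField P lam F p r) {g : ℝ≥0 → ℝ≥0}
    (hg : Measurable g) : IsPoissonRewardField P lam (F.map g) p (fun i ω => g (r i ω)) where
  measurable_location := h.measurable_location
  measurable_reward i := hg.comp (h.measurable_reward i)
  locally_finite := h.locally_finite
  simple := h.simple
  poisson := h.poisson
  law_reward i := by
    rw [← h.law_reward i, Measure.map_map hg (h.measurable_reward i)]
    rfl
  iid_reward := h.iid_reward.comp (fun _ => g) fun _ => hg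
  indep_location := h.indep_location.comp (φ := id) (ψ := fun (f : ℕ → ℝ≥0) i => g (f i))
    measurable_id (measurable_pi_lambda _ fun i => hg.comp (measurable_pi_apply i))

/-- Slice the rewards at the integers and let each slice choose its own best path. -/
theorem optimalReward_le_tsum (v : ℝ) (q : ℕ → ℝ × ℝ) (s : ℕ → ℝ≥0) {L : ℝ} :
    optimalReward v v q s L ≤ ∑' k, optimalReward v v q (fun i => exceeds k (s i)) L := by
  refine iSup₂_le fun x hx => ?_
  calc collected q s (L / v) x
      ≤ ∑' i : {i : ℕ // ∃ t ∈ Icc 0 (L / v), x t = q i}, ∑' k, (exceeds k (s i) : ℝ≥0∞) :=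
        ENNReal.tsum_le_tsum fun i => le_tsum_exceeds _
    _ = ∑' k, collected q (fun i => exceeds k (s i)) (L / v) x := ENNReal.tsum_comm
    _ ≤ _ := ENNReal.tsum_le_tsum fun k => le_iSup₂_of_le x hx le_rfl

/-- Slice `k` contributes the square root of the tail of `F` at `k`; this is where the square root
in the tail condition comes from. -/
theorem IsPoissonRewardField.lintegral_optimalReward_le [IsProbabilityMeasure P]
    [IsProbabilityMeasure F] (h : IsPoissonRewardField P lam F p r) {v L : ℝ} (hv : 0 < v)
    (hL : 0 < L) :
    ∫⁻ ω, optimalReward v v (fun i => p i ω) (fun i => r i ω) L ∂P ≤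
      ENNReal.ofReal (18 * Real.sqrt lam) *
        (1 + ∫⁻ s in Ioi (0 : ℝ), (F {x : ℝ≥0 | s < (x : ℝ)}) ^ (1 / 2 : ℝ)) * ENNReal.ofReal L := by
  have hm : ∀ k, AEMeasurable (fun ω =>
      optimalReward v v (fun i => p i ω) (fun i => exceeds k (r i ω)) L) P := fun k => by
    have hk := h.comp_reward (measurable_exceeds k)
    have : Measurable fun ω => gridValue L 0
        (gridRewards p (fun i ω => exceeds k (r i ω)) L 0 ω) :=
      measurable_gridValue_comp L measurable_const (hk.measurable_gridRewards L 0)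
    exact ⟨_, this, hk.optimalReward_ae_eq hv hL⟩
  calc ∫⁻ ω, optimalReward v v (fun i => p i ω) (fun i => r i ω) L ∂P
      ≤ ∫⁻ ω, ∑' k, optimalReward v v (fun i => p i ω) (fun i => exceeds k (r i ω)) L ∂P :=
        lintegral_mono fun ω => optimalReward_le_tsum v _ _
    _ = ∑' k, ∫⁻ ω, optimalReward v v (fun i => p i ω) (fun i => exceeds k (r i ω)) L ∂P :=
        lintegral_tsum hm
    _ ≤ ∑' k : ℕ, (ENNReal.ofReal (18 * Real.sqrt lam) *
          F {x : ℝ≥0 | (k : ℝ≥0) < x} ^ (1 / 2 : ℝ)) * ENNReal.ofReal L := by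
        refine ENNReal.tsum_le_tsum fun k => ?_
        refine (h.lintegral_optimalReward_indicator_le
          (measurableSet_lt measurable_const measurable_id) hv hL).trans (le_of_eq ?_)
        set t := F {x : ℝ≥0 | (k : ℝ≥0) < x} with ht
        have : t ^ (1 / 2 : ℝ) = ENNReal.ofReal (Real.sqrt t.toReal) := by
          rw [Real.sqrt_eq_rpow, ENNReal.toReal_rpow, ENNReal.ofReal_toReal]
          exact ENNReal.rpow_ne_top_of_nonneg (by norm_num) (measure_ne_top F _)
        rw [this, ← ENNReal.ofReal_mul (by positivity), ← ENNReal.ofReal_mul (by positivity)]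
        congr 1
        have e : F {a : ℝ≥0 | (k : ℝ≥0) < id a} = t := rfl
        rw [e, Real.sqrt_mul (by positivity)]
        ring
    _ = ENNReal.ofReal (18 * Real.sqrt lam) * (∑' k : ℕ, F {x : ℝ≥0 | (k : ℝ≥0) < x} ^ (1 / 2 : ℝ)) *
          ENNReal.ofReal L := by
        rw [ENNReal.tsum_mul_right, ENNReal.tsum_mul_left]
    _ ≤ _ := by
        gcongr
        exact tsum_tail_le F

theorem IsPoissonRewardField.optimalMeanReward_lt_top [IsProbabilityMeasure P]
    [IsProbabilityMeasure F] (h : IsPoissonRewardField P lam F p r) {v : ℝ} (hv : 0 < v)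
    (hF : ∫⁻ s in Ioi (0 : ℝ), (F {x : ℝ≥0 | s < (x : ℝ)}) ^ (1 / 2 : ℝ) < ∞) :
    optimalMeanReward P v v p r < ∞ := by
  have hlt : ENNReal.ofReal (18 * Real.sqrt lam) *
      (1 + ∫⁻ s in Ioi (0 : ℝ), (F {x : ℝ≥0 | s < (x : ℝ)}) ^ (1 / 2 : ℝ)) < ∞ :=
    ENNReal.mul_lt_top ENNReal.ofReal_lt_top (ENNReal.add_lt_top.2 ⟨ENNReal.one_lt_top, hF⟩)
  refine lt_of_le_of_lt (iSup₂_le fun L hL => ?_) hlt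
  exact ENNReal.div_le_of_le_mul (h.lintegral_optimalReward_le hv hL)

/-! ### Concatenation of iterations and the limit of the mean optimal reward -/

section Concatenation

variable {v S : ℝ} {X : ℕ → Ω → ℝ → ℝ × ℝ} {ω : Ω}

theorem abs_startState_sub_le (hv : 0 < v) (hS : 0 < S)
    (hX : ∀ k ω, IsTrajectory v v (S / v) (startState v S X k ω) (X k ω)) {k m : ℕ} (hkm : k ≤ m) :
    |(startState v S X m ω).2 - (startState v S X k ω).2| ≤ m * S - k * S := by
  induction m, hkm using Nat.le_induction with
  | base => simp
  | succ m hkm ih =>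
    have h := (hX m ω).cone hv (s := 0) (t := S / v) ⟨le_rfl, by positivity⟩ ⟨by positivity, le_rfl⟩
    rw [(hX m ω).apply_zero (by positivity)] at h
    have e : (startState v S X (m + 1) ω) = X m ω (S / v) := rfl
    rw [← e, startState_fst hv hS hX, startState_fst hv hS hX,
      abs_of_nonneg (a := ((m + 1 : ℕ) : ℝ) * S - m * S) (by push_cast; linarith)] at h
    push_cast at h ⊢
    have h1 := abs_le.1 h
    have h2 := abs_le.1 ih
    rw [abs_le]
    constructor <;> linarith [h1.1, h1.2, h2.1, h2.2]

theorem fst_mem_of_run (hv : 0 < v) (hS : 0 < S)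
    (hX : ∀ k ω, IsTrajectory v v (S / v) (startState v S X k ω) (X k ω)) {k : ℕ} {t : ℝ}
    (ht : t ∈ Icc 0 (S / v)) : k * S ≤ (X k ω t).1 ∧ (X k ω t).1 ≤ (k + 1) * S := by
  rw [(hX k ω).fst_eq ht, startState_fst hv hS hX]
  have h1 : 0 ≤ v * t := mul_nonneg hv.le ht.1
  have h2 : v * t ≤ S := by
    have := mul_le_mul_of_nonneg_left ht.2 hv.le
    rwa [mul_div_cancel₀ _ hv.ne'] at this
  constructor <;> linarith

theorem abs_run_sub_startState_le_of_le (hv : 0 < v) (hS : 0 < S)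
    (hX : ∀ k ω, IsTrajectory v v (S / v) (startState v S X k ω) (X k ω)) {k m : ℕ} {t : ℝ}
    (ht : t ∈ Icc 0 (S / v)) (hm : m ≤ k) :
    |(X k ω t).2 - (startState v S X m ω).2| ≤ (X k ω t).1 - m * S := by
  have h := (hX k ω).cone hv (s := 0) (t := t) ⟨le_rfl, by positivity⟩ ht
  have hf := fst_mem_of_run (k := k) (ω := ω) hv hS hX ht
  rw [(hX k ω).apply_zero (by positivity), startState_fst hv hS hX,
    abs_of_nonneg (a := (X k ω t).1 - k * S) (by linarith)] at h
  have h1 := abs_le.1 h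
  have h2 := abs_le.1 (abs_startState_sub_le (ω := ω) hv hS hX hm)
  rw [abs_le]
  constructor <;> linarith [h1.1, h1.2, h2.1, h2.2]

theorem abs_startState_sub_run_le_of_lt (hv : 0 < v) (hS : 0 < S)
    (hX : ∀ k ω, IsTrajectory v v (S / v) (startState v S X k ω) (X k ω)) {k m : ℕ} {t : ℝ}
    (ht : t ∈ Icc 0 (S / v)) (hm : k < m) :
    |(startState v S X m ω).2 - (X k ω t).2| ≤ m * S - (X k ω t).1 := by
  have h := (hX k ω).cone hv (s := t) (t := S / v) ht ⟨by positivity, le_rfl⟩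
  have hf := fst_mem_of_run (k := k) (ω := ω) hv hS hX ht
  have e : (startState v S X (k + 1) ω) = X k ω (S / v) := rfl
  rw [← e, startState_fst hv hS hX] at h
  push_cast at h
  rw [abs_of_nonneg (a := ((k : ℝ) + 1) * S - (X k ω t).1) (by linarith)] at h
  have h1 := abs_le.1 h
  have h2 := abs_le.1 (abs_startState_sub_le (ω := ω) hv hS hX (k := k + 1) hm)
  push_cast at h2
  rw [abs_le]
  constructor <;> linarith [h1.1, h1.2, h2.1, h2.2]

theorem abs_run_sub_run_le (hv : 0 < v) (hS : 0 < S)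
    (hX : ∀ k ω, IsTrajectory v v (S / v) (startState v S X k ω) (X k ω)) {j k : ℕ} {s t : ℝ}
    (hs : s ∈ Icc 0 (S / v)) (ht : t ∈ Icc 0 (S / v)) :
    |(X j ω s).2 - (X k ω t).2| ≤ |(X j ω s).1 - (X k ω t).1| := by
  have key : ∀ {j k : ℕ} {s t : ℝ}, s ∈ Icc 0 (S / v) → t ∈ Icc 0 (S / v) → j < k →
      |(X j ω s).2 - (X k ω t).2| ≤ |(X j ω s).1 - (X k ω t).1| := by
    intro j k s t hs ht hjk
    have h1 := abs_le.1 (abs_startState_sub_run_le_of_lt (ω := ω) hv hS hX hs hjk)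
    have h2 := abs_le.1 (abs_run_sub_startState_le_of_le (ω := ω) hv hS hX ht (le_refl k))
    have h3 := neg_abs_le ((X j ω s).1 - (X k ω t).1)
    rw [abs_le]
    constructor <;> linarith [h1.1, h1.2, h2.1, h2.2]
  rcases lt_trichotomy j k with hjk | rfl | hjk
  · exact key hs ht hjk
  · exact (hX j ω).cone hv ht hs
  · rw [abs_sub_comm, abs_sub_comm (X j ω s).1]
    exact key ht hs hjk

/-- The targets collected over all iterations form one chain from the origin. None is counted twice,
because targets off the lines `x₁ = kS` belong to at most one iteration. -/
theorem sum_collected_le_optimalReward (hv : 0 < v) (hS : 0 < S)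
    (hX : ∀ k ω, IsTrajectory v v (S / v) (startState v S X k ω) (X k ω))
    (hline : ∀ (k : ℕ) i, (p i ω).1 ≠ k * S) (n : ℕ) :
    ∑ k ∈ Finset.range n, collected (fun i => p i ω) (fun i => r i ω) (S / v) (X k ω) ≤
      optimalReward v v (fun i => p i ω) (fun i => r i ω) (n * S) := by
  classical
  let A : ℕ → Set ℕ := fun k => {i | ∃ t ∈ Icc 0 (S / v), X k ω t = p i ω}
  have hA : ∀ k i, i ∈ A k → k * S < (p i ω).1 ∧ (p i ω).1 < (k + 1) * S := by
    rintro k i ⟨t, ht, e⟩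
    have h := fst_mem_of_run (k := k) (ω := ω) hv hS hX ht
    rw [e] at h
    refine ⟨lt_of_le_of_ne h.1 (hline k i).symm, lt_of_le_of_ne h.2 ?_⟩
    exact_mod_cast hline (k + 1) i
  have hdisj : ∀ j k, j ≠ k → Disjoint (A j) (A k) := by
    intro j k hjk
    refine Set.disjoint_left.2 fun i hj hk => hjk ?_
    have h1 : (j : ℝ) < k + 1 :=
      lt_of_mul_lt_mul_right ((hA j i hj).1.trans (hA k i hk).2) hS.le
    have h2 : (k : ℝ) < j + 1 :=
      lt_of_mul_lt_mul_right ((hA k i hk).1.trans (hA j i hj).2) hS.le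
    norm_cast at h1 h2
    omega
  have hcol : ∀ k, collected (fun i => p i ω) (fun i => r i ω) (S / v) (X k ω) =
      ∑' i, (A k).indicator (fun i => (r i ω : ℝ≥0∞)) i := fun k =>
    tsum_subtype (A k) fun i => (r i ω : ℝ≥0∞)
  simp_rw [hcol]
  rw [← Summable.tsum_finsetSum fun _ _ => ENNReal.summable]
  have hU : ∀ i, ∑ k ∈ Finset.range n, (A k).indicator (fun i => (r i ω : ℝ≥0∞)) i =
      (⋃ k ∈ Finset.range n, A k).indicator (fun i => (r i ω : ℝ≥0∞)) i := fun i =>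
    (Finset.indicator_biUnion_apply _ A (fun j _ k _ hjk => hdisj j k hjk) i).symm
  simp_rw [hU]
  rw [optimalReward_eq_chainValue hv (by positivity), ENNReal.tsum_eq_iSup_sum]
  refine iSup_le fun I => ?_
  simp only [indicator_apply]
  rw [← Finset.sum_filter]
  have hmem : ∀ i ∈ I.filter fun i => i ∈ ⋃ k ∈ Finset.range n, A k,
      ∃ k < n, ∃ t ∈ Icc 0 (S / v), X k ω t = p i ω := fun i hi => by
    simpa [A] using (Finset.mem_filter.1 hi).2
  refine le_iSup₂_of_le (I.filter fun i => i ∈ ⋃ k ∈ Finset.range n, A k) ⟨fun i hi => ?_,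
    fun i hi j hj => ?_⟩ le_rfl
  · obtain ⟨k, hk, t, ht, e⟩ := hmem i hi
    have h1 := fst_mem_of_run (k := k) (ω := ω) hv hS hX ht
    have h2 := abs_run_sub_startState_le_of_le (ω := ω) hv hS hX ht (Nat.zero_le k)
    rw [e] at h1 h2
    have h0 : 0 ≤ (p i ω).1 := le_trans (by positivity) h1.1
    refine ⟨⟨h0, h1.2.trans ?_⟩, ?_⟩
    · gcongr
      exact_mod_cast hk
    · simpa [startState, abs_of_nonneg h0] using h2
  · obtain ⟨k, -, t, ht, e⟩ := hmem i hi
    obtain ⟨l, -, s, hs, e'⟩ := hmem j hj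
    simp only [← e, ← e']
    exact abs_run_sub_run_le hv hS hX ht hs

end Concatenation

/-- The mean optimal reward over the longitudinal distance `S`. -/
noncomputable def meanOptimalReward (P : Measure Ω) (v : ℝ) (p : ℕ → Ω → ℝ × ℝ) (r : ℕ → Ω → ℝ≥0)
    (S : ℝ) : ℝ≥0∞ :=
  ∫⁻ ω, optimalReward v v (fun i => p i ω) (fun i => r i ω) S ∂P

theorem IsPoissonRewardField.lintegral_segmentLaw [IsProbabilityMeasure P]
    (h : IsPoissonRewardField P lam F p r) {v S : ℝ} (hv : 0 < v) (hS : 0 < S) {f : ℝ≥0∞ → ℝ≥0∞}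
    (hf : Measurable f) :
    ∫⁻ x, f x ∂segmentLaw P p r S =
      ∫⁻ ω, f (optimalReward v v (fun i => p i ω) (fun i => r i ω) S) ∂P := by
  rw [segmentLaw, lintegral_map hf
    (measurable_gridValue_comp S measurable_const (h.measurable_gridRewards S 0))]
  refine lintegral_congr_ae ?_
  filter_upwards [h.optimalReward_ae_eq hv hS] with ω hω
  rw [hω]

theorem IsPoissonRewardField.lintegral_sq_segmentLaw_le [IsProbabilityMeasure P]
    (h : IsPoissonRewardField P lam F p r) {S : ℝ} (hS : 0 < S) :
    ∫⁻ x, x ^ 2 ∂segmentLaw P p r S ≤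
      ENNReal.ofReal (lam * (2 * S ^ 2) * (lam * (2 * S ^ 2) + 1)) * ∫⁻ s, (s : ℝ≥0∞) ^ 2 ∂F := by
  -- The law of a segment does not involve the speed, which is taken to be `1`.
  rw [h.lintegral_segmentLaw (f := fun x => x ^ 2) one_pos hS (measurable_id.pow_const 2)]
  calc ∫⁻ ω, optimalReward 1 1 (fun i => p i ω) (fun i => r i ω) S ^ 2 ∂P
      ≤ ∫⁻ ω, markSum p r (reachBox S) id ω ^ 2 ∂P := by
        refine lintegral_mono fun ω => ?_
        gcongr
        exact optimalReward_le_markSum one_pos hS.le id ω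
    _ ≤ _ := h.lintegral_markSum_sq_le (measurableSet_reachBox S) (isBounded_reachBox S)
    _ = _ := by
        have hx : 0 ≤ (lam : ℝ) * (2 * S ^ 2) := by positivity
        rw [volume_reachBox hS.le, ENNReal.ofReal_mul hx, ENNReal.ofReal_add hx zero_le_one,
          ENNReal.ofReal_mul lam.coe_nonneg, ENNReal.ofReal_coe_nnreal, ENNReal.ofReal_one]

theorem IsRecedingHorizonRun.measurable_iterationReward_ambient
    (h : IsPoissonRewardField P lam F p r) {v S : ℝ} (hv : 0 < v) (hS : 0 < S)
    {X : ℕ → Ω → ℝ → ℝ × ℝ} (hX : IsRecedingHorizonRun P v v p r S X) (k : ℕ) :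
    Measurable (iterationReward p r v S X k) :=
  (hX.measurable_iterationReward hv hS k.lt_succ_self).mono
    (Measurable.comap_le (measurable_pi_lambda _ fun a => h.measurable_markSum a.2.1 a.2.2.2.2))
    le_rfl

theorem IsRecedingHorizonRun.lintegral_iterationReward [IsProbabilityMeasure P]
    [IsProbabilityMeasure F] (h : IsPoissonRewardField P lam F p r) {v S : ℝ} (hv : 0 < v)
    (hS : 0 < S) {X : ℕ → Ω → ℝ → ℝ × ℝ} (hX : IsRecedingHorizonRun P v v p r S X) (k : ℕ) :
    ∫⁻ ω, iterationReward p r v S X k ω ∂P = meanOptimalReward P v p r S := by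
  rw [meanOptimalReward, ← h.lintegral_segmentLaw (f := fun x => x) hv hS measurable_id',
    ← hX.map_iterationReward h hv hS k,
    lintegral_map measurable_id' (hX.measurable_iterationReward_ambient h hv hS k)]

theorem IsRecedingHorizonRun.lintegral_iterationReward_sq_le [IsProbabilityMeasure P]
    [IsProbabilityMeasure F] (h : IsPoissonRewardField P lam F p r) {v S : ℝ} (hv : 0 < v)
    (hS : 0 < S) {X : ℕ → Ω → ℝ → ℝ × ℝ} (hX : IsRecedingHorizonRun P v v p r S X) (k : ℕ) :
    ∫⁻ ω, iterationReward p r v S X k ω ^ 2 ∂P ≤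
      ENNReal.ofReal (lam * (2 * S ^ 2) * (lam * (2 * S ^ 2) + 1)) * ∫⁻ s, (s : ℝ≥0∞) ^ 2 ∂F := by
  rw [← lintegral_map (f := fun x : ℝ≥0∞ => x ^ 2) (measurable_id.pow_const 2)
    (hX.measurable_iterationReward_ambient h hv hS k), hX.map_iterationReward h hv hS k]
  exact h.lintegral_sq_segmentLaw_le hS

/-- The run itself proves superadditivity: its `n` iterations each have the optimal mean, and
together they are one feasible path of length `nS`. -/
theorem IsRecedingHorizonRun.mul_meanOptimalReward_le [IsProbabilityMeasure P]
    [IsProbabilityMeasure F] (h : IsPoissonRewardField P lam F p r) {v S : ℝ} (hv : 0 < v)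
    (hS : 0 < S) {X : ℕ → Ω → ℝ → ℝ × ℝ} (hX : IsRecedingHorizonRun P v v p r S X) (n : ℕ) :
    n * meanOptimalReward P v p r S ≤ meanOptimalReward P v p r (n * S) := by
  calc n * meanOptimalReward P v p r S
      = ∑ k ∈ Finset.range n, ∫⁻ ω, iterationReward p r v S X k ω ∂P := by
        simp [hX.lintegral_iterationReward h hv hS]
    _ = ∫⁻ ω, ∑ k ∈ Finset.range n, iterationReward p r v S X k ω ∂P :=
        (lintegral_finsetSum _ fun k _ => hX.measurable_iterationReward_ambient h hv hS k).symm
    _ ≤ meanOptimalReward P v p r (n * S) := by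
        refine lintegral_mono_ae ?_
        filter_upwards [hX.collected_ae_eq h hv hS,
          ae_all_iff.2 fun k : ℕ => h.ae_notMem_line (k * S)] with ω hω hline
        rw [Finset.sum_congr rfl fun k _ => (hω k).symm]
        exact sum_collected_le_optimalReward hv hS hX.feasible hline n

theorem meanOptimalReward_mono (P : Measure Ω) {v : ℝ} (hv : 0 < v) (p : ℕ → Ω → ℝ × ℝ)
    (r : ℕ → Ω → ℝ≥0) {S T : ℝ} (hS : 0 ≤ S) (hST : S ≤ T) :
    meanOptimalReward P v p r S ≤ meanOptimalReward P v p r T := by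
  refine lintegral_mono fun ω => ?_
  rw [optimalReward_eq_chainValue hv hS, optimalReward_eq_chainValue hv (hS.trans hST)]
  exact chainValue_mono (D := {q | 0 ≤ q.1 ∧ q.1 ≤ S}) (D' := {q | 0 ≤ q.1 ∧ q.1 ≤ T})
    (fun q hq => ⟨hq.1, hq.2.trans hST⟩) _ _ _

/-- A form of Fekete's lemma for monotone functions. -/
theorem tendsto_div_of_superadditive {G : ℝ → ℝ} {R : ℝ} (hmono : MonotoneOn G (Ioi 0))
    (hmul : ∀ S, 0 < S → ∀ n : ℕ, n * G S ≤ G (n * S)) (hle : ∀ S, 0 < S → G S ≤ R * S)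
    (hlt : ∀ a < R, ∃ S, 0 < S ∧ a * S < G S) :
    Tendsto (fun S => G S / S) atTop (𝓝 R) := by
  refine tendsto_order.2 ⟨fun a ha => ?_, fun b hb => ?_⟩
  · obtain ⟨T, hT, haT⟩ := hlt a ha
    -- A distance `S` holds `⌊S/T⌋` pieces of the nearly optimal length `T`, and the remainder is
    -- negligible; monotonicity of `G` handles it.
    have h1 : Tendsto (fun S : ℝ => (⌊S / T⌋₊ : ℝ) / (S / T) * (G T / T)) atTop (𝓝 (1 * (G T / T))) :=
      (tendsto_nat_floor_div_atTop.comp (tendsto_id.atTop_div_const hT)).mul_const _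
    rw [one_mul] at h1
    filter_upwards [h1.eventually_const_lt ((lt_div_iff₀ hT).2 haT), eventually_ge_atTop T]
      with S hS hTS
    have hS0 : 0 < S := hT.trans_le hTS
    have hfl : (1 : ℝ) ≤ ⌊S / T⌋₊ := by
      exact_mod_cast Nat.le_floor (by simpa using (one_le_div hT).2 hTS)
    have hfs : ⌊S / T⌋₊ * T ≤ S :=
      (le_div_iff₀ hT).1 (Nat.floor_le (by positivity))
    refine hS.trans_le ?_
    have e : (⌊S / T⌋₊ : ℝ) / (S / T) * (G T / T) = ⌊S / T⌋₊ * G T / S := by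
      field_simp
    rw [e]
    gcongr
    exact (hmul T hT _).trans (hmono (mem_Ioi.2 (by positivity)) hS0 hfs)
  · filter_upwards [eventually_gt_atTop 0] with S hS
    exact ((div_le_iff₀ hS).2 (hle S hS)).trans_lt hb

/-! ### Law of large numbers with a logarithmic horizon -/

/-- Chebyshev's inequality for a sum of pairwise independent variables with a common mean. -/
theorem measure_le_abs_sum_sub_le [IsProbabilityMeasure P] {Y : ℕ → Ω → ℝ} {g m : ℝ}
    (hL2 : ∀ k, MemLp (Y k) 2 P) (hmean : ∀ k, ∫ ω, Y k ω ∂P = g)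
    (hsq : ∀ k, ∫ ω, Y k ω ^ 2 ∂P ≤ m) (hind : ∀ j k, j < k → IndepFun (Y j) (Y k) P) (N : ℕ)
    {a : ℝ} (ha : 0 < a) :
    P {ω | a ≤ |∑ k ∈ Finset.range N, Y k ω - N * g|} ≤ ENNReal.ofReal (N * m / a ^ 2) := by
  have hsum : MemLp (∑ k ∈ Finset.range N, Y k) 2 P := memLp_finsetSum' _ fun k _ => hL2 k
  have hE : ∫ ω, (∑ k ∈ Finset.range N, Y k) ω ∂P = N * g := by
    simp only [Finset.sum_apply]
    rw [integral_finsetSum _ fun k _ => (hL2 k).integrable one_le_two]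
    simp [hmean]
  have hV : variance (∑ k ∈ Finset.range N, Y k) P ≤ N * m := by
    rw [IndepFun.variance_sum (fun k _ => hL2 k) fun j _ k _ hjk =>
      (lt_or_gt_of_ne hjk).elim (hind j k) fun hkj => (hind k j hkj).symm]
    calc ∑ k ∈ Finset.range N, variance (Y k) P ≤ ∑ k ∈ Finset.range N, m :=
          Finset.sum_le_sum fun k _ =>
            (variance_le_expectation_sq (hL2 k).aestronglyMeasurable).trans (hsq k)
      _ = N * m := by simp
  have h := meas_ge_le_variance_div_sq hsum ha
  rw [hE] at h
  simp only [Finset.sum_apply] at h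
  exact h.trans (ENNReal.ofReal_le_ofReal (by gcongr))

theorem edist_eq_ofReal_abs_toReal_sub {a b : ℝ≥0∞} (ha : a ≠ ∞) (hb : b ≠ ∞) :
    edist a b = ENNReal.ofReal |a.toReal - b.toReal| := by
  lift a to ℝ≥0 using ha
  lift b to ℝ≥0 using hb
  have h : edist (a : ℝ≥0∞) b = edist a b := rfl
  rw [h, edist_dist]
  rfl

theorem tendsto_div_log_atTop : Tendsto (fun L : ℝ => L / Real.log L) atTop atTop := by
  have h : Tendsto (fun L : ℝ => Real.log L / L) atTop (𝓝[>] 0) := by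
    refine tendsto_nhdsWithin_iff.2
      ⟨Real.isLittleO_log_id_atTop.tendsto_div_nhds_zero, ?_⟩
    filter_upwards [eventually_gt_atTop 1] with L hL
    exact div_pos (Real.log_pos hL) (by linarith)
  refine h.inv_tendsto_nhdsGT_zero.congr fun L => ?_
  simp [inv_div]

theorem tendsto_natCeil_mul_log_div :
    Tendsto (fun L : ℝ => (⌈L / Real.log L⌉₊ : ℝ) * Real.log L / L) atTop (𝓝 1) := by
  refine (tendsto_nat_ceil_div_atTop.comp tendsto_div_log_atTop).congr fun L => ?_
  simp [div_eq_mul_inv, mul_assoc, mul_comm]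

theorem meanOptimalReward_le (P : Measure Ω) (v : ℝ) (p : ℕ → Ω → ℝ × ℝ) (r : ℕ → Ω → ℝ≥0)
    {S : ℝ} (hS : 0 < S) :
    meanOptimalReward P v p r S ≤ optimalMeanReward P v v p r * ENNReal.ofReal S := by
  refine (ENNReal.div_le_iff_le_mul (.inl (ENNReal.ofReal_pos.2 hS).ne') (.inl ENNReal.ofReal_ne_top)).1 ?_
  exact le_iSup₂_of_le S hS le_rfl

/-- A run at each horizon is assumed because superadditivity at `S` is read off from a run with that
horizon. -/
theorem tendsto_meanOptimalReward_div [IsProbabilityMeasure P] [IsProbabilityMeasure F]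
    (h : IsPoissonRewardField P lam F p r) {v : ℝ} (hv : 0 < v)
    (hR : optimalMeanReward P v v p r < ∞) {X : ℝ → ℕ → Ω → ℝ → ℝ × ℝ}
    (hX : ∀ S, 0 < S → IsRecedingHorizonRun P v v p r S (X S)) :
    Tendsto (fun S => (meanOptimalReward P v p r S).toReal / S) atTop
      (𝓝 (optimalMeanReward P v v p r).toReal) := by
  have hfin : ∀ S, 0 < S → meanOptimalReward P v p r S ≠ ∞ := fun S hS =>
    ne_top_of_le_ne_top (ENNReal.mul_ne_top hR.ne ENNReal.ofReal_ne_top)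
      (meanOptimalReward_le P v p r hS)
  refine tendsto_div_of_superadditive (fun S hS T hT hST => ?_) (fun S hS n => ?_)
    (fun S hS => ?_) fun a ha => ?_
  · exact ENNReal.toReal_mono (hfin T hT) (meanOptimalReward_mono P hv p r (le_of_lt hS) hST)
  · rcases n.eq_zero_or_pos with rfl | hn
    · simp
    · have h1 := ENNReal.toReal_mono (hfin (n * S) (by positivity))
        ((hX S hS).mul_meanOptimalReward_le h hv hS n)
      simpa using h1
  · have h1 := ENNReal.toReal_mono (ENNReal.mul_ne_top hR.ne ENNReal.ofReal_ne_top)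
      (meanOptimalReward_le P v p r hS)
    simpa [ENNReal.toReal_ofReal hS.le] using h1
  · rcases lt_or_ge a 0 with ha0 | ha0
    · exact ⟨1, one_pos, by linarith [ENNReal.toReal_nonneg (a := meanOptimalReward P v p r 1)]⟩
    · have h1 : ENNReal.ofReal a < optimalMeanReward P v v p r :=
        (ENNReal.ofReal_lt_iff_lt_toReal ha0 hR.ne).2 ha
      obtain ⟨S, h2⟩ := lt_iSup_iff.1 h1
      obtain ⟨hS, h3⟩ := lt_iSup_iff.1 h2
      refine ⟨S, hS, ?_⟩
      rw [← ENNReal.ofReal_lt_iff_lt_toReal (by positivity) (hfin S hS), ENNReal.ofReal_mul ha0]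
      exact (ENNReal.lt_div_iff_mul_lt (.inl (ENNReal.ofReal_pos.2 hS).ne')
        (.inl ENNReal.ofReal_ne_top)).1 h3

theorem IsRecedingHorizonRun.measure_le_abs_sum_sub_le [IsProbabilityMeasure P]
    [IsProbabilityMeasure F] (h : IsPoissonRewardField P lam F p r)
    (hF : ∫⁻ s, (s : ℝ≥0∞) ^ 2 ∂F < ∞) {v S : ℝ} (hv : 0 < v)
    (hS : 0 < S) {X : ℕ → Ω → ℝ → ℝ × ℝ} (hX : IsRecedingHorizonRun P v v p r S X) (N : ℕ) {a : ℝ}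
    (ha : 0 < a) :
    P {ω | a ≤ |∑ k ∈ Finset.range N, (iterationReward p r v S X k ω).toReal -
        N * (meanOptimalReward P v p r S).toReal|} ≤
      ENNReal.ofReal (N * (lam * (2 * S ^ 2) * (lam * (2 * S ^ 2) + 1) *
        (∫⁻ s, (s : ℝ≥0∞) ^ 2 ∂F).toReal) / a ^ 2) := by
  have hm := hX.measurable_iterationReward_ambient h hv hS
  have hsq := hX.lintegral_iterationReward_sq_le h hv hS
  have htop := ENNReal.mul_ne_top (ENNReal.ofReal_ne_top
    (r := lam * (2 * S ^ 2) * (lam * (2 * S ^ 2) + 1))) hF.ne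
  have hfin : ∀ k, ∫⁻ ω, iterationReward p r v S X k ω ^ 2 ∂P ≠ ∞ := fun k =>
    ne_top_of_le_ne_top htop (hsq k)
  have hae : ∀ k, ∀ᵐ ω ∂P, iterationReward p r v S X k ω < ∞ := fun k => by
    filter_upwards [ae_lt_top ((hm k).pow_const 2) (hfin k)] with ω hω
    simpa using hω
  refine RewardField.measure_le_abs_sum_sub_le (fun k => ?_) (fun k => ?_) (fun k => ?_)
    (fun j k hjk => ?_) N ha
  · refine (memLp_two_iff_integrable_sq (hm k).ennreal_toReal.aestronglyMeasurable).2 ?_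
    simpa using integrable_toReal_of_lintegral_ne_top ((hm k).pow_const 2).aemeasurable (hfin k)
  · rw [integral_toReal (hm k).aemeasurable (hae k), hX.lintegral_iterationReward h hv hS]
  · have e := integral_toReal ((hm k).pow_const 2).aemeasurable
      (ae_lt_top ((hm k).pow_const 2) (hfin k))
    simp only [ENNReal.toReal_pow] at e
    rw [e]
    refine (ENNReal.toReal_mono htop (hsq k)).trans_eq ?_
    rw [ENNReal.toReal_mul, ENNReal.toReal_ofReal (by positivity)]
  · exact (hX.indepFun_iterationReward h hv hS hjk).comp ENNReal.measurable_toReal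
      ENNReal.measurable_toReal

/-- The number of iterations is asymptotic to `L / log L` and the moment bound is of order `log⁴ L`,
so the quotient is of order `log³ L / L`. -/
theorem tendsto_natCeil_mul_polynomial_log_div_sq (a b : ℝ) :
    Tendsto (fun L : ℝ => ⌈L / Real.log L⌉₊ *
      (a * (2 * Real.log L ^ 2) * (a * (2 * Real.log L ^ 2) + 1) * b) / L ^ 2) atTop (𝓝 0) := by
  have h3 : Tendsto (fun L : ℝ => Real.log L ^ 3 / L) atTop (𝓝 0) :=
    Real.isLittleO_pow_log_id_atTop.tendsto_div_nhds_zero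
  have h1 : Tendsto (fun L : ℝ => Real.log L / L) atTop (𝓝 0) :=
    Real.isLittleO_log_id_atTop.tendsto_div_nhds_zero
  have h := tendsto_natCeil_mul_log_div.mul
    ((h3.const_mul (4 * a ^ 2 * b)).add (h1.const_mul (2 * a * b)))
  simp only [mul_zero, add_zero] at h
  refine h.congr' ?_
  filter_upwards [eventually_gt_atTop 1] with L hL
  have := Real.log_pos hL
  have : L ≠ 0 := by linarith
  field_simp
  ring

theorem tendstoInMeasure_meanReward [IsProbabilityMeasure P] [IsProbabilityMeasure F]
    (h : IsPoissonRewardField P lam F p r) (hF : ∫⁻ s, (s : ℝ≥0∞) ^ 2 ∂F < ∞) {v : ℝ} (hv : 0 < v)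
    (hR : optimalMeanReward P v v p r < ∞) {X : ℝ → ℕ → Ω → ℝ → ℝ × ℝ}
    (hX : ∀ L, 1 < L → IsRecedingHorizonRun P v v p r (Real.log L) (X L)) :
    TendstoInMeasure P (fun L ω => meanReward v p r L (Real.log L) (X L) ω) atTop
      (fun _ => optimalMeanReward P v v p r) := by
  -- Every horizon `S > 0` is the logarithm of some `L > 1`, so the given runs supply one for each
  -- horizon.
  have hG := tendsto_meanOptimalReward_div h hv hR (X := fun S => X (Real.exp S)) fun S hS => by
    simpa using hX (Real.exp S) (Real.one_lt_exp_iff.2 hS)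
  have hNG : Tendsto (fun L : ℝ => ⌈L / Real.log L⌉₊ *
      (meanOptimalReward P v p r (Real.log L)).toReal / L) atTop
      (𝓝 (optimalMeanReward P v v p r).toReal) := by
    have h1 := tendsto_natCeil_mul_log_div.mul (hG.comp Real.tendsto_log_atTop)
    rw [one_mul] at h1
    refine h1.congr' ?_
    filter_upwards [eventually_gt_atTop 1] with L hL
    have := (Real.log_pos hL).ne'
    simp only [Function.comp]
    field_simp
  refine tendstoInMeasure_of_ne_top fun ε hε hε' => ?_
  have hδ : 0 < ε.toReal := ENNReal.toReal_pos hε.ne' hε'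
  have hbound := ENNReal.tendsto_ofReal ((tendsto_natCeil_mul_polynomial_log_div_sq lam
    (∫⁻ s, (s : ℝ≥0∞) ^ 2 ∂F).toReal).mul_const ((ε.toReal / 2) ^ 2)⁻¹)
  rw [zero_mul, ENNReal.ofReal_zero] at hbound
  refine tendsto_of_tendsto_of_tendsto_of_le_of_le' tendsto_const_nhds hbound
    (Eventually.of_forall fun _ => zero_le) ?_
  -- Half of the tolerance absorbs the distance from the mean to the limit, the other half is left
  -- to the fluctuation of the sum.
  filter_upwards [Metric.tendsto_nhds.1 hNG (ε.toReal / 2) (by positivity), eventually_gt_atTop 1]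
    with L hclose hL
  have hL0 : 0 < L := by linarith
  have hS := Real.log_pos hL
  have hY := (hX L hL).measure_le_abs_sum_sub_le h hF hv hS ⌈L / Real.log L⌉₊
    (a := L * (ε.toReal / 2)) (by positivity)
  have hm := (hX L hL).measurable_iterationReward_ambient h hv hS
  have hae : ∀ᵐ ω ∂P, ∀ k, iterationReward p r v (Real.log L) (X L) k ω < ∞ := by
    refine ae_all_iff.2 fun k => ae_lt_top (hm k) ?_
    rw [(hX L hL).lintegral_iterationReward h hv hS]
    exact ne_top_of_le_ne_top (ENNReal.mul_ne_top hR.ne ENNReal.ofReal_ne_top)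
      (meanOptimalReward_le P v p r hS)
  refine (measure_mono_ae ?_).trans (hY.trans_eq ?_)
  · filter_upwards [hae, (hX L hL).collected_ae_eq h hv hS] with ω hω hcol hmem
    have hmem' : ε ≤ edist (meanReward v p r L (Real.log L) (X L) ω)
      (optimalMeanReward P v v p r) := hmem
    have e : meanReward v p r L (Real.log L) (X L) ω =
        (∑ k ∈ Finset.range ⌈L / Real.log L⌉₊, iterationReward p r v (Real.log L) (X L) k ω) /
          ENNReal.ofReal L := by
      rw [meanReward, Finset.sum_congr rfl fun k _ => hcol k]
    have hne : ∑ k ∈ Finset.range ⌈L / Real.log L⌉₊, iterationReward p r v (Real.log L) (X L) k ω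
        ≠ ∞ := ENNReal.sum_ne_top.2 fun k _ => (hω k).ne
    rw [e, edist_eq_ofReal_abs_toReal_sub
      (ENNReal.div_ne_top hne (ENNReal.ofReal_pos.2 hL0).ne') hR.ne, ENNReal.toReal_div,
      ENNReal.toReal_sum fun k _ => (hω k).ne, ENNReal.toReal_ofReal hL0.le,
      ENNReal.le_ofReal_iff_toReal_le hε' (abs_nonneg _)] at hmem'
    rw [Real.dist_eq] at hclose
    change L * (ε.toReal / 2) ≤ |_ - _|
    set Y := ∑ k ∈ Finset.range ⌈L / Real.log L⌉₊,
      (iterationReward p r v (Real.log L) (X L) k ω).toReal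
    set M := ⌈L / Real.log L⌉₊ * (meanOptimalReward P v p r (Real.log L)).toReal
    have h1 := abs_sub_le (Y / L) (M / L) (optimalMeanReward P v v p r).toReal
    have h2 : ε.toReal / 2 ≤ |Y - M| / L := by
      have h3 : |Y - M| / L = |Y / L - M / L| := by rw [← sub_div, abs_div, abs_of_pos hL0]
      rw [h3]
      linarith
    rw [le_div_iff₀ hL0] at h2
    linarith
  · congr 1
    field_simp

end RewardField

theorem mainTheorem4 {Ω : Type*} [MeasurableSpace Ω] (P : Measure Ω) [IsProbabilityMeasure P]
    (lam : ℝ≥0) (hlam : 0 < lam)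
    (F : Measure ℝ≥0) [IsProbabilityMeasure F]
    (hF : ∫⁻ s in Ioi (0 : ℝ), (F {x : ℝ≥0 | s < (x : ℝ)}) ^ (1 / 2 : ℝ) < ∞)
    (p : ℕ → Ω → ℝ × ℝ) (r : ℕ → Ω → ℝ≥0)
    (hfield : RewardField.IsPoissonRewardField P lam F p r)
    (v : ℝ) (hv : 0 < v) :
    RewardField.optimalMeanReward P v v p r < ∞ ∧
    ∃ c : ℝ, 0 < c ∧
      ∀ X : ℝ → ℕ → Ω → ℝ → ℝ × ℝ,
        (∀ L : ℝ, 1 < L →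
          RewardField.IsRecedingHorizonRun P v v p r (c * Real.log L) (X L)) →
        TendstoInMeasure P
          (fun (L : ℝ) (ω : Ω) => RewardField.meanReward v p r L (c * Real.log L) (X L) ω)
          atTop (fun _ => RewardField.optimalMeanReward P v v p r) := by
  -- The value of the constant is immaterial: what matters is that the horizon tends to infinity
  -- while its cube is negligible against `L`.
  refine ⟨hfield.optimalMeanReward_lt_top hv hF, 1, one_pos, fun X hX => ?_⟩
  simp only [one_mul] at hX ⊢
  exact RewardField.tendstoInMeasure_meanReward hfield (RewardField.lintegral_sq_lt_top hF) hv
    (hfield.optimalMeanReward_lt_top hv hF) hX
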